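/- **Theorem (the 3-dimensional calculus on the quantum Hopf fibration is complete).** Let $q\in\mathbb C$, $q\neq 0$, $q^2\neq -1$. *Algebras.* Let $A=\mathcal O_q(SU(2))$ be the unital $\mathbb C$-algebra generated by $\alpha,\beta,\gamma,\delta$ with relations $\beta\alpha=q\alpha\beta$, $\gamma\alpha=q\alpha\gamma$, $\delta\beta=q\beta\delta$, $\delta\gamma=q\gamma\delta$, $\gamma\beta=\beta\gamma$, $\delta\alpha-\alpha\delta=(q-q^{-1})\beta\gamma$, $\alpha\delta-q^{-1}\beta\gamma=1$. Let $H=\mathcal O(U(1))=\mathbb C[t,t^{-1}]$ with $\Delta t=t\otimes t$, put $|\alpha|=|\gamma|=1$, $|\beta|=|\delta|=-1$, and let $\Delta_A:A\to A\otimes H$ be the algebra map with $\Delta_A(f)=f\otimes t^{|f|}$ for $f\in\{\alpha,\beta,\gamma,\delta\}$. Let $B=A^{\mathrm{co}H}$ (the Podleś sphere). *Conventions.* A differential calculus over an algebra $C$ is a differential $\mathbb N_0$-graded algebra $(\Omega^\bullet,\wedge,d)$ with $\Omega^0=C$ and $\Omega^k=\mathrm{span}\{c^0dc^1\wedge\dots\wedge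 dc^k\}$. Tensor products of differential graded algebras carry the product $(\omega\otimes\eta)(\omega'\otimes\eta')=(-1)^{|\eta||\omega'|}\omega\omega'\otimes\eta\eta'$ and the differential $d(\omega\otimes\eta)=d\omega\otimes\eta+(-1)^{|\omega|}\omega\otimes d\eta$. A calculus $\Omega^\bullet(A)$ is complete, with respect to a calculus $\Omega^\bullet(H)$, if $B\subseteq A$ is a quantum principal bundle (i.e. $A$ is a right $H$-comodule algebra, faithfully flat as a left $B$-module, and $A\otimes_BA\to A\otimes H$, $a\otimes a'\mapsto a\Delta_A(a')$, is bijective) and $\Delta_A$ extends to a morphism $\Delta_A^\wedge:\Omega^\bullet(A)\to\Omega^\bullet(A)\otimes\Omega^\bullet(H)$ of differential graded algebras. Its components are $\mathfrak{ver}^{k,\ell}=(\pi^k\otimes\pi^\ell)\circ\Delta_A^\wedge|_{\Omega^{k+\ell}(A)}$, and $\Delta_{\Omega^k(A)}=\mathfrak{ver}^{k,0}$. *Calculus on $H$.* Let $\Omega^\bullet(H)$ be the algebra generated by $t,t^{-1},dt$ with the relations $tt^{-1}=t^{-1}t=1$, $dt\,t=q^2\,t\,dt$, $dt\wedge dt=-q^2dt\wedge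 dt$. With the differential with $d(t)=dt$ it is a differential calculus; $\Omega^1(H)$ is the free left $H$-module on $dt$, $\Omega^k(H)=0$ for $k\ge2$, it is the maximal prolongation of its first order part, it is left and right covariant, and the coproduct of $H$ extends to a morphism $\Omega^\bullet(H)\to\Omega^\bullet(H)\otimes\Omega^\bullet(H)$ of differential graded algebras. *Calculus on $A$.* Let $\Omega^\bullet(A)$ be the graded algebra generated by $A$ in degree $0$ and $e^+,e^-,e^0$ in degree $1$ with the relations $e^\pm f=q^{|f|}fe^\pm$, $e^0f=q^{2|f|}fe^0$ for $f\in\{\alpha,\beta,\gamma,\delta\}$, and $$e^+\wedge e^-=-q^{-2}e^-\wedge e^+,\qquad e^\pm\wedge e^0=-q^{\mp4}e^0\wedge e^\pm,\qquad e^\pm\wedge e^\pm=e^0\wedge e^0=0 .$$ Then there is a differential $d$ on $\Omega^\bullet(A)$ such that the following hold. 1. $(\Omega^\bullet(A),\wedge,d)$ is a differential calculus over $A$, and $e^+=q^{-1}\alpha\,d\gamma-q^{-2}\gamma\,d\alpha$, $e^-=\delta\,d\beta-q\beta\,d\delta$, $e^0=\delta\,d\alpha-q\beta\,d\gamma$.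 2. $de^0=q^3e^+\wedge e^-$, $de^\pm=\mp q^{\pm2}(1+q^{-2})\,e^\pm\wedge e^0$, and $d(e^+\wedge e^-)=-q^{-2}d(e^-\wedge e^+)$, $d(e^\pm\wedge e^0)=-q^{\mp4}d(e^0\wedge e^\pm)$. 3. $\Omega^1(A)$, $\Omega^2(A)$, $\Omega^3(A)$ are free left $A$-modules with bases $\{e^+,e^-,e^0\}$, $\{e^+\wedge e^-,e^+\wedge e^0,e^-\wedge e^0\}$, $\{e^+\wedge e^-\wedge e^0\}$, and $\Omega^k(A)=0$ for $k>3$. 4. $\Omega^\bullet(A)$ is complete with respect to $\Omega^\bullet(H)$. 5. For every morphism $\Delta^\wedge_A$ of differential graded algebras that extends $\Delta_A$, the components are left linear along $\Delta_A$, $\mathfrak{ver}^{k,\ell}(a\omega)=\Delta_A(a)\,\mathfrak{ver}^{k,\ell}(\omega)$, and have the values - $\Delta_{\Omega^1(A)}(e^\pm)=e^\pm\otimes t^{\pm2}$, $\Delta_{\Omega^1(A)}(e^0)=e^0\otimes1$, $\mathfrak{ver}^{0,1}(e^\pm)=0$, $\mathfrak{ver}^{0,1}(e^0)=1\otimes t^{-1}dt$;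 - $\Delta_{\Omega^2(A)}(e^+\wedge e^-)=e^+\wedge e^-\otimes1$, $\Delta_{\Omega^2(A)}(e^\pm\wedge e^0)=e^\pm\wedge e^0\otimes t^{\pm2}$, $\mathfrak{ver}^{1,1}(e^+\wedge e^-)=0$, $\mathfrak{ver}^{1,1}(e^\pm\wedge e^0)=e^\pm\otimes t^{\pm2-1}dt$, $\mathfrak{ver}^{0,2}=0$; - $\Delta_{\Omega^3(A)}(e^+\wedge e^-\wedge e^0)=e^+\wedge e^-\wedge e^0\otimes1$, $\mathfrak{ver}^{2,1}(e^+\wedge e^-\wedge e^0)=e^+\wedge e^-\otimes t^{-1}dt$, $\mathfrak{ver}^{1,2}=\mathfrak{ver}^{0,3}=0$; and the maps $\Delta_{\Omega^k(A)}$ form a right $H$-coaction by algebra maps, extending $\Delta_A$, for which $d$ is right $H$-colinear. -/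

import Mathlib

open scoped TensorProduct LaurentPolynomial DirectSum

noncomputable section

namespace QHopf

universe u

/-! ## Comodule algebras and quantum principal bundles -/

section Bundles

variable {k : Type u} [Field k] {A H : Type u} [Ring A] [Algebra k A] [Ring H] [HopfAlgebra k H]

/-- A right coaction `V → V ⊗ H`: coassociative and counital. -/
structure IsRightCoaction {V : Type*} [AddCommGroup V] [Module k V]
    (ρ : V →ₗ[k] V ⊗[k] H) : Prop where
  coassoc : ∀ v, TensorProduct.assoc k V H H (TensorProduct.map ρ LinearMap.id (ρ v)) =
    TensorProduct.map LinearMap.id Coalgebra.comul (ρ v)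
  counit : ∀ v, TensorProduct.rid k V (TensorProduct.map LinearMap.id Coalgebra.counit (ρ v)) = v

/-- A left coaction `V → H ⊗ V`: coassociative and counital. -/
structure IsLeftCoaction {V : Type*} [AddCommGroup V] [Module k V]
    (l : V →ₗ[k] H ⊗[k] V) : Prop where
  coassoc : ∀ v, TensorProduct.assoc k H H V
    (TensorProduct.map Coalgebra.comul LinearMap.id (l v)) =
      TensorProduct.map LinearMap.id l (l v)
  counit : ∀ v, TensorProduct.lid k V (TensorProduct.map Coalgebra.counit LinearMap.id (l v)) = v

/-- The subalgebra `A^{co H} = {a | ρ a = a ⊗ 1}` of coinvariants. -/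
def coinvariants (ρ : A →ₐ[k] A ⊗[k] H) : Subalgebra k A :=
  AlgHom.equalizer ρ Algebra.TensorProduct.includeLeft

/-- The relations `a b ⊗ a' = a ⊗ b a'`, `b` coinvariant, that cut `A ⊗_B A` out of `A ⊗ A`. -/
def galoisRel (ρ : A →ₐ[k] A ⊗[k] H) : Submodule k (A ⊗[k] A) :=
  Submodule.span k {z | ∃ a a' : A, ∃ b ∈ coinvariants ρ,
    z = (a * b) ⊗ₜ[k] a' - a ⊗ₜ[k] (b * a')}

/-- `a ⊗ a' ↦ a a'₀ ⊗ a'₁` on `A ⊗ A`. -/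
def preGaloisMap (ρ : A →ₐ[k] A ⊗[k] H) : A ⊗[k] A →ₗ[k] A ⊗[k] H :=
  LinearMap.mul' k (A ⊗[k] H) ∘ₗ
    TensorProduct.map (Algebra.TensorProduct.includeLeft : A →ₐ[k] A ⊗[k] H).toLinearMap
      ρ.toLinearMap

theorem galoisRel_le (ρ : A →ₐ[k] A ⊗[k] H) : galoisRel ρ ≤ LinearMap.ker (preGaloisMap ρ) := by
  refine Submodule.span_le.2 ?_
  rintro _ ⟨a, a', b, hb, rfl⟩
  have hb' : ρ b = b ⊗ₜ[k] 1 := hb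
  simp [preGaloisMap, hb', ← mul_assoc]

/-- The canonical map `χ : A ⊗_B A → A ⊗ H`, `χ (a ⊗ a') = a a'₀ ⊗ a'₁`. -/
def galoisMap (ρ : A →ₐ[k] A ⊗[k] H) : ((A ⊗[k] A) ⧸ galoisRel ρ) →ₗ[k] A ⊗[k] H :=
  (galoisRel ρ).liftQ (preGaloisMap ρ) (galoisRel_le ρ)

end Bundles

section FaithfullyFlat

variable (k : Type u) [Field k] (B : Type u) [Ring B] [Algebra k B]
variable (M : Type u) [AddCommGroup M] [Module k M] [Module B M]

/-- The relations `x b ⊗ m = x ⊗ b m` for a right `B`-module `X` and a left `B`-module `M`. -/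
def balancedRel (X : Type u) [AddCommGroup X] [Module k X] [Module Bᵐᵒᵖ X] :
    Submodule k (X ⊗[k] M) :=
  Submodule.span k {z | ∃ (x : X) (b : B) (m : M),
    z = (MulOpposite.op b • x) ⊗ₜ[k] m - x ⊗ₜ[k] (b • m)}

/-- The tensor product `X ⊗_B M` over a noncommutative `k`-algebra `B`. -/
abbrev BalancedTensor (X : Type u) [AddCommGroup X] [Module k X] [Module Bᵐᵒᵖ X] : Type u :=
  (X ⊗[k] M) ⧸ balancedRel k B M X

variable {X Y : Type u} [AddCommGroup X] [Module k X] [Module Bᵐᵒᵖ X] [IsScalarTower k Bᵐᵒᵖ X]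
  [AddCommGroup Y] [Module k Y] [Module Bᵐᵒᵖ Y] [IsScalarTower k Bᵐᵒᵖ Y]

theorem balancedRel_le (f : X →ₗ[Bᵐᵒᵖ] Y) : balancedRel k B M X ≤
    (balancedRel k B M Y).comap (TensorProduct.map (f.restrictScalars k) LinearMap.id) := by
  refine Submodule.span_le.2 ?_
  rintro _ ⟨x, b, m, rfl⟩
  refine Submodule.subset_span ⟨f x, b, m, ?_⟩
  simp

/-- `f ⊗_B M : X ⊗_B M → Y ⊗_B M`. -/
def balancedMap (f : X →ₗ[Bᵐᵒᵖ] Y) : BalancedTensor k B M X →ₗ[k] BalancedTensor k B M Y :=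
  Submodule.mapQ _ _ (TensorProduct.map (f.restrictScalars k) LinearMap.id)
    (balancedRel_le k B M f)

/-- The left `B`-module `M` is faithfully flat: a sequence `0 → X → Y → Z → 0` of right
`B`-modules is exact if and only if `0 → X ⊗_B M → Y ⊗_B M → Z ⊗_B M → 0` is. -/
def IsFaithfullyFlat : Prop :=
  ∀ (X Y Z : Type u) [AddCommGroup X] [Module k X] [Module Bᵐᵒᵖ X] [IsScalarTower k Bᵐᵒᵖ X]
    [AddCommGroup Y] [Module k Y] [Module Bᵐᵒᵖ Y] [IsScalarTower k Bᵐᵒᵖ Y]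
    [AddCommGroup Z] [Module k Z] [Module Bᵐᵒᵖ Z] [IsScalarTower k Bᵐᵒᵖ Z]
    (f : X →ₗ[Bᵐᵒᵖ] Y) (g : Y →ₗ[Bᵐᵒᵖ] Z),
    (Function.Injective f ∧ Function.Exact f g ∧ Function.Surjective g) ↔
      (Function.Injective (balancedMap k B M f) ∧
        Function.Exact (balancedMap k B M f) (balancedMap k B M g) ∧
        Function.Surjective (balancedMap k B M g))

end FaithfullyFlat

section Calculi

variable {k : Type u} [Field k] {A H : Type u} [Ring A] [Algebra k A] [Ring H] [HopfAlgebra k H]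

/-- A quantum principal bundle: a right `H`-comodule algebra `A` such that `A^{co H} ⊆ A` is a
faithfully flat Hopf-Galois extension. -/
structure IsQuantumPrincipalBundle (ρ : A →ₐ[k] A ⊗[k] H) : Prop where
  coaction : IsRightCoaction ρ.toLinearMap
  hopfGalois : Function.Bijective (galoisMap ρ)
  faithfullyFlat : IsFaithfullyFlat k (coinvariants ρ) A

/-! ## Differential calculi -/

variable {Ω Θ : Type u} [Ring Ω] [Algebra k Ω] [Ring Θ] [Algebra k Θ]

/-- `(Ω, d)` with the grading `gr` is a differential calculus over `A`, where `ι` identifies `A`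
with `Ω⁰`: a differential graded algebra generated in degree zero. -/
structure IsDifferentialCalculus (ι : A →ₐ[k] Ω) (gr : ℕ → Submodule k Ω) [GradedAlgebra gr]
    (d : Ω →ₗ[k] Ω) : Prop where
  injective : Function.Injective ι
  range_eq : LinearMap.range ι.toLinearMap = gr 0
  degree : ∀ n, ∀ ω ∈ gr n, d ω ∈ gr (n + 1)
  d_d : ∀ ω, d (d ω) = 0
  leibniz : ∀ n, ∀ ω ∈ gr n, ∀ η, d (ω * η) = d ω * η + (-1 : k) ^ n • (ω * d η)
  generated : ∀ n, gr n = Submodule.span k (Set.range fun a : A × (Fin n → A) =>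
    ι a.1 * (List.ofFn fun i => d (ι (a.2 i))).prod)

/-- The grading involution `ω ↦ (-1)^{|ω|} ω`. -/
def gradeInvolution (gr : ℕ → Submodule k Ω) [GradedAlgebra gr] : Ω →ₗ[k] Ω :=
  DirectSum.toModule k ℕ Ω (fun n => (-1 : k) ^ n • (gr n).subtype) ∘ₗ
    (DirectSum.decomposeLinearEquiv gr).toLinearMap

/-- The differential `ω ⊗ η ↦ dω ⊗ η + (-1)^{|ω|} ω ⊗ dη` of a tensor product. -/
def tensorDifferential (gr : ℕ → Submodule k Ω) [GradedAlgebra gr] (d : Ω →ₗ[k] Ω)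
    (d' : Θ →ₗ[k] Θ) : Ω ⊗[k] Θ →ₗ[k] Ω ⊗[k] Θ :=
  TensorProduct.map d LinearMap.id + TensorProduct.map (gradeInvolution gr) d'

/-- The part `⊕_{i + j = n} Ωⁱ ⊗ Θʲ` of degree `n` of a tensor product. -/
def tensorDegree (gr : ℕ → Submodule k Ω) (gr' : ℕ → Submodule k Θ) (n : ℕ) :
    Submodule k (Ω ⊗[k] Θ) :=
  ⨆ p ∈ Finset.HasAntidiagonal.antidiagonal n, Submodule.map₂ (TensorProduct.mk k Ω Θ) (gr p.1) (gr' p.2)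

/-- `Φ : Ω(A) → Ω(A) ⊗ Ω(H)` is a morphism of differential graded algebras that extends the
algebra map `ρ : A → A ⊗ H`. The target carries the graded product
`(ω ⊗ η)(ω' ⊗ η') = (-1)^{|η||ω'|} ωω' ⊗ ηη'`. -/
structure IsDGExtension (ρ : A →ₐ[k] A ⊗[k] H)
    (ι : A →ₐ[k] Ω) (gr : ℕ → Submodule k Ω) [GradedAlgebra gr] (d : Ω →ₗ[k] Ω)
    (ι' : H →ₐ[k] Θ) (gr' : ℕ → Submodule k Θ) [GradedAlgebra gr'] (d' : Θ →ₗ[k] Θ)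
    (Φ : Ω →ₐ[k] GradedTensorProduct k gr gr') : Prop where
  extends_coaction : ∀ a, (GradedTensorProduct.of k gr gr').symm (Φ (ι a)) =
    Algebra.TensorProduct.map ι ι' (ρ a)
  degree : ∀ n, ∀ ω ∈ gr n,
    (GradedTensorProduct.of k gr gr').symm (Φ ω) ∈ tensorDegree gr gr' n
  differential : ∀ ω, (GradedTensorProduct.of k gr gr').symm (Φ (d ω)) =
    tensorDifferential gr d d' ((GradedTensorProduct.of k gr gr').symm (Φ ω))

/-- The calculus `(Ω, d)` over the total space of the quantum principal bundle `A^{co H} ⊆ A` is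
complete, with respect to the calculus `(Θ, d')` on `H`. -/
structure IsCompleteCalculus (ρ : A →ₐ[k] A ⊗[k] H)
    (ι : A →ₐ[k] Ω) (gr : ℕ → Submodule k Ω) [GradedAlgebra gr] (d : Ω →ₗ[k] Ω)
    (ι' : H →ₐ[k] Θ) (gr' : ℕ → Submodule k Θ) [GradedAlgebra gr'] (d' : Θ →ₗ[k] Θ) : Prop where
  bundle : IsQuantumPrincipalBundle ρ
  calculus : IsDifferentialCalculus ι gr d
  lifts : ∃ Φ : Ω →ₐ[k] GradedTensorProduct k gr gr', IsDGExtension ρ ι gr d ι' gr' d' Φ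

/-- The component `(π_i ⊗ π_j) ∘ Φ` of `Φ`; on `Ω^{i+j}` it is the map `ver^{i,j}`, and for
`j = 0` it is `Δ_{Ω^i}`. -/
def ver {gr : ℕ → Submodule k Ω} [GradedAlgebra gr] {gr' : ℕ → Submodule k Θ} [GradedAlgebra gr']
    (Φ : Ω →ₐ[k] GradedTensorProduct k gr gr') (i j : ℕ) : Ω →ₗ[k] Ω ⊗[k] Θ :=
  TensorProduct.map (GradedAlgebra.proj gr i) (GradedAlgebra.proj gr' j) ∘ₗ
    (GradedTensorProduct.of k gr gr').symm.toLinearMap ∘ₗ Φ.toLinearMap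

/-- `Δ` makes the calculus `(Ω, d)` over the right `H`-comodule algebra `A` right `H`-covariant. -/
structure IsRightCovariant (ρ : A →ₐ[k] A ⊗[k] H) (ι : A →ₐ[k] Ω) (gr : ℕ → Submodule k Ω)
    (d : Ω →ₗ[k] Ω) (Δ : Ω →ₐ[k] Ω ⊗[k] H) : Prop where
  coaction : IsRightCoaction Δ.toLinearMap
  extends_coaction : ∀ a, Δ (ι a) = Algebra.TensorProduct.map ι (AlgHom.id k H) (ρ a)
  degree : ∀ n, ∀ ω ∈ gr n, Δ ω ∈ Submodule.map₂ (TensorProduct.mk k Ω H) (gr n) ⊤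
  colinear : ∀ ω, Δ (d ω) = TensorProduct.map d LinearMap.id (Δ ω)

/-- `Δ` makes the calculus `(Θ, d)` over `H` left covariant. -/
structure IsLeftCovariant (ι : H →ₐ[k] Θ) (gr : ℕ → Submodule k Θ)
    (d : Θ →ₗ[k] Θ) (Δ : Θ →ₐ[k] H ⊗[k] Θ) : Prop where
  coaction : IsLeftCoaction Δ.toLinearMap
  extends_coproduct : ∀ h, Δ (ι h) =
    Algebra.TensorProduct.map (AlgHom.id k H) ι (Bialgebra.comulAlgHom k H h)
  degree : ∀ n, ∀ ω ∈ gr n, Δ ω ∈ Submodule.map₂ (TensorProduct.mk k H Θ) ⊤ (gr n)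
  colinear : ∀ ω, Δ (d ω) = TensorProduct.map LinearMap.id d (Δ ω)

/-- `Ω` is the maximal prolongation `T_A(Ω¹) / ⟨∑ daᵢ ⊗ dbᵢ : ∑ aᵢ dbᵢ = 0⟩` of its first order
part: an algebra map out of `Ω` is the same thing as an algebra map `f₀` on `A` together with an
`f₀`-bilinear map `f₁` on `Ω¹` for which `∑ f₁(daᵢ) f₁(dbᵢ) = 0` whenever `∑ aᵢ dbᵢ = 0`. -/
def IsMaximalProlongation (ι : A →ₐ[k] Ω) (gr : ℕ → Submodule k Ω) (d : Ω →ₗ[k] Ω) : Prop :=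
  ∀ (R : Type u) [Ring R] [Algebra k R] (f₀ : A →ₐ[k] R) (f₁ : gr 1 →ₗ[k] R),
    (∀ (a b : A) (ω η : gr 1), (η : Ω) = ι a * ω * ι b → f₁ η = f₀ a * f₁ ω * f₀ b) →
    (∀ (n : ℕ) (a b : Fin n → A) (α β : Fin n → gr 1),
      (∀ i, (α i : Ω) = d (ι (a i))) → (∀ i, (β i : Ω) = d (ι (b i))) →
      ∑ i, ι (a i) * d (ι (b i)) = 0 → ∑ i, f₁ (α i) * f₁ (β i) = 0) →
    ∃! F : Ω →ₐ[k] R, (∀ a, F (ι a) = f₀ a) ∧ ∀ ω : gr 1, F ω = f₁ ω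

/-- The submodule `M` of `Ω` is a free left `A`-module with basis `v`. -/
def IsLeftBasis (ι : A →ₐ[k] Ω) (M : Submodule k Ω) {n : ℕ} (v : Fin n → Ω) : Prop :=
  Set.BijOn (fun c : Fin n → A => ∑ i, ι (c i) * v i) Set.univ (M : Set Ω)

end Calculi

/-! ## Gradings of algebras given by generators and homogeneous relations -/

section Presented

variable {k : Type u} [Field k] {X : Type u}

/-- The span of the words of total weight `n` in the elements `g x`, where `g x` has weight
`w x`. -/
def wordGrading {R : Type u} [Ring R] [Algebra k R] (w : X → ℕ) (g : X → R) (n : ℕ) :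
    Submodule k R :=
  Submodule.span k {z | ∃ l : List X, (l.map w).sum = n ∧ z = (l.map g).prod}

variable {R : Type u} [Ring R] [Algebra k R] (w : X → ℕ) (g : X → R)

theorem gen_mem (x : X) : g x ∈ wordGrading (k := k) w g (w x) :=
  Submodule.subset_span ⟨[x], by simp, by simp⟩

instance wordGrading_gradedMonoid : SetLike.GradedMonoid (wordGrading (k := k) w g) where
  one_mem := Submodule.subset_span ⟨[], by simp, by simp⟩
  mul_mem := by
    intro i j x y hx hy
    have h : wordGrading (k := k) w g i * wordGrading (k := k) w g j ≤
        wordGrading (k := k) w g (i + j) := by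
      rw [wordGrading, wordGrading, Submodule.span_mul_span, Submodule.span_le]
      rintro _ ⟨_, ⟨l, hl, rfl⟩, _, ⟨m, hm, rfl⟩, rfl⟩
      exact Submodule.subset_span ⟨l ++ m, by simp [hl, hm], by simp⟩
    exact h (Submodule.mul_mem_mul hx hy)

variable (s : FreeAlgebra k X → FreeAlgebra k X → Prop)

/-- The class of the generator `x`. -/
def pgen (x : X) : RingQuot s := RingQuot.mkAlgHom k s (FreeAlgebra.ι k x)

/-- Both sides of every relation are homogeneous of the same weight. -/
def Homogeneous : Prop := ∀ ⦃a b⦄, s a b → ∃ n,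
  a ∈ wordGrading (k := k) w (FreeAlgebra.ι k) n ∧ b ∈ wordGrading (k := k) w (FreeAlgebra.ι k) n

theorem mk_mem {n : ℕ} {a : FreeAlgebra k X} (ha : a ∈ wordGrading (k := k) w (FreeAlgebra.ι k) n) :
    RingQuot.mkAlgHom k s a ∈ wordGrading (k := k) w (pgen s) n := by
  have h : wordGrading (k := k) w (FreeAlgebra.ι k) n ≤
      (wordGrading (k := k) w (pgen s) n).comap (RingQuot.mkAlgHom k s).toLinearMap := by
    refine Submodule.span_le.2 ?_
    rintro _ ⟨l, hl, rfl⟩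
    refine Submodule.subset_span ⟨l, hl, ?_⟩
    simp only [AlgHom.toLinearMap_apply, map_list_prod, List.map_map]
    rfl
  exact h ha

/-- The generators, placed in their degrees. -/
def freeDecompose : FreeAlgebra k X →ₐ[k] ⨁ i, wordGrading (k := k) w (pgen s) i :=
  FreeAlgebra.lift k fun x =>
    DirectSum.of (fun i => wordGrading (k := k) w (pgen s) i) (w x) ⟨pgen s x, gen_mem w _ x⟩

theorem freeDecompose_list (l : List X) {n : ℕ} (hl : (l.map w).sum = n)
    (h : (l.map (pgen s)).prod ∈ wordGrading (k := k) w (pgen s) n) :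
    freeDecompose w s (l.map (FreeAlgebra.ι k)).prod =
      DirectSum.of (fun i => wordGrading (k := k) w (pgen s) i) n ⟨(l.map (pgen s)).prod, h⟩ := by
  induction l generalizing n with
  | nil =>
    subst hl
    simp only [List.map_nil, List.prod_nil, map_one]
    rfl
  | cons x l ih =>
    have h' : (l.map (pgen s)).prod ∈ wordGrading (k := k) w (pgen s) (l.map w).sum :=
      Submodule.subset_span ⟨l, rfl, rfl⟩
    rw [List.map_cons, List.prod_cons, map_mul, ih rfl h']
    simp only [freeDecompose, FreeAlgebra.lift_ι_apply, DirectSum.of_mul_of]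
    exact DirectSum.of_eq_of_gradedMonoid_eq
      (Sigma.subtype_ext (by simpa [GradedMonoid.mk] using hl) (List.prod_cons (l := l.map _)).symm)

theorem freeDecompose_mem {n : ℕ} {a : FreeAlgebra k X}
    (ha : a ∈ wordGrading (k := k) w (FreeAlgebra.ι k) n) :
    freeDecompose w s a = DirectSum.of (fun i => wordGrading (k := k) w (pgen s) i) n
      ⟨RingQuot.mkAlgHom k s a, mk_mem w s ha⟩ := by
  change _ = DirectSum.lof k ℕ (fun i => wordGrading (k := k) w (pgen s) i) n _
  induction ha using Submodule.span_induction with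
  | mem x hx =>
    obtain ⟨l, hl, rfl⟩ := hx
    have e : RingQuot.mkAlgHom k s (l.map (FreeAlgebra.ι k)).prod = (l.map (pgen s)).prod := by
      rw [map_list_prod, List.map_map]
      rfl
    rw [freeDecompose_list w s l hl (Submodule.subset_span ⟨l, hl, rfl⟩), DirectSum.lof_eq_of]
    congr 1
    exact Subtype.ext e.symm
  | zero =>
    rw [map_zero]
    exact ((DirectSum.lof k ℕ (fun i => wordGrading (k := k) w (pgen s) i) n).map_zero).symm.trans
      (congrArg _ (Subtype.ext (map_zero _).symm))
  | add x y hx hy ihx ihy =>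
    rw [map_add, ihx, ihy, ← map_add]
    exact congrArg _ (Subtype.ext (map_add _ _ _).symm)
  | smul c x hx ih =>
    rw [map_smul, ih, ← map_smul]
    exact congrArg _ (Subtype.ext (map_smul _ _ _).symm)

/-- An algebra presented by homogeneous relations is graded by word weight. -/
abbrev presentedGradedAlgebra (hs : Homogeneous w s) :
    GradedAlgebra (wordGrading (k := k) w (pgen s)) :=
  GradedAlgebra.ofAlgHom _
    (RingQuot.liftAlgHom k ⟨freeDecompose w s, by
      intro a b hab
      obtain ⟨n, ha, hb⟩ := hs hab
      rw [freeDecompose_mem w s ha, freeDecompose_mem w s hb]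
      congr 1
      exact Subtype.ext (RingQuot.mkAlgHom_rel k hab)⟩)
    (by
      apply RingQuot.ringQuot_ext'
      ext x
      simp only [Function.comp_apply, AlgHom.comp_apply, RingQuot.liftAlgHom_mkAlgHom_apply,
        freeDecompose, FreeAlgebra.lift_ι_apply, DirectSum.coeAlgHom_of]
      rfl)
    (by
      rintro i ⟨x, hx⟩
      change _ = DirectSum.lof k ℕ (fun i => wordGrading (k := k) w (pgen s) i) i _
      induction hx using Submodule.span_induction with
      | mem x hx =>
        obtain ⟨l, hl, rfl⟩ := hx
        have e : (l.map (pgen s)).prod = RingQuot.mkAlgHom k s (l.map (FreeAlgebra.ι k)).prod := by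
          rw [map_list_prod, List.map_map]
          rfl
        simp only [e, RingQuot.liftAlgHom_mkAlgHom_apply]
        rw [freeDecompose_list w s l hl (Submodule.subset_span ⟨l, hl, rfl⟩), DirectSum.lof_eq_of]
        congr 1
        exact Subtype.ext e
      | zero =>
        simp only [map_zero]
        exact ((DirectSum.lof k ℕ (fun i => wordGrading (k := k) w (pgen s) i) i).map_zero).symm
      | add x y hx hy ihx ihy =>
        simp only [map_add] at ihx ihy ⊢
        rw [ihx, ihy, ← map_add]
        rfl
      | smul c x hx ih =>
        simp only [map_smul] at ih ⊢
        rw [ih, ← map_smul]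
        rfl)

end Presented

/-! ## The quantum group `O_q(SU(2))` and the coaction of `O(U(1))` -/

/-- The generators `α, β, γ, δ`. -/
inductive Gen : Type
  | al | be | ga | de

/-- The degrees `|α| = |γ| = 1`, `|β| = |δ| = -1`. -/
def Gen.deg : Gen → ℤ
  | .al => 1
  | .be => -1
  | .ga => 1
  | .de => -1

/-- The relations of `O_q(SU(2))`, imposed on elements `x .al, x .be, x .ga, x .de`. -/
inductive SURel {R : Type} [Ring R] [Algebra ℂ R] (q : ℂ) (x : Gen → R) : R → R → Prop
  | be_al : SURel q x (x .be * x .al) (q • (x .al * x .be))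
  | ga_al : SURel q x (x .ga * x .al) (q • (x .al * x .ga))
  | de_be : SURel q x (x .de * x .be) (q • (x .be * x .de))
  | de_ga : SURel q x (x .de * x .ga) (q • (x .ga * x .de))
  | ga_be : SURel q x (x .ga * x .be) (x .be * x .ga)
  | de_al : SURel q x (x .de * x .al - x .al * x .de) ((q - q⁻¹) • (x .be * x .ga))
  | det : SURel q x (x .al * x .de - q⁻¹ • (x .be * x .ga)) 1

/-- `A = O_q(SU(2))`. -/
abbrev SUq (q : ℂ) : Type := RingQuot (SURel q (FreeAlgebra.ι ℂ : Gen → FreeAlgebra ℂ Gen))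

/-- The generators of `O_q(SU(2))`. -/
def SUq.gen (q : ℂ) (f : Gen) : SUq q := pgen _ f

theorem SURel.map {R S : Type} [Ring R] [Algebra ℂ R] [Ring S] [Algebra ℂ S] {q : ℂ}
    {x : Gen → R} (φ : R →ₐ[ℂ] S) {a b : R} (h : SURel q x a b) :
    SURel q (φ ∘ x) (φ a) (φ b) := by
  cases h <;> simp only [map_mul, map_sub, map_smul, map_one] <;> constructor

theorem SURel.exists_of_map {R S : Type} [Ring R] [Algebra ℂ R] [Ring S] [Algebra ℂ S] {q : ℂ}
    {x : Gen → R} (φ : R →ₐ[ℂ] S) {a b : S} (h : SURel q (fun f => φ (x f)) a b) :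
    ∃ a' b' : R, SURel q x a' b' ∧ φ a' = a ∧ φ b' = b := by
  cases h
  · exact ⟨_, _, .be_al, by simp, by simp⟩
  · exact ⟨_, _, .ga_al, by simp, by simp⟩
  · exact ⟨_, _, .de_be, by simp, by simp⟩
  · exact ⟨_, _, .de_ga, by simp, by simp⟩
  · exact ⟨_, _, .ga_be, by simp, by simp⟩
  · exact ⟨_, _, .de_al, by simp, by simp⟩
  · exact ⟨_, _, .det, by simp, by simp⟩

/-- An algebra map out of `O_q(SU(2))` from elements that satisfy the relations. -/
def SUq.lift {R : Type} [Ring R] [Algebra ℂ R] (q : ℂ) (x : Gen → R)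
    (hx : ∀ a b, SURel q x a b → a = b) : SUq q →ₐ[ℂ] R :=
  RingQuot.liftAlgHom ℂ ⟨FreeAlgebra.lift ℂ x, by
    intro a b h
    have h' := h.map (FreeAlgebra.lift ℂ x)
    rw [FreeAlgebra.ι_comp_lift] at h'
    exact hx _ _ h'⟩

theorem SUq.gen_rel (q : ℂ) {a b : SUq q} (h : SURel q (SUq.gen q) a b) : a = b := by
  obtain ⟨a', b', h', rfl, rfl⟩ := SURel.exists_of_map
    (RingQuot.mkAlgHom ℂ (SURel q (FreeAlgebra.ι ℂ : Gen → FreeAlgebra ℂ Gen))) h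
  exact RingQuot.mkAlgHom_rel ℂ h'

/-- The right coaction `Δ_A : A → A ⊗ H` of `H = O(U(1)) = ℂ[t, t⁻¹]`, `f ↦ f ⊗ t^{|f|}` on the
generators. -/
def coaction (q : ℂ) : SUq q →ₐ[ℂ] SUq q ⊗[ℂ] ℂ[T;T⁻¹] :=
  SUq.lift q (fun f => SUq.gen q f ⊗ₜ[ℂ] (LaurentPolynomial.T f.deg : ℂ[T;T⁻¹])) (by
    intro a b h
    have one : (1 : SUq q ⊗[ℂ] ℂ[T;T⁻¹]) = 1 ⊗ₜ[ℂ] LaurentPolynomial.T 0 := rfl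
    cases h <;>
      simp only [Algebra.TensorProduct.tmul_mul_tmul, ← LaurentPolynomial.T_add, Gen.deg,
        TensorProduct.smul_tmul', one, add_neg_cancel, neg_add_cancel, ← TensorProduct.sub_tmul]
    · rw [SUq.gen_rel q .be_al]
    · rw [SUq.gen_rel q .ga_al]
    · rw [SUq.gen_rel q .de_be]
    · rw [SUq.gen_rel q .de_ga]
    · rw [SUq.gen_rel q .ga_be]
    · rw [SUq.gen_rel q .de_al]
    · rw [SUq.gen_rel q .det])

/-! ## The three-dimensional calculus on `O_q(SU(2))` -/

/-- The symbols `e⁺, e⁻, e⁰`. -/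
inductive EGen : Type
  | ep | em | ez

/-- The weights in `e^± f = q^{|f|} f e^±` and `e⁰ f = q^{2|f|} f e⁰`. -/
def EGen.wt : EGen → ℤ
  | .ep => 1
  | .em => 1
  | .ez => 2

/-- The form degree of a generator of `Ω(A)`. -/
def formDeg : Gen ⊕ EGen → ℕ
  | .inl _ => 0
  | .inr _ => 1

/-- The relations of the algebra of forms, imposed on elements `x f` and `e s`: the relations of
`A`, the bimodule relations and the relations between the products of two one-forms. -/
inductive FormRel {R : Type} [Ring R] [Algebra ℂ R] (q : ℂ) (x : Gen → R) (e : EGen → R) :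
    R → R → Prop
  | base {a b : R} : SURel q x a b → FormRel q x e a b
  | comm (s : EGen) (f : Gen) : FormRel q x e (e s * x f) (q ^ (s.wt * f.deg) • (x f * e s))
  | sq (s : EGen) : FormRel q x e (e s * e s) 0
  | ep_em : FormRel q x e (e .ep * e .em) (-(q⁻¹ ^ 2) • (e .em * e .ep))
  | ep_ez : FormRel q x e (e .ep * e .ez) (-(q⁻¹ ^ 4) • (e .ez * e .ep))
  | em_ez : FormRel q x e (e .em * e .ez) (-(q ^ 4) • (e .ez * e .em))

/-- The defining relation of `Ω(A)` on the free algebra. -/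
abbrev formRel (q : ℂ) : FreeAlgebra ℂ (Gen ⊕ EGen) → FreeAlgebra ℂ (Gen ⊕ EGen) → Prop :=
  FormRel q (fun f => FreeAlgebra.ι ℂ (Sum.inl f)) (fun s => FreeAlgebra.ι ℂ (Sum.inr s))

/-- The algebra `Ω(A)` of forms. -/
abbrev Form (q : ℂ) : Type := RingQuot (formRel q)

/-- The generators `α, β, γ, δ` of `A`, as elements of `Ω⁰(A)`. -/
def Form.x (q : ℂ) (f : Gen) : Form q := pgen (formRel q) (Sum.inl f)

/-- The one-forms `e⁺, e⁻, e⁰`. -/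
def Form.e (q : ℂ) (s : EGen) : Form q := pgen (formRel q) (Sum.inr s)

/-- The map `A → Ω(A)`. -/
def Form.incl (q : ℂ) : SUq q →ₐ[ℂ] Form q :=
  SUq.lift q (Form.x q) (by
    intro a b h
    obtain ⟨a', b', h', rfl, rfl⟩ := SURel.exists_of_map
      (x := fun f => FreeAlgebra.ι ℂ (Sum.inl f)) (RingQuot.mkAlgHom ℂ (formRel q)) h
    exact RingQuot.mkAlgHom_rel ℂ (FormRel.base h'))

/-- `Ωⁿ(A)`: the span of the products of generators with exactly `n` factors among
`e⁺, e⁻, e⁰`. -/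
def Form.gr (q : ℂ) : ℕ → Submodule ℂ (Form q) :=
  wordGrading (k := ℂ) formDeg (pgen (formRel q))

theorem mul_mem_wordGrading {X R : Type} [Ring R] [Algebra ℂ R] {w : X → ℕ} {g : X → R} (x y : X)
    {n : ℕ} (h : w x + w y = n) : g x * g y ∈ wordGrading (k := ℂ) w g n :=
  Submodule.subset_span ⟨[x, y], by simpa using h, by simp⟩

theorem one_mem_wordGrading {X R : Type} [Ring R] [Algebra ℂ R] {w : X → ℕ} {g : X → R} :
    (1 : R) ∈ wordGrading (k := ℂ) w g 0 :=
  Submodule.subset_span ⟨[], by simp, by simp⟩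

theorem formRel_homogeneous (q : ℂ) : Homogeneous formDeg (formRel q) := by
  intro a b h
  have hA : ∀ f g : Gen, (FreeAlgebra.ι ℂ (Sum.inl f) * FreeAlgebra.ι ℂ (Sum.inl g) :
      FreeAlgebra ℂ (Gen ⊕ EGen)) ∈ wordGrading (k := ℂ) formDeg (FreeAlgebra.ι ℂ) 0 :=
    fun f g => mul_mem_wordGrading _ _ rfl
  have hE : ∀ s t : EGen, (FreeAlgebra.ι ℂ (Sum.inr s) * FreeAlgebra.ι ℂ (Sum.inr t) :
      FreeAlgebra ℂ (Gen ⊕ EGen)) ∈ wordGrading (k := ℂ) formDeg (FreeAlgebra.ι ℂ) 2 :=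
    fun f g => mul_mem_wordGrading _ _ rfl
  cases h with
  | base h =>
    refine ⟨0, ?_⟩
    cases h
    · exact ⟨hA _ _, Submodule.smul_mem _ _ (hA _ _)⟩
    · exact ⟨hA _ _, Submodule.smul_mem _ _ (hA _ _)⟩
    · exact ⟨hA _ _, Submodule.smul_mem _ _ (hA _ _)⟩
    · exact ⟨hA _ _, Submodule.smul_mem _ _ (hA _ _)⟩
    · exact ⟨hA _ _, hA _ _⟩
    · exact ⟨Submodule.sub_mem _ (hA _ _) (hA _ _), Submodule.smul_mem _ _ (hA _ _)⟩
    · exact ⟨Submodule.sub_mem _ (hA _ _) (Submodule.smul_mem _ _ (hA _ _)), one_mem_wordGrading⟩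
  | comm s f =>
    exact ⟨1, mul_mem_wordGrading _ _ rfl, Submodule.smul_mem _ _ (mul_mem_wordGrading _ _ rfl)⟩
  | sq s => exact ⟨2, hE _ _, Submodule.zero_mem _⟩
  | ep_em => exact ⟨2, hE _ _, Submodule.smul_mem _ _ (hE _ _)⟩
  | ep_ez => exact ⟨2, hE _ _, Submodule.smul_mem _ _ (hE _ _)⟩
  | em_ez => exact ⟨2, hE _ _, Submodule.smul_mem _ _ (hE _ _)⟩

instance Form.gradedAlgebra (q : ℂ) : GradedAlgebra (Form.gr q) :=
  presentedGradedAlgebra formDeg (formRel q) (formRel_homogeneous q)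

/-! ## The calculus on `O(U(1))` -/

/-- The generators `t, t⁻¹, dt`. -/
inductive CGen : Type
  | t | ti | dt

/-- The form degree of a generator of `Ω(H)`. -/
def CGen.deg : CGen → ℕ
  | .t => 0
  | .ti => 0
  | .dt => 1

/-- The relations of `Ω(H)`: `t` is invertible, `dt t = q² t dt`, and the relation
`dt ∧ dt = - q² dt ∧ dt` obtained from it by differentiation. -/
inductive CircleRel (q : ℂ) : FreeAlgebra ℂ CGen → FreeAlgebra ℂ CGen → Prop
  | t_ti : CircleRel q (FreeAlgebra.ι ℂ .t * FreeAlgebra.ι ℂ .ti) 1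
  | ti_t : CircleRel q (FreeAlgebra.ι ℂ .ti * FreeAlgebra.ι ℂ .t) 1
  | dt_t : CircleRel q (FreeAlgebra.ι ℂ .dt * FreeAlgebra.ι ℂ .t)
      (q ^ 2 • (FreeAlgebra.ι ℂ .t * FreeAlgebra.ι ℂ .dt))
  | dt_dt : CircleRel q (FreeAlgebra.ι ℂ .dt * FreeAlgebra.ι ℂ .dt)
      (-(q ^ 2) • (FreeAlgebra.ι ℂ .dt * FreeAlgebra.ι ℂ .dt))

/-- The algebra `Ω(H)`. -/
abbrev CForm (q : ℂ) : Type := RingQuot (CircleRel q)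

/-- The one-form `dt`. -/
def CForm.dt (q : ℂ) : CForm q := pgen (CircleRel q) .dt

/-- `t` as an invertible element of `Ω(H)`. -/
def CForm.tUnit (q : ℂ) : (CForm q)ˣ where
  val := pgen (CircleRel q) .t
  inv := pgen (CircleRel q) .ti
  val_inv := by
    simpa only [map_mul, map_one, pgen] using RingQuot.mkAlgHom_rel ℂ (CircleRel.t_ti (q := q))
  inv_val := by
    simpa only [map_mul, map_one, pgen] using RingQuot.mkAlgHom_rel ℂ (CircleRel.ti_t (q := q))

/-- The map `H = ℂ[t, t⁻¹] → Ω(H)`, `tⁿ ↦ tⁿ`. -/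
def CForm.incl (q : ℂ) : ℂ[T;T⁻¹] →ₐ[ℂ] CForm q :=
  AddMonoidAlgebra.lift ℂ (CForm q) ℤ
    ((Units.coeHom (CForm q)).comp (zpowersHom (CForm q)ˣ (CForm.tUnit q)))

/-- The element `tⁿ` of `Ω⁰(H)`, for an integer `n`. -/
def CForm.t (q : ℂ) (n : ℤ) : CForm q := CForm.incl q (LaurentPolynomial.T n)

/-- `Ωⁿ(H)`: the span of the products of generators with exactly `n` factors `dt`. -/
def CForm.gr (q : ℂ) : ℕ → Submodule ℂ (CForm q) :=
  wordGrading (k := ℂ) CGen.deg (pgen (CircleRel q))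

theorem circleRel_homogeneous (q : ℂ) : Homogeneous CGen.deg (CircleRel q) := by
  intro a b h
  cases h with
  | t_ti => exact ⟨0, mul_mem_wordGrading _ _ rfl, one_mem_wordGrading⟩
  | ti_t => exact ⟨0, mul_mem_wordGrading _ _ rfl, one_mem_wordGrading⟩
  | dt_t =>
    exact ⟨1, mul_mem_wordGrading _ _ rfl, Submodule.smul_mem _ _ (mul_mem_wordGrading _ _ rfl)⟩
  | dt_dt =>
    exact ⟨2, mul_mem_wordGrading _ _ rfl, Submodule.smul_mem _ _ (mul_mem_wordGrading _ _ rfl)⟩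

instance CForm.gradedAlgebra (q : ℂ) : GradedAlgebra (CForm.gr q) :=
  presentedGradedAlgebra CGen.deg (CircleRel q) (circleRel_homogeneous q)

end QHopf

end

open QHopf

open scoped TensorProduct LaurentPolynomial DirectSum

noncomputable section

/-! Put `g = [[α, β], [γ, δ]]` and `ω = [[e⁰, e⁻], [q e⁺, -q⁻² e⁰]]`. The differential is determined
by the Maurer–Cartan equations `dg = gω` and `dω = -ω∧ω`, which are the formulas in `dGen` and
`dEGen`. Multiplying `dg = gω` from the left by the inverse `[[δ, -qβ], [-q⁻¹γ, α]]` of `g` recovers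
`e⁺, e⁻, e⁰` from the differentials of the generators.

Existence of `d`: a graded derivation of an algebra amounts to a multiplicative map `a ↦ [[±a, da],
[0, a]]` into upper triangular matrices. On a presented algebra it therefore exists as soon as these
matrices satisfy the relations (`exists_differential`, `upper_formRel`), and `d² = 0` has to be
checked on generators only (`d_d_of_generators`).

Freeness: moving one-forms to the right and ordering them shows that eight monomials span `Ω(A)`
over `A` (`Form.gr_le`). They are independent because `Ω(A)` acts on `A⁸` by what left
multiplication has to be, and the action on the first basis vector reads off coefficients
(`Form.exists_coordinates`). The calculus on the circle is treated in the same way with an action on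
`H ⊕ H dt`; there `q² ≠ -1` forces `dt ∧ dt = 0`.

Principal bundle: a coaction of `ℂ[t, t⁻¹]` is a `ℤ`-grading. The identities `δα - qβγ = 1` and `αδ
- q⁻¹γβ = 1` write `1` as a sum of products of elements of degree `-1` and `1`, in both orders, so
`A` is strongly graded. Such decompositions of `1` give the inverse of the canonical map and a dual
basis of `A` over `B`. Since `B` is also a direct summand, `A` is faithfully flat
(`isQuantumPrincipalBundle_of_strong`, `isFaithfullyFlat_of_projective`).

Completeness: with `w = t⁻¹dt` the extension sends `e^±` to `e^± ⊗ t^{±2}` and `e⁰` to `e⁰ ⊗ 1 + 1 ⊗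
w`. The relations survive because `w tⁿ = q^{2n} tⁿ w`, so `w` acquires from `t^{|f|}` and `t^{±2}`
exactly the powers of `q` that `e⁰` acquires from `f` and `e^±` (`CircleRules.formRel`). The
extension is unique because `A` and `dA` generate `Ω(A)`, so all its components can be computed from
this one. -/

namespace QHopf

/-! ### Presented algebras and derivations defined on generators. -/

section Words

variable {k : Type} [Field k] {X R : Type} [Ring R] [Algebra k R]

/-- Induction along words, one letter at a time. -/
theorem wordGrading_le {w : X → ℕ} {g : X → R} {V : ℕ → Submodule k R} (h1 : 1 ∈ V 0)
    (hg : ∀ x n, ∀ y ∈ V n, g x * y ∈ V (w x + n)) (n : ℕ) : wordGrading (k := k) w g n ≤ V n := by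
  refine Submodule.span_le.2 ?_
  rintro _ ⟨l, hl, rfl⟩
  induction l generalizing n with
  | nil => subst hl; simpa using h1
  | cons x l ih => subst hl; simpa using hg x _ _ (ih _ rfl)

theorem mul_mem_wordGrading_of_mem {w : X → ℕ} {g : X → R} {i j n : ℕ} {a b : R}
    (ha : a ∈ wordGrading (k := k) w g i) (hb : b ∈ wordGrading (k := k) w g j)
    (h : i + j = n) : a * b ∈ wordGrading (k := k) w g n :=
  h ▸ SetLike.GradedMul.mul_mem ha hb

theorem adjoin_pgen (s : FreeAlgebra k X → FreeAlgebra k X → Prop) :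
    Algebra.adjoin k (Set.range (pgen s)) = ⊤ := by
  have h : Set.range (pgen s) = RingQuot.mkAlgHom k s '' Set.range (FreeAlgebra.ι k) := by
    rw [← Set.range_comp]; rfl
  rw [h, ← AlgHom.map_adjoin, FreeAlgebra.adjoin_range_ι, Algebra.map_top,
    AlgHom.range_eq_top]
  exact RingQuot.mkAlgHom_surjective k s

/-- Stability under the generators spreads to the subalgebra they generate, which is everything, so
`V` is a left ideal containing `1`. With `V` the locus where two linear maps agree, this is the
induction behind most identities on presented algebras below. -/
theorem mem_of_generators (s : FreeAlgebra k X → FreeAlgebra k X → Prop)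
    (V : Submodule k (RingQuot s)) (h1 : 1 ∈ V) (hg : ∀ x, ∀ y ∈ V, pgen s x * y ∈ V)
    (z : RingQuot s) : z ∈ V := by
  have h : ∀ z ∈ Algebra.adjoin k (Set.range (pgen s)), ∀ y ∈ V, z * y ∈ V := by
    intro z hz
    induction hz using Algebra.adjoin_induction with
    | mem x hx => obtain ⟨x, rfl⟩ := hx; exact hg x
    | algebraMap r => intro y hy; rw [← Algebra.smul_def]; exact V.smul_mem _ hy
    | add a b _ _ ha hb => intro y hy; rw [add_mul]; exact V.add_mem (ha y hy) (hb y hy)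
    | mul a b _ _ ha hb => intro y hy; rw [mul_assoc]; exact ha _ (hb y hy)
  simpa using h z (by rw [adjoin_pgen]; trivial) 1 h1

theorem presented_algHom_ext {S : Type} [Semiring S] [Algebra k S]
    {s : FreeAlgebra k X → FreeAlgebra k X → Prop} {f g : RingQuot s →ₐ[k] S}
    (h : ∀ x, f (pgen s x) = g (pgen s x)) : f = g := by
  apply RingQuot.ringQuot_ext'
  ext x
  exact h x

theorem exists_lift {S : Type} [Semiring S] [Algebra k S]
    {s : FreeAlgebra k X → FreeAlgebra k X → Prop} (g : X → S)
    (hs : ∀ a b, s a b → FreeAlgebra.lift k g a = FreeAlgebra.lift k g b) :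
    ∃ φ : RingQuot s →ₐ[k] S, ∀ x, φ (pgen s x) = g x :=
  ⟨RingQuot.liftAlgHom k ⟨FreeAlgebra.lift k g, fun ⦃a b⦄ h => hs a b h⟩, fun x => by
    simp [pgen]⟩

section UpperTriangular

variable {a b c a' b' c' : R}

/-- With diagonal `σ u`, `u` and corner `D u`, the corner of a product is `D u * v + σ u * D v`:
matrices of this shape encode derivations twisted by `σ`. -/
theorem upper_mul : !![a, b; 0, c] * !![a', b'; 0, c'] =
    !![a * a', b * c' + a * b'; 0, c * c'] := by
  simp [add_comm]

theorem upper_sub : !![a, b; 0, c] - !![a', b'; 0, c'] =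
    !![a - a', b - b'; 0, c - c'] := by
  ext i j
  fin_cases i <;> fin_cases j <;> simp

theorem upper_smul (r : k) : r • !![a, b; 0, c] = !![r • a, r • b; 0, r • c] := by
  ext i j
  fin_cases i <;> fin_cases j <;> simp

theorem upper_one : (1 : Matrix (Fin 2) (Fin 2) R) = !![1, 0; 0, 1] := Matrix.one_fin_two

theorem upper_zero : (0 : Matrix (Fin 2) (Fin 2) R) = !![0, 0; 0, 0] := by
  ext i j
  fin_cases i <;> fin_cases j <;> rfl

theorem upper_ext (h1 : a = a') (h2 : b = b') (h3 : c = c') :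
    !![a, b; 0, c] = !![a', b'; 0, c'] := by
  rw [h1, h2, h3]

end UpperTriangular

/-- A linear map out of an algebra with generators that satisfies a twisted Leibniz rule for
products with a generator on the left. -/
theorem exists_differential (w : X → ℕ) (s : FreeAlgebra k X → FreeAlgebra k X → Prop)
    (D : X → RingQuot s)
    (hs : ∀ a b, s a b →
      FreeAlgebra.lift k (fun x => !![(-1 : k) ^ w x • pgen s x, D x; 0, pgen s x]) a =
      FreeAlgebra.lift k (fun x => !![(-1 : k) ^ w x • pgen s x, D x; 0, pgen s x]) b) :
    ∃ d : RingQuot s →ₗ[k] RingQuot s, d 1 = 0 ∧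
      ∀ x y, d (pgen s x * y) = D x * y + (-1 : k) ^ w x • (pgen s x * d y) := by
  obtain ⟨φ, hφ⟩ := exists_lift _ hs
  -- The corner of `φ y` will be `d y`. Its recursion uses that the lower right entry of `φ y` is
  -- `y`, and the upper left entry only at a generator.
  have h11 : ∀ y, φ y 1 1 = y ∧ φ y 1 0 = 0 := by
    let V : Submodule k (RingQuot s) :=
      { carrier := {y | φ y 1 1 = y ∧ φ y 1 0 = 0}
        add_mem' := by rintro a b ⟨h1, h2⟩ ⟨h3, h4⟩; simp_all
        zero_mem' := by simp
        smul_mem' := by rintro c a ⟨h1, h2⟩; simp_all }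
    refine mem_of_generators s V (by simp [V]) ?_
    rintro x y ⟨h1, h2⟩
    simp [V, hφ, Matrix.mul_apply, h1, h2]
  refine ⟨⟨⟨fun y => φ y 0 1, by simp⟩, by simp⟩, by simp, ?_⟩
  intro x y
  simp [hφ, Matrix.mul_apply, (h11 y).1, add_comm]

variable {w : X → ℕ} {s : FreeAlgebra k X → FreeAlgebra k X → Prop} {D : X → RingQuot s}
  {d : RingQuot s →ₗ[k] RingQuot s}

theorem d_pgen (h1 : d 1 = 0)
    (hd : ∀ x y, d (pgen s x * y) = D x * y + (-1 : k) ^ w x • (pgen s x * d y)) (x : X) :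
    d (pgen s x) = D x := by
  simpa [h1] using hd x 1

theorem leibniz_of_generators (h1 : d 1 = 0)
    (hd : ∀ x y, d (pgen s x * y) = D x * y + (-1 : k) ^ w x • (pgen s x * d y)) (n : ℕ)
    (ω : RingQuot s) (hω : ω ∈ wordGrading (k := k) w (pgen s) n) (η : RingQuot s) :
    d (ω * η) = d ω * η + (-1 : k) ^ n • (ω * d η) := by
  let V : ℕ → Submodule k (RingQuot s) := fun n =>
    { carrier := {ω | ∀ η, d (ω * η) = d ω * η + (-1 : k) ^ n • (ω * d η)}
      add_mem' := by
        intro a b ha hb η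
        rw [add_mul, map_add, ha, hb, map_add, add_mul, add_mul, smul_add]; abel
      zero_mem' := by simp
      smul_mem' := by
        intro c a ha η
        simp only [smul_mul_assoc, map_smul, ha η, smul_add, smul_comm c] }
  have := wordGrading_le (k := k) (w := w) (g := pgen s) (V := V) (by simp [V, h1]) ?_ n hω
  · exact this η
  · intro x n y hy η
    rw [mul_assoc, hd, hy, hd]
    simp only [mul_add, add_mul, smul_add, mul_smul_comm, smul_smul, pow_add, mul_assoc,
      smul_mul_assoc]
    abel

theorem degree_of_generators (h1 : d 1 = 0)
    (hd : ∀ x y, d (pgen s x * y) = D x * y + (-1 : k) ^ w x • (pgen s x * d y))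
    (hD : ∀ x, D x ∈ wordGrading (k := k) w (pgen s) (w x + 1)) (n : ℕ)
    (ω : RingQuot s) (hω : ω ∈ wordGrading (k := k) w (pgen s) n) :
    d ω ∈ wordGrading (k := k) w (pgen s) (n + 1) := by
  let V : ℕ → Submodule k (RingQuot s) := fun n => wordGrading (k := k) w (pgen s) n ⊓
    (wordGrading (k := k) w (pgen s) (n + 1)).comap d
  refine (wordGrading_le (k := k) (w := w) (g := pgen s) (V := V) ?_ ?_ n hω).2
  · exact ⟨SetLike.GradedOne.one_mem, by simp [h1]⟩
  · rintro x n y ⟨hy, hy'⟩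
    refine ⟨mul_mem_wordGrading_of_mem (gen_mem w _ x) hy rfl, ?_⟩
    change d _ ∈ wordGrading (k := k) w (pgen s) _
    rw [hd]
    exact add_mem (mul_mem_wordGrading_of_mem (hD x) hy (by ring)) (Submodule.smul_mem _ _
      (mul_mem_wordGrading_of_mem (gen_mem w _ x) hy' (by ring)))

/-- In `d (d (x * y))` the two terms `D x * d y` carry the signs `(-1) ^ (w x + 1)` and `(-1) ^ w x`
and cancel. What is left involves only `d (D x)` and `d (d y)`. -/
theorem d_d_of_generators (h1 : d 1 = 0)
    (hd : ∀ x y, d (pgen s x * y) = D x * y + (-1 : k) ^ w x • (pgen s x * d y))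
    (hD : ∀ x, D x ∈ wordGrading (k := k) w (pgen s) (w x + 1)) (hdD : ∀ x, d (D x) = 0)
    (ω : RingQuot s) : d (d ω) = 0 := by
  have := mem_of_generators s (LinearMap.ker (d ∘ₗ d)) (by simp [h1]) ?_ ω
  · simpa using this
  · intro x y hy
    simp only [LinearMap.mem_ker, LinearMap.comp_apply] at hy ⊢
    rw [hd, map_add, map_smul, hd, leibniz_of_generators h1 hd _ _ (hD x), hdD, hy]
    simp only [zero_mul, mul_zero, smul_zero, add_zero, zero_add, pow_succ, mul_neg, mul_one]
    module

end Words

end QHopf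
end

open scoped TensorProduct LaurentPolynomial DirectSum

noncomputable section

namespace QHopf

/-! ### Tensor products of differential graded algebras. -/

section GradedTensor

variable {k : Type} [Field k] {Ω Θ : Type} [Ring Ω] [Algebra k Ω] [Ring Θ] [Algebra k Θ]
  {gr : ℕ → Submodule k Ω} {gr' : ℕ → Submodule k Θ}

theorem tmul_mem_tensorDegree {i j n : ℕ} {a : Ω} {b : Θ} (ha : a ∈ gr i) (hb : b ∈ gr' j)
    (h : i + j = n) : a ⊗ₜ[k] b ∈ tensorDegree gr gr' n := by
  refine Submodule.mem_iSup_of_mem (i, j) (Submodule.mem_iSup_of_mem ?_ ?_)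
  · simpa using h
  · exact Submodule.apply_mem_map₂ _ ha hb

theorem tensorDegree_le {n : ℕ} {V : Submodule k (Ω ⊗[k] Θ)}
    (h : ∀ i j, i + j = n → ∀ a ∈ gr i, ∀ b ∈ gr' j, a ⊗ₜ[k] b ∈ V) :
    tensorDegree gr gr' n ≤ V := by
  refine iSup₂_le fun p hp => Submodule.map₂_le.2 fun a ha b hb => ?_
  exact h p.1 p.2 (by simpa using hp) a ha b hb

/-- `d ⊗ id` satisfies the graded Leibniz rule on `Ω ⊗ H`. -/
theorem map_d_id_mul {H : Type} [Ring H] [Algebra k H] {d : Ω →ₗ[k] Ω} {a b : Ω} {c : k}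
    (h : ∀ η, d (a * η) = b * η + c • (a * d η)) (t : H) (v : Ω ⊗[k] H) :
    TensorProduct.map d LinearMap.id ((a ⊗ₜ[k] t) * v) = (b ⊗ₜ[k] t) * v +
      c • ((a ⊗ₜ[k] t) * TensorProduct.map d LinearMap.id v) := by
  induction v with
  | zero => simp
  | add x y hx hy => simp only [map_add, mul_add, hx, hy, smul_add]; abel
  | tmul ω η => simp [h, TensorProduct.add_tmul, TensorProduct.smul_tmul']

variable [GradedAlgebra gr] [GradedAlgebra gr']

theorem proj_of_mem {n : ℕ} {ω : Ω} (h : ω ∈ gr n) : GradedAlgebra.proj gr n ω = ω :=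
  DirectSum.decompose_of_mem_same gr h

theorem proj_of_mem_ne {m n : ℕ} {ω : Ω} (h : ω ∈ gr m) (hmn : m ≠ n) :
    GradedAlgebra.proj gr n ω = 0 :=
  DirectSum.decompose_of_mem_ne gr h hmn

theorem proj_mul_of_mem_zero {n : ℕ} {a : Ω} (h : a ∈ gr 0) (ω : Ω) :
    GradedAlgebra.proj gr n (a * ω) = a * GradedAlgebra.proj gr n ω :=
  DirectSum.coe_decompose_mul_of_left_mem_zero gr h

theorem gradeInvolution_of_mem {n : ℕ} {ω : Ω} (h : ω ∈ gr n) :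
    gradeInvolution gr ω = (-1 : k) ^ n • ω := by
  rw [gradeInvolution, LinearMap.comp_apply]
  change DirectSum.toModule k ℕ Ω _ (DirectSum.decompose gr ω) = _
  rw [DirectSum.decompose_of_mem gr h, ← DirectSum.lof_eq_of k, DirectSum.toModule_lof]
  rfl

theorem mem_of_homogeneous (V : Submodule k Ω) (h : ∀ n, gr n ≤ V) (ω : Ω) : ω ∈ V := by
  classical
  rw [← DirectSum.sum_support_decompose gr ω]
  exact Submodule.sum_mem _ fun i _ => h i (SetLike.coe_mem _)

variable (gr gr') in
/-- Linear maps on a tensor product of graded algebras agree if they agree on tensors of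
homogeneous elements. -/
theorem ext_homogeneous_tmul {M : Type} [AddCommGroup M] [Module k M] {f g : Ω ⊗[k] Θ →ₗ[k] M}
    (h : ∀ i j, ∀ a ∈ gr i, ∀ b ∈ gr' j, f (a ⊗ₜ[k] b) = g (a ⊗ₜ[k] b)) : f = g := by
  refine TensorProduct.ext' fun a b => ?_
  have key : ∀ j, ∀ b ∈ gr' j, ∀ a, f (a ⊗ₜ[k] b) = g (a ⊗ₜ[k] b) := by
    intro j b hb
    refine mem_of_homogeneous (gr := gr) (LinearMap.eqLocus
      (f ∘ₗ (TensorProduct.mk k Ω Θ).flip b) (g ∘ₗ (TensorProduct.mk k Ω Θ).flip b)) ?_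
    intro i a ha
    exact h i j a ha b hb
  refine mem_of_homogeneous (gr := gr') (LinearMap.eqLocus
      (f ∘ₗ (TensorProduct.mk k Ω Θ) a) (g ∘ₗ (TensorProduct.mk k Ω Θ) a)) ?_ b
  intro j b hb
  exact key j b hb a

open GradedTensorProduct

/-- The sign of the graded product is turned from a unit of `ℤ` into a scalar of `k`, so that it can
be handled by linear algebra over `k`. -/
theorem of_tmul_mul_of_tmul {i j : ℕ} (a : Ω) {b : Θ} (hb : b ∈ gr' j) {a' : Ω} (ha' : a' ∈ gr i)
    (b' : Θ) : of k gr gr' (a ⊗ₜ[k] b) * of k gr gr' (a' ⊗ₜ[k] b') =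
      (-1 : k) ^ (j * i) • of k gr gr' ((a * a') ⊗ₜ[k] (b * b')) := by
  have h := tmul_coe_mul_coe_tmul gr gr' a ⟨b, hb⟩ ⟨a', ha'⟩ b'
  refine h.trans ?_
  have e := uzpow_natCast (R := ℕ) (-1 : ℤˣ) (j * i)
  rw [Nat.cast_id] at e
  rw [e]
  rcases Nat.even_or_odd (j * i) with hp | hp
  · rw [hp.neg_one_pow, hp.neg_one_pow, one_smul, one_smul]
  · rw [hp.neg_one_pow, hp.neg_one_pow, neg_smul, one_smul, Units.neg_smul, one_smul]

/-- An inner factor `b` of degree zero causes no sign, whatever the degree of `a'`; by linearity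
`a'` need not be homogeneous. -/
theorem of_tmul_mul_of_tmul_zero_left (a : Ω) {b : Θ} (hb : b ∈ gr' 0) (a' : Ω) (b' : Θ) :
    of k gr gr' (a ⊗ₜ[k] b) * of k gr gr' (a' ⊗ₜ[k] b') =
      of k gr gr' ((a * a') ⊗ₜ[k] (b * b')) := by
  refine mem_of_homogeneous (gr := gr) (LinearMap.eqLocus
    (LinearMap.mulLeft k (of k gr gr' (a ⊗ₜ[k] b)) ∘ₗ (of k gr gr').toLinearMap ∘ₗ
      (TensorProduct.mk k Ω Θ).flip b')
    ((of k gr gr').toLinearMap ∘ₗ (TensorProduct.mk k Ω Θ).flip (b * b') ∘ₗ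
      LinearMap.mulLeft k a)) ?_ a'
  intro i a' ha'
  simpa using of_tmul_mul_of_tmul a hb ha' b'

theorem of_tmul_mul_of_tmul_zero_right (a : Ω) (b : Θ) {a' : Ω} (ha' : a' ∈ gr 0) (b' : Θ) :
    of k gr gr' (a ⊗ₜ[k] b) * of k gr gr' (a' ⊗ₜ[k] b') =
      of k gr gr' ((a * a') ⊗ₜ[k] (b * b')) := by
  refine mem_of_homogeneous (gr := gr') (LinearMap.eqLocus
    (LinearMap.mulRight k (of k gr gr' (a' ⊗ₜ[k] b')) ∘ₗ (of k gr gr').toLinearMap ∘ₗ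
      (TensorProduct.mk k Ω Θ) a)
    ((of k gr gr').toLinearMap ∘ₗ (TensorProduct.mk k Ω Θ) (a * a') ∘ₗ
      LinearMap.mulRight k b')) ?_ b
  intro i b hb
  simpa using of_tmul_mul_of_tmul a hb ha' b'

theorem mul_mem_tensorDegree {m n : ℕ} {u v : Ω ⊗[k] Θ} (hu : u ∈ tensorDegree gr gr' m)
    (hv : v ∈ tensorDegree gr gr' n) :
    (of k gr gr').symm (of k gr gr' u * of k gr gr' v) ∈ tensorDegree gr gr' (m + n) := by
  have key : ∀ u ∈ tensorDegree gr gr' m, tensorDegree gr gr' n ≤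
      (tensorDegree gr gr' (m + n)).comap ((of k gr gr').symm.toLinearMap ∘ₗ
        LinearMap.mulLeft k (of k gr gr' u) ∘ₗ (of k gr gr').toLinearMap) := by
    intro u hu
    refine tensorDegree_le fun i j hij a ha b hb => ?_
    have : tensorDegree gr gr' m ≤
      (tensorDegree gr gr' (m + n)).comap ((of k gr gr').symm.toLinearMap ∘ₗ
        LinearMap.mulRight k (of k gr gr' (a ⊗ₜ[k] b)) ∘ₗ (of k gr gr').toLinearMap) := by
      refine tensorDegree_le fun i' j' hij' a' ha' b' hb' => ?_
      have e := of_tmul_mul_of_tmul (k := k) a' hb' ha b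
      simp only [Submodule.mem_comap, LinearMap.comp_apply, LinearEquiv.coe_coe,
        LinearMap.mulRight_apply, e, map_smul, of_symm_of]
      refine Submodule.smul_mem _ _ (tmul_mem_tensorDegree
        (SetLike.GradedMul.mul_mem ha' ha) (SetLike.GradedMul.mul_mem hb' hb) (by omega))
    exact this hu
  exact key u hu hv

theorem tensorDifferential_tmul {d : Ω →ₗ[k] Ω} {d' : Θ →ₗ[k] Θ} {n : ℕ} {ω : Ω} (h : ω ∈ gr n)
    (η : Θ) : tensorDifferential gr d d' (ω ⊗ₜ[k] η) =
      d ω ⊗ₜ[k] η + (-1 : k) ^ n • ω ⊗ₜ[k] d' η := by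
  simp [tensorDifferential, gradeInvolution_of_mem h, TensorProduct.smul_tmul']

/-- The differential of a tensor product satisfies the graded Leibniz rule for products with a
homogeneous tensor on the left. -/
theorem tensorDifferential_mul {d : Ω →ₗ[k] Ω} {d' : Θ →ₗ[k] Θ}
    (hdeg : ∀ n, ∀ ω ∈ gr n, d ω ∈ gr (n + 1)) (hdeg' : ∀ n, ∀ ω ∈ gr' n, d' ω ∈ gr' (n + 1))
    (hd : ∀ n, ∀ ω ∈ gr n, ∀ η, d (ω * η) = d ω * η + (-1 : k) ^ n • (ω * d η))
    (hd' : ∀ n, ∀ ω ∈ gr' n, ∀ η, d' (ω * η) = d' ω * η + (-1 : k) ^ n • (ω * d' η))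
    {i j : ℕ} {a : Ω} (ha : a ∈ gr i) {b : Θ} (hb : b ∈ gr' j) (v : Ω ⊗[k] Θ) :
    of k gr gr' (tensorDifferential gr d d'
      ((of k gr gr').symm (of k gr gr' (a ⊗ₜ[k] b) * of k gr gr' v))) =
    of k gr gr' (tensorDifferential gr d d' (a ⊗ₜ[k] b)) * of k gr gr' v +
      (-1 : k) ^ (i + j) • (of k gr gr' (a ⊗ₜ[k] b) *
        of k gr gr' (tensorDifferential gr d d' v)) := by
  refine LinearMap.congr_fun (f := (of k gr gr').toLinearMap ∘ₗ tensorDifferential gr d d' ∘ₗ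
    (of k gr gr').symm.toLinearMap ∘ₗ LinearMap.mulLeft k (of k gr gr' (a ⊗ₜ[k] b)) ∘ₗ
      (of k gr gr').toLinearMap) (g := LinearMap.mulLeft k
      (of k gr gr' (tensorDifferential gr d d' (a ⊗ₜ[k] b))) ∘ₗ (of k gr gr').toLinearMap +
      (-1 : k) ^ (i + j) • LinearMap.mulLeft k (of k gr gr' (a ⊗ₜ[k] b)) ∘ₗ
        (of k gr gr').toLinearMap ∘ₗ tensorDifferential gr d d') ?_ v
  refine ext_homogeneous_tmul gr gr' fun i' j' a' ha' b' hb' => ?_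
  have e : ∀ n, ∀ ω ∈ gr n, ∀ η, tensorDifferential gr d d' (ω ⊗ₜ[k] η) =
      d ω ⊗ₜ[k] η + (-1 : k) ^ n • ω ⊗ₜ[k] d' η := fun n ω h η => tensorDifferential_tmul h η
  have haa : a * a' ∈ gr (i + i') := SetLike.GradedMul.mul_mem ha ha'
  simp only [LinearMap.comp_apply, LinearEquiv.coe_coe, LinearMap.mulLeft_apply,
    LinearMap.add_apply, LinearMap.smul_apply, of_tmul_mul_of_tmul a hb ha' b', e _ _ ha,
    e _ _ ha', map_smul, map_add, of_symm_of, add_mul, mul_add, smul_mul_assoc,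
    of_tmul_mul_of_tmul _ hb ha', of_tmul_mul_of_tmul _ hb (hdeg _ _ ha'),
    of_tmul_mul_of_tmul _ (hdeg' _ _ hb) ha', e _ _ haa, hd _ _ ha, hd' _ _ hb,
    TensorProduct.add_tmul, TensorProduct.tmul_add, ← TensorProduct.smul_tmul',
    TensorProduct.tmul_smul, smul_add, smul_smul]
  -- Only the parities of `i`, `j` and `i'` enter the signs, and for each choice the claim is a
  -- linear identity.
  rcases neg_one_pow_eq_or k i with h1 | h1 <;> rcases neg_one_pow_eq_or k j with h2 | h2 <;>
    rcases neg_one_pow_eq_or k i' with h3 | h3 <;>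
    simp only [pow_add, pow_mul, h1, h2, h3, mul_one, pow_one, one_pow] <;>
    module

theorem tensorDifferential_mul_of_mem {d : Ω →ₗ[k] Ω} {d' : Θ →ₗ[k] Θ}
    (hdeg : ∀ n, ∀ ω ∈ gr n, d ω ∈ gr (n + 1)) (hdeg' : ∀ n, ∀ ω ∈ gr' n, d' ω ∈ gr' (n + 1))
    (hd : ∀ n, ∀ ω ∈ gr n, ∀ η, d (ω * η) = d ω * η + (-1 : k) ^ n • (ω * d η))
    (hd' : ∀ n, ∀ ω ∈ gr' n, ∀ η, d' (ω * η) = d' ω * η + (-1 : k) ^ n • (ω * d' η))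
    {n : ℕ} {u : Ω ⊗[k] Θ} (hu : u ∈ tensorDegree gr gr' n) (v : Ω ⊗[k] Θ) :
    of k gr gr' (tensorDifferential gr d d'
      ((of k gr gr').symm (of k gr gr' u * of k gr gr' v))) =
    of k gr gr' (tensorDifferential gr d d' u) * of k gr gr' v +
      (-1 : k) ^ n • (of k gr gr' u * of k gr gr' (tensorDifferential gr d d' v)) := by
  refine tensorDegree_le (V := LinearMap.eqLocus ((of k gr gr').toLinearMap ∘ₗ
      tensorDifferential gr d d' ∘ₗ (of k gr gr').symm.toLinearMap ∘ₗ
      LinearMap.mulRight k (of k gr gr' v) ∘ₗ (of k gr gr').toLinearMap)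
    (LinearMap.mulRight k (of k gr gr' v) ∘ₗ (of k gr gr').toLinearMap ∘ₗ
      tensorDifferential gr d d' + (-1 : k) ^ n • LinearMap.mulRight k
        (of k gr gr' (tensorDifferential gr d d' v)) ∘ₗ (of k gr gr').toLinearMap)) ?_ hu
  rintro i j rfl a ha b hb
  exact tensorDifferential_mul hdeg hdeg' hd hd' ha hb v

theorem of_tmul_mul_of_zero_left (a : Ω) {b : Θ} (hb : b ∈ gr' 0) (v : Ω ⊗[k] Θ) :
    of k gr gr' (a ⊗ₜ[k] b) * of k gr gr' v = of k gr gr' ((a ⊗ₜ[k] b) * v) := by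
  induction v with
  | zero => simp
  | add x y hx hy => simp only [map_add, mul_add, hx, hy]
  | tmul a' b' => rw [of_tmul_mul_of_tmul_zero_left _ hb, Algebra.TensorProduct.tmul_mul_tmul]

/-- Tensors whose second factor has positive degree are killed, alone and in every product, and the
remaining ones multiply without sign. Hence this projection turns the graded product into the
ordinary one, which links the extended coaction to the coaction on forms. -/
theorem map_proj_zero_mul (u v : Ω ⊗[k] Θ) :
    TensorProduct.map LinearMap.id (GradedAlgebra.proj gr' 0)
      ((of k gr gr').symm (of k gr gr' u * of k gr gr' v)) =
    TensorProduct.map LinearMap.id (GradedAlgebra.proj gr' 0) u *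
      TensorProduct.map LinearMap.id (GradedAlgebra.proj gr' 0) v := by
  let P : Ω ⊗[k] Θ →ₗ[k] Ω ⊗[k] Θ := TensorProduct.map LinearMap.id (GradedAlgebra.proj gr' 0)
  refine LinearMap.congr_fun (f := P ∘ₗ (of k gr gr').symm.toLinearMap ∘ₗ
    LinearMap.mulRight k (of k gr gr' v) ∘ₗ (of k gr gr').toLinearMap)
    (g := LinearMap.mulRight k (P v) ∘ₗ P) ?_ u
  refine ext_homogeneous_tmul gr gr' fun i j a ha b hb => ?_
  refine LinearMap.congr_fun (f := P ∘ₗ (of k gr gr').symm.toLinearMap ∘ₗ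
    LinearMap.mulLeft k (of k gr gr' (a ⊗ₜ[k] b)) ∘ₗ (of k gr gr').toLinearMap)
    (g := LinearMap.mulLeft k (P (a ⊗ₜ[k] b)) ∘ₗ P) ?_ v
  refine ext_homogeneous_tmul gr gr' fun i' j' a' ha' b' hb' => ?_
  simp only [LinearMap.comp_apply, LinearEquiv.coe_coe, LinearMap.mulLeft_apply,
    of_tmul_mul_of_tmul a hb ha' b', map_smul, of_symm_of, P, TensorProduct.map_tmul,
    LinearMap.id_apply, Algebra.TensorProduct.tmul_mul_tmul]
  rcases Nat.eq_zero_or_pos j with rfl | hj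
  · simp [proj_of_mem hb, proj_mul_of_mem_zero hb]
  · rw [proj_of_mem_ne hb hj.ne', proj_of_mem_ne (SetLike.GradedMul.mul_mem hb hb') (by omega)]
    simp

/-- Elements coming from `A ⊗ H` have bidegree zero, so they cause no sign and preserve every
bidegree. This is the source of the linearity of `ver` along the coaction. -/
theorem map_proj_mul {A H : Type} [Ring A] [Algebra k A] [Ring H] [Algebra k H]
    {ι : A →ₐ[k] Ω} (hι : ∀ a, ι a ∈ gr 0) {ι' : H →ₐ[k] Θ} (hι' : ∀ h, ι' h ∈ gr' 0) (i j : ℕ)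
    (u : A ⊗[k] H) (v : Ω ⊗[k] Θ) :
    TensorProduct.map (GradedAlgebra.proj gr i) (GradedAlgebra.proj gr' j)
      ((of k gr gr').symm (of k gr gr' (Algebra.TensorProduct.map ι ι' u) * of k gr gr' v)) =
    Algebra.TensorProduct.map ι ι' u *
      TensorProduct.map (GradedAlgebra.proj gr i) (GradedAlgebra.proj gr' j) v := by
  induction u with
  | zero => simp
  | add x y hx hy => simp only [map_add, add_mul, hx, hy]
  | tmul a h =>
    induction v with
    | zero => simp
    | add x y hx hy => simp only [map_add, mul_add, hx, hy]
    | tmul ω η =>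
      rw [Algebra.TensorProduct.map_tmul, of_tmul_mul_of_tmul_zero_left _ (hι' h), of_symm_of,
        TensorProduct.map_tmul, TensorProduct.map_tmul, Algebra.TensorProduct.tmul_mul_tmul,
        proj_mul_of_mem_zero (hι a), proj_mul_of_mem_zero (hι' h)]

end GradedTensor

end QHopf
end

open scoped TensorProduct LaurentPolynomial DirectSum

noncomputable section

namespace QHopf

universe u

/-! ### Faithful flatness of projective modules with a free summand, by retracts. -/

section FlatCriterion

/-- A retract of a short exact sequence is short exact. -/
theorem shortExact_of_retract {X Y Z X' Y' Z' : Type*} [Zero Z] [Zero Z']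
    {f : X → Y} {g : Y → Z} {f' : X' → Y'} {g' : Y' → Z'}
    {iX : X → X'} {iY : Y → Y'} {iZ : Z → Z'} {rX : X' → X} {rY : Y' → Y} {rZ : Z' → Z}
    (hX : ∀ x, rX (iX x) = x) (hY : ∀ y, rY (iY y) = y) (hZ : ∀ z, rZ (iZ z) = z)
    (hiZ : iZ 0 = 0) (if_ : ∀ x, iY (f x) = f' (iX x)) (ig : ∀ y, iZ (g y) = g' (iY y))
    (rf : ∀ x, rY (f' x) = f (rX x)) (rg : ∀ y, rZ (g' y) = g (rY y))
    (h : Function.Injective f' ∧ Function.Exact f' g' ∧ Function.Surjective g') :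
    Function.Injective f ∧ Function.Exact f g ∧ Function.Surjective g := by
  obtain ⟨h1, h2, h3⟩ := h
  have hrZ : rZ 0 = 0 := by rw [← hiZ, hZ]
  refine ⟨fun x y hxy => ?_, fun y => ⟨fun hy => ?_, ?_⟩, fun z => ?_⟩
  · rw [← hX x, h1 (by rw [← if_, hxy, if_] : f' (iX x) = f' (iX y)), hX]
  · obtain ⟨x, hx⟩ := (h2 (iY y)).1 (by rw [← ig, hy, hiZ])
    exact ⟨rX x, by rw [← rf, hx, hY]⟩
  · rintro ⟨x, rfl⟩
    rw [← hZ (g (f x)), ig, if_, (h2 _).2 ⟨_, rfl⟩, hrZ]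
  · obtain ⟨y, hy⟩ := h3 (iZ z)
    exact ⟨rY y, by rw [← rg, hy, hZ]⟩

theorem shortExact_finsupp (I : Type*) {X Y Z : Type*} [AddCommGroup X] [AddCommGroup Y]
    [AddCommGroup Z] {f : X →+ Y} {g : Y →+ Z}
    (h : Function.Injective f ∧ Function.Exact f g ∧ Function.Surjective g) :
    Function.Injective (Finsupp.mapRange.addMonoidHom (ι := I) f) ∧
      Function.Exact (Finsupp.mapRange.addMonoidHom (ι := I) f)
        (Finsupp.mapRange.addMonoidHom (ι := I) g) ∧
      Function.Surjective (Finsupp.mapRange.addMonoidHom (ι := I) g) := by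
  obtain ⟨h1, h2, h3⟩ := h
  -- A merely set-theoretic left inverse of `f` that fixes `0` is enough to lift finitely supported
  -- families coordinate by coordinate.
  have h0 : Function.invFun f 0 = 0 := by
    have := Function.leftInverse_invFun h1 0
    rwa [map_zero] at this
  refine ⟨Finsupp.mapRange_injective _ (map_zero f) h1, fun y => ⟨fun hy => ?_, ?_⟩,
    Finsupp.mapRange_surjective _ (map_zero g) h3⟩
  · refine ⟨Finsupp.mapRange (Function.invFun f) h0 y, Finsupp.ext fun i => ?_⟩
    have := (h2 (y i)).1 (by simpa using DFunLike.congr_fun hy i)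
    simpa using Function.invFun_eq this
  · rintro ⟨x, rfl⟩
    exact Finsupp.ext fun i => by simpa using (h2 _).2 ⟨x i, rfl⟩

variable {k : Type u} [Field k] {B : Type u} [Ring B] [Algebra k B]
variable {M : Type u} [AddCommGroup M] [Module k M] [Module B M]

variable (k B) in
/-- `(x, b) ↦ x b` for a right `B`-module `X`. -/
def rightMul (X : Type u) [AddCommGroup X] [Module k X] [Module Bᵐᵒᵖ X] [IsScalarTower k Bᵐᵒᵖ X] :
    X →ₗ[k] B →ₗ[k] X :=
  LinearMap.mk₂ k (fun x b => MulOpposite.op b • x) (fun _ _ _ => smul_add _ _ _)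
    (fun c x b => by
      rw [← algebraMap_smul Bᵐᵒᵖ c x, ← mul_smul, ← Algebra.commutes, mul_smul, algebraMap_smul])
    (fun x b b' => by rw [MulOpposite.op_add, add_smul])
    (fun c x b => by rw [MulOpposite.op_smul, smul_assoc])

section

variable {X Y : Type u} [AddCommGroup X] [Module k X] [Module Bᵐᵒᵖ X] [IsScalarTower k Bᵐᵒᵖ X]
  [AddCommGroup Y] [Module k Y] [Module Bᵐᵒᵖ Y] [IsScalarTower k Bᵐᵒᵖ Y]

/-- The class of `x ⊗ m` in `X ⊗_B M`. -/
def balancedMk (x : X) (m : M) : BalancedTensor k B M X := (balancedRel k B M X).mkQ (x ⊗ₜ[k] m)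

theorem balancedMk_smul (x : X) (b : B) (m : M) :
    balancedMk (k := k) (B := B) (MulOpposite.op b • x) m = balancedMk x (b • m) := by
  rw [balancedMk, balancedMk, ← sub_eq_zero, ← map_sub]
  exact (Submodule.Quotient.mk_eq_zero _).2 (Submodule.subset_span ⟨x, b, m, rfl⟩)

theorem balancedMap_mk (f : X →ₗ[Bᵐᵒᵖ] Y) (x : X) (m : M) :
    balancedMap k B M f (balancedMk x m) = balancedMk (f x) m := rfl

theorem balanced_induction {P : BalancedTensor k B M X → Prop}
    (hadd : ∀ a b, P a → P b → P (a + b)) (hmk : ∀ x m, P (balancedMk x m))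
    (z : BalancedTensor k B M X) : P z := by
  obtain ⟨z, rfl⟩ := Submodule.mkQ_surjective _ z
  induction z with
  | zero => simpa [balancedMk] using hmk 0 0
  | add a b ha hb => rw [map_add]; exact hadd _ _ ha hb
  | tmul x m => exact hmk x m

variable [IsScalarTower k B M]

/-- The map `X ⊗_B M → X ⊗_B B = X` given by a `B`-linear form on `M`. -/
def balancedContract (p : M →ₗ[B] B) : BalancedTensor k B M X →ₗ[k] X :=
  (balancedRel k B M X).liftQ
    (TensorProduct.lift ((rightMul k B X).compl₂ (p.restrictScalars k))) (by
      refine Submodule.span_le.2 ?_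
      rintro _ ⟨x, b, m, rfl⟩
      simp [rightMul, mul_smul])

theorem balancedContract_mk (p : M →ₗ[B] B) (x : X) (m : M) :
    balancedContract (k := k) p (balancedMk x m) = MulOpposite.op (p m) • x := rfl

/-- The map `X ⊗_B M → X ⊗_B B^(I) = X^(I)` given by a `B`-linear map from `M` to a free module. -/
def balancedCoords {I : Type u} (s : M →ₗ[B] I →₀ B) : BalancedTensor k B M X →ₗ[k] I →₀ X :=
  (balancedRel k B M X).liftQ
    (TensorProduct.lift (LinearMap.mk₂ k
      (fun x m => Finsupp.mapRange.linearMap (rightMul k B X x) (s m))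
      (fun x y m => by ext i; simp) (fun c x m => by ext i; simp)
      (fun x m n => by ext i; simp) (fun c x m => by
        rw [← algebraMap_smul B c m, map_smul]
        ext i
        simp))) (by
      refine Submodule.span_le.2 ?_
      rintro _ ⟨x, b, m, rfl⟩
      rw [SetLike.mem_coe, LinearMap.mem_ker, map_sub, sub_eq_zero]
      ext i
      simp [rightMul, mul_smul])

theorem balancedCoords_mk {I : Type u} (s : M →ₗ[B] I →₀ B) (x : X) (m : M) (i : I) :
    balancedCoords (k := k) s (balancedMk x m) i = MulOpposite.op (s m i) • x := rfl

variable (k B M X) in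
/-- `∑ xₘ · m ↦ ∑ xₘ ⊗ m`. -/
def balancedCombination : (M →₀ X) →ₗ[k] BalancedTensor k B M X :=
  Finsupp.lsum k fun m => (balancedRel k B M X).mkQ ∘ₗ (TensorProduct.mk k X M).flip m

/-- Expand `m` by the splitting `s` and move the coefficients to the left factor: `x ⊗ m` becomes
the sum of `x s(m)ₙ ⊗ n` over `n` in `M`. So `X ⊗_B M` is a retract of the families `M →₀ X`,
naturally in `X`. -/
theorem balancedCombination_coords {s : M →ₗ[B] M →₀ B}
    (hs : Function.LeftInverse (Finsupp.linearCombination B id) s) (z : BalancedTensor k B M X) :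
    balancedCombination k B M X (balancedCoords s z) = z := by
  induction z using balanced_induction with
  | hadd a b ha hb => rw [map_add, map_add, ha, hb]
  | hmk x m =>
    have e : balancedCoords (k := k) s (balancedMk x m) =
        Finsupp.mapRange.linearMap (rightMul k B X x) (s m) := rfl
    rw [e, balancedCombination, Finsupp.lsum_apply, Finsupp.mapRange.linearMap_apply,
      Finsupp.sum_mapRange_index (by simp)]
    change (s m).sum (fun m' b => balancedMk (k := k) (B := B) (MulOpposite.op b • x) m') = _
    simp only [balancedMk_smul]
    conv_rhs => rw [← hs m, Finsupp.linearCombination_apply]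
    simp only [Finsupp.sum, balancedMk, TensorProduct.tmul_sum, map_sum, id]

theorem balancedCoords_map {I : Type u} (s : M →ₗ[B] I →₀ B) (f : X →ₗ[Bᵐᵒᵖ] Y)
    (z : BalancedTensor k B M X) : balancedCoords s (balancedMap k B M f z) =
      Finsupp.mapRange.addMonoidHom (f : X →+ Y) (balancedCoords s z) := by
  induction z using balanced_induction with
  | hadd a b ha hb => simp only [map_add, ha, hb]
  | hmk x m => ext i; simp [balancedMap_mk, balancedCoords_mk]

theorem balancedCombination_map (f : X →ₗ[Bᵐᵒᵖ] Y) (z : M →₀ X) :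
    balancedCombination k B M Y (Finsupp.mapRange.addMonoidHom (f : X →+ Y) z) =
      balancedMap k B M f (balancedCombination k B M X z) := by
  induction z using Finsupp.induction_linear with
  | zero => simp
  | add a b ha hb => simp only [map_add, ha, hb]
  | single m x => simp [balancedCombination]; rfl

theorem balancedContract_map (p : M →ₗ[B] B) (f : X →ₗ[Bᵐᵒᵖ] Y) (z : BalancedTensor k B M X) :
    balancedContract p (balancedMap k B M f z) = f (balancedContract p z) := by
  induction z using balanced_induction with
  | hadd a b ha hb => simp only [map_add, ha, hb]
  | hmk x m => simp [balancedMap_mk, balancedContract_mk]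

end

/-- A projective module with a direct summand isomorphic to the ring is faithfully flat. -/
theorem isFaithfullyFlat_of_projective [IsScalarTower k B M] [Module.Projective B M]
    (p : M →ₗ[B] B) (m : M)
    (hm : p m = 1) : IsFaithfullyFlat k B M := by
  obtain ⟨s, hs⟩ := Module.projective_def.1 (inferInstance : Module.Projective B M)
  intro X Y Z _ _ _ _ _ _ _ _ _ _ _ _ f g
  constructor
  · intro h
    -- Exactness passes to families indexed by `M` and then down to their retract.
    exact shortExact_of_retract (balancedCombination_coords hs) (balancedCombination_coords hs)
      (balancedCombination_coords hs) (map_zero _) (balancedCoords_map s f)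
      (balancedCoords_map s g) (balancedCombination_map f) (balancedCombination_map g)
      (shortExact_finsupp M (f := (f : X →+ Y)) (g := (g : Y →+ Z)) h)
  · intro h
    -- As `p m = 1`, contraction with `p` is a left inverse of `w ↦ w ⊗ m`. The original sequence is
    -- thus a retract of the tensored one, and exactness is reflected.
    have hr : ∀ {W : Type u} [AddCommGroup W] [Module k W] [Module Bᵐᵒᵖ W]
        [IsScalarTower k Bᵐᵒᵖ W] (w : W),
        balancedContract (k := k) p (balancedMk (k := k) w m) = w := by
      intro W _ _ _ _ w
      rw [balancedContract_mk, hm, MulOpposite.op_one, one_smul]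
    exact shortExact_of_retract (f' := balancedMap k B M f) (g' := balancedMap k B M g)
      hr hr hr (by simp [balancedMk])
      (fun x => (balancedMap_mk f x m).symm) (fun x => (balancedMap_mk g x m).symm)
      (balancedContract_map p f) (balancedContract_map p g) h

end FlatCriterion

end QHopf
end

open scoped TensorProduct LaurentPolynomial DirectSum

noncomputable section

namespace QHopf

/-! ### Coactions of Laurent polynomials as `ℤ`-gradings; strong gradings give principal bundles. -/

section StronglyGraded

open LaurentPolynomial (T)

variable {k A : Type} [Field k] [Ring A] [Algebra k A]

variable (k A) in
/-- `A ⊗ k[T, T⁻¹]` as the space of finitely supported families in `A`. -/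
def laurentTensor : A ⊗[k] k[T;T⁻¹] ≃ₗ[k] ℤ →₀ A :=
  (TensorProduct.congr (LinearEquiv.refl k A) (AddMonoidAlgebra.coeffLinearEquiv k)).trans
    (TensorProduct.finsuppScalarRight k k A ℤ)

theorem laurentTensor_tmul_T (a : A) (n : ℤ) :
    laurentTensor k A (a ⊗ₜ[k] (T n : k[T;T⁻¹])) = Finsupp.single n a := by
  have : AddMonoidAlgebra.coeff (T n : k[T;T⁻¹]) = Finsupp.single n 1 := rfl
  simp [laurentTensor, this, TensorProduct.finsuppScalarRight_apply_tmul]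

variable (ρ : A →ₐ[k] A ⊗[k] k[T;T⁻¹])

/-- The elements of degree `n`: `ρ a = a ⊗ Tⁿ`. -/
def homog (n : ℤ) : Submodule k A :=
  LinearMap.eqLocus ρ.toLinearMap ((TensorProduct.mk k A k[T;T⁻¹]).flip (T n))

variable {ρ}

theorem mem_homog {n : ℤ} {a : A} : a ∈ homog ρ n ↔ ρ a = a ⊗ₜ[k] (T n : k[T;T⁻¹]) := Iff.rfl

theorem mem_coinvariants_iff {a : A} : a ∈ coinvariants ρ ↔ a ∈ homog ρ 0 := Iff.rfl

theorem one_mem_homog : (1 : A) ∈ homog ρ 0 := by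
  rw [mem_homog, map_one]; rfl

theorem mul_mem_homog {m n p : ℤ} {a b : A} (ha : a ∈ homog ρ m) (hb : b ∈ homog ρ n)
    (h : m + n = p) : a * b ∈ homog ρ p := by
  rw [mem_homog] at *
  rw [map_mul, ha, hb, Algebra.TensorProduct.tmul_mul_tmul, ← LaurentPolynomial.T_add, h]

variable (ρ) in
/-- The component of degree `n`. -/
def component (n : ℤ) : A →ₗ[k] A :=
  Finsupp.lapply n ∘ₗ (laurentTensor k A).toLinearMap ∘ₗ ρ.toLinearMap

theorem component_of_mem {n : ℤ} {a : A} (h : a ∈ homog ρ n) : component ρ n a = a := by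
  simp [component, mem_homog.1 h, laurentTensor_tmul_T]

theorem component_of_mem_ne {m n : ℤ} {a : A} (h : a ∈ homog ρ m) (hmn : m ≠ n) :
    component ρ n a = 0 := by
  simp [component, mem_homog.1 h, laurentTensor_tmul_T, hmn]

theorem mem_of_homog (hspan : ⨆ n, homog ρ n = ⊤) {V : Submodule k A} (h : ∀ n, homog ρ n ≤ V)
    (a : A) : a ∈ V :=
  iSup_le h (hspan ▸ Submodule.mem_top : a ∈ ⨆ n, homog ρ n)

theorem component_mem (hspan : ⨆ n, homog ρ n = ⊤) (n : ℤ) (a : A) :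
    component ρ n a ∈ homog ρ n := by
  refine mem_of_homog hspan (V := (homog ρ n).comap (component ρ n)) (fun m a ha => ?_) a
  rw [Submodule.mem_comap]
  by_cases h : m = n
  · subst h; rwa [component_of_mem ha]
  · rw [component_of_mem_ne ha h]; exact Submodule.zero_mem _

theorem component_mul (hspan : ⨆ n, homog ρ n = ⊤) (n : ℤ) {b : A} (hb : b ∈ homog ρ 0) (a : A) :
    component ρ n (b * a) = b * component ρ n a := by
  refine mem_of_homog hspan (V := LinearMap.eqLocus (component ρ n ∘ₗ LinearMap.mulLeft k b)
    (LinearMap.mulLeft k b ∘ₗ component ρ n)) (fun m a ha => ?_) a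
  change component ρ n (b * a) = b * component ρ n a
  have hba := mul_mem_homog hb ha (zero_add m)
  by_cases h : m = n
  · subst h; rw [component_of_mem ha, component_of_mem hba]
  · rw [component_of_mem_ne ha h, component_of_mem_ne hba h, mul_zero]

/-- Both axioms are linear in the element, and for `ρ a = a ⊗ Tⁿ` they say that `Tⁿ` is group-like.
-/
theorem isRightCoaction_of_homog (hspan : ⨆ n, homog ρ n = ⊤) :
    IsRightCoaction ρ.toLinearMap where
  coassoc := by
    refine mem_of_homog hspan (V := LinearMap.eqLocus ((TensorProduct.assoc k A _ _).toLinearMap ∘ₗ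
      TensorProduct.map ρ.toLinearMap LinearMap.id ∘ₗ ρ.toLinearMap)
      (TensorProduct.map LinearMap.id Coalgebra.comul ∘ₗ ρ.toLinearMap)) fun n a ha => ?_
    rw [mem_homog] at ha
    simp [ha]
  counit := by
    refine mem_of_homog hspan (V := LinearMap.eqLocus ((TensorProduct.rid k A).toLinearMap ∘ₗ
      TensorProduct.map LinearMap.id Coalgebra.counit ∘ₗ ρ.toLinearMap)
      LinearMap.id) fun n a ha => ?_
    rw [mem_homog] at ha
    simp [ha]

variable (ρ) in
/-- `1` is a sum of products of elements of degree `-n` and `n`. -/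
def IsStrongAt (n : ℤ) : Prop := ∃ (I : Type) (_ : Fintype I) (u v : I → A),
  (∀ i, u i ∈ homog ρ (-n)) ∧ (∀ i, v i ∈ homog ρ n) ∧ ∑ i, u i * v i = 1

/-- Insert one decomposition of `1` into the middle of the other: `1 = ∑ᵢ uᵢ (∑ⱼ u'ⱼ v'ⱼ) vᵢ`. -/
theorem IsStrongAt.add {m n : ℤ} (hm : IsStrongAt ρ m) (hn : IsStrongAt ρ n) :
    IsStrongAt ρ (m + n) := by
  obtain ⟨I, _, u, v, hu, hv, h⟩ := hm
  obtain ⟨J, _, u', v', hu', hv', h'⟩ := hn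
  refine ⟨I × J, inferInstance, fun p => u p.1 * u' p.2, fun p => v' p.2 * v p.1,
    fun p => mul_mem_homog (hu _) (hu' _) (by ring),
    fun p => mul_mem_homog (hv' _) (hv _) (by ring), ?_⟩
  rw [Fintype.sum_prod_type, ← h]
  refine Finset.sum_congr rfl fun i _ => ?_
  calc ∑ j, u i * u' j * (v' j * v i) = u i * (∑ j, u' j * v' j) * v i := by
        simp only [Finset.mul_sum, Finset.sum_mul, mul_assoc]
    _ = u i * v i := by rw [h', mul_one]

theorem IsStrongAt.all (h1 : IsStrongAt ρ 1) (h2 : IsStrongAt ρ (-1)) (n : ℤ) :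
    IsStrongAt ρ n := by
  induction n using Int.induction_on with
  | zero => exact ⟨Unit, inferInstance, 1, 1, fun _ => by simpa using one_mem_homog,
      fun _ => one_mem_homog, by simp⟩
  | succ i ih => exact ih.add h1
  | pred i ih => exact ih.add h2

theorem galoisMap_mk (a a' : A) : galoisMap ρ ((galoisRel ρ).mkQ (a ⊗ₜ[k] a')) =
    (a ⊗ₜ[k] 1) * ρ a' := by
  simp [galoisMap, preGaloisMap]

/-- The inverse is `a ⊗ Tⁿ ↦ ∑ᵢ a uᵢ ⊗ vᵢ`, where `∑ᵢ uᵢ vᵢ = 1` with `uᵢ` of degree `-n` and `vᵢ`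
of degree `n`. -/
theorem galoisMap_bijective (hspan : ⨆ n, homog ρ n = ⊤) (hs : ∀ n, IsStrongAt ρ n) :
    Function.Bijective (galoisMap ρ) := by
  choose I hI u v hu hv h1 using hs
  let ψ : A ⊗[k] k[T;T⁻¹] →ₗ[k] (A ⊗[k] A) ⧸ galoisRel ρ :=
    Finsupp.lsum k (fun n => ∑ i, (galoisRel ρ).mkQ ∘ₗ (TensorProduct.mk k A A).flip (v n i) ∘ₗ
      LinearMap.mulRight k (u n i)) ∘ₗ (laurentTensor k A).toLinearMap
  have hψ : ∀ a n, ψ (a ⊗ₜ[k] T n) = ∑ i, (galoisRel ρ).mkQ ((a * u n i) ⊗ₜ[k] v n i) := by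
    intro a n
    simp [ψ, laurentTensor_tmul_T]
  have hχ : ∀ (a : A) (n : ℤ), ∀ a' ∈ homog ρ n,
      galoisMap ρ ((galoisRel ρ).mkQ (a ⊗ₜ[k] a')) = (a * a') ⊗ₜ[k] T n := by
    intro a n a' ha'
    rw [galoisMap_mk, mem_homog.1 ha', Algebra.TensorProduct.tmul_mul_tmul, one_mul]
  constructor
  · refine Function.LeftInverse.injective (g := ψ) fun z => ?_
    refine LinearMap.congr_fun (f := ψ ∘ₗ galoisMap ρ) (g := LinearMap.id) ?_ z
    refine Submodule.linearMap_qext _ (TensorProduct.ext' fun a a' => ?_)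
    refine mem_of_homog hspan (V := LinearMap.eqLocus
      (ψ ∘ₗ galoisMap ρ ∘ₗ (galoisRel ρ).mkQ ∘ₗ TensorProduct.mk k A A a)
      ((galoisRel ρ).mkQ ∘ₗ TensorProduct.mk k A A a)) (fun n a' ha' => ?_) a'
    change ψ (galoisMap ρ ((galoisRel ρ).mkQ (a ⊗ₜ[k] a'))) = (galoisRel ρ).mkQ (a ⊗ₜ[k] a')
    rw [hχ _ _ _ ha', hψ]
    -- The product `a' * u n i` has degree `n - n = 0`, so it is coinvariant and may cross the
    -- tensor sign.
    have e : ∀ i, (galoisRel ρ).mkQ ((a * a' * u n i) ⊗ₜ[k] v n i) =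
        (galoisRel ρ).mkQ (a ⊗ₜ[k] (a' * (u n i * v n i))) := by
      intro i
      rw [← sub_eq_zero, ← map_sub, ← mul_assoc a']
      refine (Submodule.Quotient.mk_eq_zero _).2 (Submodule.subset_span ⟨a, v n i, a' * u n i,
        mem_coinvariants_iff.2 (mul_mem_homog ha' (hu n i) (by ring)), by rw [mul_assoc]⟩)
    rw [Finset.sum_congr rfl fun i _ => e i, ← map_sum, ← TensorProduct.tmul_sum, ← Finset.mul_sum,
      h1, mul_one]
  · rw [← LinearMap.range_eq_top, eq_top_iff]
    rintro z -
    have hz : ∀ w : ℤ →₀ A, (laurentTensor k A).symm w ∈ LinearMap.range (galoisMap ρ) := by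
      intro w
      induction w using Finsupp.induction_linear with
      | zero => simp
      | add x y hx hy => rw [map_add]; exact Submodule.add_mem _ hx hy
      | single n a =>
        refine ⟨∑ i, (galoisRel ρ).mkQ ((a * u n i) ⊗ₜ[k] v n i), ?_⟩
        rw [map_sum, Finset.sum_congr rfl fun i _ => hχ _ n _ (hv n i), LinearEquiv.eq_symm_apply,
          ← TensorProduct.sum_tmul]
        simp only [mul_assoc]
        rw [← Finset.mul_sum, h1, mul_one, laurentTensor_tmul_T]
    simpa using hz (laurentTensor k A z)

/-- The elements `v n i` have a dual basis: for `a` of degree `n`, `a = ∑ᵢ (a uᵢ) vᵢ`, and the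
coefficients `a uᵢ` have degree zero. A general `a` has finitely many homogeneous components, so its
family of coefficients is finitely supported. -/
theorem projective_of_strong (hspan : ⨆ n, homog ρ n = ⊤) (hs : ∀ n, IsStrongAt ρ n) :
    Module.Projective (coinvariants ρ) A := by
  choose I hI u v hu hv h1 using hs
  let φ : ∀ n, I n → A →ₗ[k] coinvariants ρ := fun n i =>
    LinearMap.codRestrict (Subalgebra.toSubmodule (coinvariants ρ))
      (LinearMap.mulRight k (u n i) ∘ₗ component ρ n) fun a =>
        mem_coinvariants_iff.2 (mul_mem_homog (component_mem hspan n a) (hu n i) (by ring))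
  have hφ : ∀ n i a, ((φ n i a : coinvariants ρ) : A) = component ρ n a * u n i :=
    fun _ _ _ => rfl
  let s₀ : A →ₗ[k] (Σ n, I n) →₀ coinvariants ρ :=
    Finsupp.lsum k (fun n => ∑ i, (Finsupp.lsingle (⟨n, i⟩ : Σ n, I n) :
      coinvariants ρ →ₗ[k] (Σ n, I n) →₀ coinvariants ρ) ∘ₗ φ n i) ∘ₗ
      (laurentTensor k A).toLinearMap ∘ₗ ρ.toLinearMap
  have hs₀ : ∀ n, ∀ a ∈ homog ρ n, s₀ a = ∑ i, Finsupp.single ⟨n, i⟩ (φ n i a) := by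
    intro n a ha
    simp [s₀, mem_homog.1 ha, laurentTensor_tmul_T]
  let s : A →ₗ[coinvariants ρ] (Σ n, I n) →₀ coinvariants ρ :=
    { toFun := s₀
      map_add' := map_add s₀
      map_smul' := by
        intro b a
        let L : ((Σ n, I n) →₀ coinvariants ρ) →ₗ[k] ((Σ n, I n) →₀ coinvariants ρ) :=
          Finsupp.mapRange.linearMap (LinearMap.mulLeft k b)
        have hL : ∀ w, L w = b • w := fun w => Finsupp.ext fun i => by simp [L]
        refine mem_of_homog hspan (V := LinearMap.eqLocus (s₀ ∘ₗ LinearMap.mulLeft k (b : A))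
          (L ∘ₗ s₀)) (fun n a ha => ?_) a |>.trans (hL _)
        have hba : (b : A) * a ∈ homog ρ n :=
          mul_mem_homog (mem_coinvariants_iff.1 b.2) ha (zero_add n)
        change s₀ ((b : A) * a) = L (s₀ a)
        rw [hL, hs₀ _ _ ha, hs₀ _ _ hba, Finset.smul_sum]
        refine Finset.sum_congr rfl fun i _ => ?_
        rw [Finsupp.smul_single]
        congr 1
        apply Subtype.ext
        rw [hφ, component_mul hspan n (mem_coinvariants_iff.1 b.2), mul_assoc]
        rfl }
  refine Module.Projective.of_split s
    (Finsupp.linearCombination (coinvariants ρ) fun p : Σ n, I n => v p.1 p.2) ?_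
  ext a
  let R : ((Σ n, I n) →₀ coinvariants ρ) →ₗ[k] A :=
    (Finsupp.linearCombination (coinvariants ρ) fun p : Σ n, I n => v p.1 p.2).restrictScalars k
  refine mem_of_homog hspan (V := LinearMap.eqLocus (R ∘ₗ s₀) LinearMap.id) (fun n a ha => ?_) a
  change Finsupp.linearCombination (coinvariants ρ) (fun p : Σ n, I n => v p.1 p.2) (s₀ a) = a
  rw [hs₀ _ _ ha, map_sum]
  have e : ∀ i, Finsupp.linearCombination (coinvariants ρ) (fun p : Σ n, I n => v p.1 p.2)
      (Finsupp.single ⟨n, i⟩ (φ n i a)) = a * (u n i * v n i) := by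
    intro i
    rw [Finsupp.linearCombination_single, ← mul_assoc]
    conv_rhs => rw [← component_of_mem ha]
    rfl
  rw [Finset.sum_congr rfl fun i _ => e i, ← Finset.mul_sum, h1, mul_one]

/-- A strongly `ℤ`-graded algebra is a quantum principal bundle for `k[T, T⁻¹]`. -/
theorem isQuantumPrincipalBundle_of_strong (hspan : ⨆ n, homog ρ n = ⊤) (h1 : IsStrongAt ρ 1)
    (h2 : IsStrongAt ρ (-1)) : IsQuantumPrincipalBundle ρ where
  coaction := isRightCoaction_of_homog hspan
  hopfGalois := galoisMap_bijective hspan (IsStrongAt.all h1 h2)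
  faithfullyFlat := by
    have := projective_of_strong hspan (IsStrongAt.all h1 h2)
    let p : A →ₗ[coinvariants ρ] coinvariants ρ :=
      { toFun := fun a => ⟨component ρ 0 a, mem_coinvariants_iff.2 (component_mem hspan 0 a)⟩
        map_add' := fun a b => Subtype.ext (map_add _ a b)
        map_smul' := fun b a => Subtype.ext
          (component_mul hspan 0 (mem_coinvariants_iff.1 b.2) a) }
    exact isFaithfullyFlat_of_projective p 1 (Subtype.ext (component_of_mem one_mem_homog))

end StronglyGraded

/-! ### The quantum Hopf fibration over the Podleś sphere is a principal bundle. -/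

section Podles

variable (q : ℂ)

theorem gen_mem_homog (f : Gen) : SUq.gen q f ∈ homog (coaction q) f.deg := by
  rw [mem_homog]
  simp [coaction, SUq.lift, SUq.gen, pgen]

theorem iSup_homog : ⨆ n, homog (coaction q) n = ⊤ := by
  rw [eq_top_iff]
  rintro a -
  refine mem_of_generators _ _ (Submodule.mem_iSup_of_mem 0 one_mem_homog) ?_ a
  intro f y hy
  have : (⨆ n, homog (coaction q) n) ≤
      (⨆ n, homog (coaction q) n).comap (LinearMap.mulLeft ℂ (SUq.gen q f)) :=
    iSup_le fun n y hy =>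
      Submodule.mem_iSup_of_mem (f.deg + n) (mul_mem_homog (gen_mem_homog q f) hy rfl)
  exact this hy

/-- The determinant relation in the opposite order: substitute `αδ = 1 + q⁻¹βγ` into the commutator
of `δ` and `α`. -/
theorem de_mul_al : SUq.gen q .de * SUq.gen q .al - q • (SUq.gen q .be * SUq.gen q .ga) = 1 := by
  have h1 := SUq.gen_rel q (.de_al)
  have h2 := SUq.gen_rel q (.det)
  rw [sub_eq_iff_eq_add] at h1 h2
  rw [h1, h2]
  module

theorem coaction_isQuantumPrincipalBundle : IsQuantumPrincipalBundle (coaction q) := by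
  refine isQuantumPrincipalBundle_of_strong (iSup_homog q) ?_ ?_
  -- The decomposition is `δα - qβγ = 1`: `δ, β` have degree `-1` and `α, γ` degree `1`.
  · refine ⟨Fin 2, inferInstance, ![SUq.gen q .de, (-q) • SUq.gen q .be],
      ![SUq.gen q .al, SUq.gen q .ga], ?_, ?_, ?_⟩
    · intro i
      fin_cases i
      · exact gen_mem_homog q .de
      · exact Submodule.smul_mem _ _ (gen_mem_homog q .be)
    · intro i
      fin_cases i
      · exact gen_mem_homog q .al
      · exact gen_mem_homog q .ga
    · rw [← de_mul_al q]
      simp only [Fin.sum_univ_two, Matrix.cons_val_zero, Matrix.cons_val_one, smul_mul_assoc]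
      module
  -- The decomposition is `αδ - q⁻¹γβ = 1`, the determinant relation up to `γβ = βγ`.
  · refine ⟨Fin 2, inferInstance, ![SUq.gen q .al, (-q⁻¹) • SUq.gen q .ga],
      ![SUq.gen q .de, SUq.gen q .be], ?_, ?_, ?_⟩
    · intro i
      fin_cases i
      · exact gen_mem_homog q .al
      · exact Submodule.smul_mem _ _ (gen_mem_homog q .ga)
    · intro i
      fin_cases i
      · exact gen_mem_homog q .de
      · exact gen_mem_homog q .be
    · rw [← SUq.gen_rel q .det]
      simp only [Fin.sum_univ_two, Matrix.cons_val_zero, Matrix.cons_val_one, smul_mul_assoc,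
        SUq.gen_rel q .ga_be]
      module

end Podles

end QHopf
end

open scoped TensorProduct LaurentPolynomial DirectSum

noncomputable section

namespace QHopf

/-! ### Covariance and differential graded extensions, tested on generators. -/

section PresentedCovariance

open LaurentPolynomial (T)
open GradedTensorProduct

variable {k : Type} [Field k] {X : Type} {w : X → ℕ}
  {s : FreeAlgebra k X → FreeAlgebra k X → Prop} {D : X → RingQuot s}
  {d : RingQuot s →ₗ[k] RingQuot s}

theorem iSup_homog_of_generators {Δ : RingQuot s →ₐ[k] RingQuot s ⊗[k] k[T;T⁻¹]} {δ : X → ℤ}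
    (hΔ : ∀ x, pgen s x ∈ homog Δ (δ x)) : ⨆ n, homog Δ n = ⊤ := by
  rw [eq_top_iff]
  rintro a -
  refine mem_of_generators _ _ (Submodule.mem_iSup_of_mem 0 one_mem_homog) ?_ a
  intro x y hy
  have : (⨆ n, homog Δ n) ≤
      (⨆ n, homog Δ n).comap (LinearMap.mulLeft k (pgen s x)) :=
    iSup_le fun n y hy =>
      Submodule.mem_iSup_of_mem (δ x + n) (mul_mem_homog (hΔ x) hy rfl)
  exact this hy

/-- Each generator and its differential have the same coaction degree, so `Δ ∘ d` and `(d ⊗ id) ∘ Δ`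
satisfy the same Leibniz recursion along words. -/
theorem isRightCovariant_of_generators {A : Type} [Ring A] [Algebra k A]
    {ρ : A →ₐ[k] A ⊗[k] k[T;T⁻¹]} {ι : A →ₐ[k] RingQuot s} (h1 : d 1 = 0)
    (hd : ∀ x y, d (pgen s x * y) = D x * y + (-1 : k) ^ w x • (pgen s x * d y))
    {Δ : RingQuot s →ₐ[k] RingQuot s ⊗[k] k[T;T⁻¹]} {δ : X → ℤ}
    (hΔ : ∀ x, pgen s x ∈ homog Δ (δ x)) (hD : ∀ x, D x ∈ homog Δ (δ x))
    (hext : ∀ a, Δ (ι a) = Algebra.TensorProduct.map ι (AlgHom.id k k[T;T⁻¹]) (ρ a)) :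
    IsRightCovariant ρ ι (wordGrading (k := k) w (pgen s)) d Δ where
  coaction := isRightCoaction_of_homog (iSup_homog_of_generators hΔ)
  extends_coaction := hext
  degree := by
    intro n
    refine wordGrading_le (V := fun n => (Submodule.map₂ (TensorProduct.mk k _ k[T;T⁻¹])
      (wordGrading (k := k) w (pgen s) n) ⊤).comap Δ.toLinearMap) ?_ ?_ n
    · rw [Submodule.mem_comap, AlgHom.toLinearMap_apply, map_one]
      exact Submodule.apply_mem_map₂ _ (Submodule.subset_span ⟨[], by simp, by simp⟩)
        Submodule.mem_top
    · intro x n y hy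
      rw [Submodule.mem_comap, AlgHom.toLinearMap_apply] at hy ⊢
      rw [map_mul, mem_homog.1 (hΔ x)]
      have : Submodule.map₂ (TensorProduct.mk k _ k[T;T⁻¹])
          (wordGrading (k := k) w (pgen s) n) ⊤ ≤ (Submodule.map₂ (TensorProduct.mk k _ k[T;T⁻¹])
          (wordGrading (k := k) w (pgen s) (w x + n)) ⊤).comap
            (LinearMap.mulLeft k (pgen s x ⊗ₜ[k] T (δ x))) := by
        refine Submodule.map₂_le.2 fun a ha h _ => ?_
        rw [Submodule.mem_comap, LinearMap.mulLeft_apply, TensorProduct.mk_apply,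
          Algebra.TensorProduct.tmul_mul_tmul]
        exact Submodule.apply_mem_map₂ _ (mul_mem_wordGrading_of_mem (gen_mem w _ x) ha rfl)
          Submodule.mem_top
      exact this hy
  colinear := by
    refine mem_of_generators s (LinearMap.eqLocus (Δ.toLinearMap ∘ₗ d)
      (TensorProduct.map d LinearMap.id ∘ₗ Δ.toLinearMap)) ?_ ?_
    · simp [h1, Algebra.TensorProduct.one_def]
    · intro x y hy
      simp only [LinearMap.mem_eqLocus, LinearMap.comp_apply, AlgHom.toLinearMap_apply] at hy ⊢
      rw [hd, map_mul, mem_homog.1 (hΔ x), map_d_id_mul (hd x), ← hy, map_add, map_smul, map_mul,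
        map_mul, mem_homog.1 (hD x), mem_homog.1 (hΔ x)]

/-- The graded Leibniz rule holds in the source and in the target, so a map that commutes with the
differentials on generators does so everywhere. The grading `gr` is a variable, equal to the word
grading by `hgr`, in order to carry its own `GradedAlgebra` instance. -/
theorem isDGExtension_of_generators {A H Θ : Type} [Ring A] [Algebra k A] [Ring H]
    [HopfAlgebra k H] [Ring Θ] [Algebra k Θ]
    {ρ : A →ₐ[k] A ⊗[k] H} {ι : A →ₐ[k] RingQuot s} {ι' : H →ₐ[k] Θ}
    {gr : ℕ → Submodule k (RingQuot s)} [GradedAlgebra gr] {gr' : ℕ → Submodule k Θ}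
    [GradedAlgebra gr'] {d' : Θ →ₗ[k] Θ} (hgr : gr = wordGrading (k := k) w (pgen s))
    (hdeg : ∀ n, ∀ ω ∈ gr n, d ω ∈ gr (n + 1)) (hdeg' : ∀ n, ∀ ω ∈ gr' n, d' ω ∈ gr' (n + 1))
    (hl : ∀ n, ∀ ω ∈ gr n, ∀ η, d (ω * η) = d ω * η + (-1 : k) ^ n • (ω * d η))
    (hl' : ∀ n, ∀ ω ∈ gr' n, ∀ η, d' (ω * η) = d' ω * η + (-1 : k) ^ n • (ω * d' η))
    (h1 : d 1 = 0) (h1' : d' 1 = 0)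
    (hd : ∀ x y, d (pgen s x * y) = D x * y + (-1 : k) ^ w x • (pgen s x * d y))
    {Φ : RingQuot s →ₐ[k] GradedTensorProduct k gr gr'}
    {u : X → RingQuot s ⊗[k] Θ} (hΦ : ∀ x, Φ (pgen s x) = of k gr gr' (u x))
    (hu : ∀ x, u x ∈ tensorDegree gr gr' (w x))
    (hD : ∀ x, Φ (D x) = of k gr gr' (tensorDifferential gr d d' (u x)))
    (hext : ∀ a, (of k gr gr').symm (Φ (ι a)) = Algebra.TensorProduct.map ι ι' (ρ a)) :
    IsDGExtension ρ ι gr d ι' gr' d' Φ where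
  extends_coaction := hext
  degree := by
    intro n ω hω
    rw [hgr] at hω
    refine wordGrading_le (V := fun n => (tensorDegree gr gr' n).comap
      ((of k gr gr').symm.toLinearMap ∘ₗ Φ.toLinearMap)) ?_ ?_ n hω
    · rw [Submodule.mem_comap, LinearMap.comp_apply, AlgHom.toLinearMap_apply, map_one]
      exact tmul_mem_tensorDegree SetLike.GradedOne.one_mem SetLike.GradedOne.one_mem rfl
    · intro x n y hy
      rw [Submodule.mem_comap, LinearMap.comp_apply, AlgHom.toLinearMap_apply, map_mul, hΦ]
      exact mul_mem_tensorDegree (hu x) hy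
  differential := by
    refine mem_of_generators s (LinearMap.eqLocus ((of k gr gr').symm.toLinearMap ∘ₗ
      Φ.toLinearMap ∘ₗ d) (tensorDifferential gr d d' ∘ₗ (of k gr gr').symm.toLinearMap ∘ₗ
        Φ.toLinearMap)) ?_ ?_
    · simp [h1, h1', tensorDifferential, Algebra.TensorProduct.one_def]
    · intro x y hy
      simp only [LinearMap.mem_eqLocus, LinearMap.comp_apply, AlgHom.toLinearMap_apply,
        LinearEquiv.coe_coe] at hy ⊢
      have e := tensorDifferential_mul_of_mem hdeg hdeg' hl hl' (hu x)
        ((of k gr gr').symm (Φ y))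
      rw [← hy, symm_of_of, symm_of_of] at e
      apply (of k gr gr').injective
      rw [symm_of_of, hd, map_add Φ, map_smul Φ, map_mul Φ, map_mul Φ, map_mul Φ, hΦ, hD, e]

end PresentedCovariance

end QHopf
end

open scoped TensorProduct LaurentPolynomial DirectSum

noncomputable section

namespace QHopf

/-! ### The algebra of forms on the circle: normal forms and freeness. -/

section Circle

open LaurentPolynomial (T)
open GradedTensorProduct

theorem laurent_algHom_ext {R : Type} [Semiring R] [Algebra ℂ R] {f g : ℂ[T;T⁻¹] →ₐ[ℂ] R}
    (h : f (T 1) = g (T 1)) : f = g := by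
  apply AddMonoidAlgebra.algHom_ext'
  · apply MonoidHom.ext_mint
    exact h
  · exact Subsingleton.elim _ _

theorem laurent_mem {V : Submodule ℂ ℂ[T;T⁻¹]} (h1 : 1 ∈ V) (hp : ∀ y ∈ V, T 1 * y ∈ V)
    (hm : ∀ y ∈ V, T (-1) * y ∈ V) (h : ℂ[T;T⁻¹]) : h ∈ V := by
  have hT : ∀ n : ℤ, T n ∈ V := by
    intro n
    induction n using Int.induction_on with
    | zero => exact h1
    | succ i ih => rw [add_comm, LaurentPolynomial.T_add]; exact hp _ ih
    | pred i ih => rw [sub_eq_neg_add, LaurentPolynomial.T_add]; exact hm _ ih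
  induction h using LaurentPolynomial.induction_on' with
  | add a b ha hb => exact V.add_mem ha hb
  | C_mul_T n a => rw [← LaurentPolynomial.smul_eq_C_mul]; exact V.smul_mem _ (hT n)

variable {q : ℂ}

theorem CForm.t_add (m n : ℤ) : CForm.t q (m + n) = CForm.t q m * CForm.t q n := by
  rw [CForm.t, LaurentPolynomial.T_add, map_mul]; rfl

theorem CForm.t_zero : CForm.t q 0 = 1 := map_one _

theorem CForm.t_eq (n : ℤ) : CForm.t q n = ((CForm.tUnit q ^ n : (CForm q)ˣ) : CForm q) := by
  simp [CForm.t, CForm.incl, T, -LaurentPolynomial.single_eq_C_mul_T]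

theorem CForm.t_one : CForm.t q 1 = pgen (CircleRel q) .t := by
  rw [CForm.t_eq, zpow_one]; rfl

theorem CForm.t_neg_one : CForm.t q (-1) = pgen (CircleRel q) .ti := by
  rw [CForm.t_eq, zpow_neg, zpow_one]; rfl

theorem CForm.dt_mul_t_one : CForm.dt q * CForm.t q 1 = q ^ 2 • (CForm.t q 1 * CForm.dt q) := by
  rw [CForm.t_one]
  simpa [CForm.dt, pgen] using RingQuot.mkAlgHom_rel ℂ (CircleRel.dt_t (q := q))

/-- The defining relation says `(1 + q²) dt ∧ dt = 0`, and the scalar is nonzero. -/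
theorem CForm.dt_mul_dt (hq2 : q ^ 2 ≠ -1) : CForm.dt q * CForm.dt q = 0 := by
  have h : CForm.dt q * CForm.dt q = -(q ^ 2) • (CForm.dt q * CForm.dt q) := by
    simpa only [CForm.dt, pgen, map_mul, map_smul] using
      RingQuot.mkAlgHom_rel ℂ (CircleRel.dt_dt (q := q))
  have h' : (1 + q ^ 2) • (CForm.dt q * CForm.dt q) = 0 := by
    rw [add_smul, one_smul]
    nth_rewrite 1 [h]
    module
  refine (smul_eq_zero.1 h').resolve_left fun h0 => hq2 ?_
  linear_combination h0

theorem CForm.t_one_mem : CForm.t q 1 ∈ CForm.gr q 0 :=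
  CForm.t_one (q := q) ▸ gen_mem CGen.deg (pgen (CircleRel q)) .t

theorem CForm.t_neg_one_mem : CForm.t q (-1) ∈ CForm.gr q 0 :=
  CForm.t_neg_one (q := q) ▸ gen_mem CGen.deg (pgen (CircleRel q)) .ti

theorem CForm.dt_mem : CForm.dt q ∈ CForm.gr q 1 :=
  gen_mem CGen.deg (pgen (CircleRel q)) .dt

theorem CForm.incl_mem (h : ℂ[T;T⁻¹]) : CForm.incl q h ∈ CForm.gr q 0 := by
  refine laurent_mem (V := (CForm.gr q 0).comap (CForm.incl q).toLinearMap) ?_ ?_ ?_ h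
  · simpa using (SetLike.GradedOne.one_mem : 1 ∈ CForm.gr q 0)
  · intro y hy
    rw [Submodule.mem_comap, AlgHom.toLinearMap_apply, map_mul]
    exact (SetLike.GradedMul.mul_mem CForm.t_one_mem hy : _ ∈ CForm.gr q (0 + 0))
  · intro y hy
    rw [Submodule.mem_comap, AlgHom.toLinearMap_apply, map_mul]
    exact (SetLike.GradedMul.mul_mem CForm.t_neg_one_mem hy : _ ∈ CForm.gr q (0 + 0))

theorem CForm.t_mem (n : ℤ) : CForm.t q n ∈ CForm.gr q 0 := CForm.incl_mem _

/-- The automorphism `Tⁿ ↦ cⁿ Tⁿ` of the Laurent polynomials. -/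
def laurentScale (c : ℂ) (hc : c ≠ 0) : ℂ[T;T⁻¹] →ₐ[ℂ] ℂ[T;T⁻¹] :=
  AddMonoidAlgebra.lift ℂ _ ℤ
    { toFun := fun n => c ^ n.toAdd • T n.toAdd
      map_one' := by simp
      map_mul' := fun m n => by
        rw [toAdd_mul, zpow_add₀ hc, LaurentPolynomial.T_add, smul_mul_smul_comm] }

theorem laurentScale_T (c : ℂ) (hc : c ≠ 0) (n : ℤ) : laurentScale c hc (T n) = c ^ n • T n := by
  simp [laurentScale, T, -LaurentPolynomial.single_eq_C_mul_T]

/-- Multiply `dt t = q² t dt` by `t⁻¹` from both sides. -/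
theorem CForm.dt_mul_t_neg_one (hq : q ≠ 0) :
    CForm.dt q * CForm.t q (-1) = q⁻¹ ^ 2 • (CForm.t q (-1) * CForm.dt q) := by
  have e1 : CForm.t q (-1) * CForm.t q 1 = 1 := by rw [← CForm.t_add]; exact CForm.t_zero
  have e2 : CForm.t q 1 * CForm.t q (-1) = 1 := by rw [← CForm.t_add]; exact CForm.t_zero
  have h := congrArg (fun z => CForm.t q (-1) * z * CForm.t q (-1)) (CForm.dt_mul_t_one (q := q))
  simp only [mul_assoc, e2, mul_one, mul_smul_comm, smul_mul_assoc] at h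
  rw [← mul_assoc (CForm.t q (-1)) (CForm.t q 1), e1, one_mul] at h
  rw [h, smul_smul, ← mul_pow, inv_mul_cancel₀ hq, one_pow, one_smul]

theorem CForm.dt_mul_incl (hq : q ≠ 0) (h : ℂ[T;T⁻¹]) : CForm.dt q * CForm.incl q h =
    CForm.incl q (laurentScale (q ^ 2) (pow_ne_zero 2 hq) h) * CForm.dt q := by
  refine laurent_mem (V := LinearMap.eqLocus
    (LinearMap.mulLeft ℂ (CForm.dt q) ∘ₗ (CForm.incl q).toLinearMap)
    (LinearMap.mulRight ℂ (CForm.dt q) ∘ₗ (CForm.incl q).toLinearMap ∘ₗ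
      (laurentScale (q ^ 2) (pow_ne_zero 2 hq)).toLinearMap)) ?_ ?_ ?_ h
  · simp
  · intro y hy
    change CForm.dt q * CForm.incl q y =
      CForm.incl q (laurentScale (q ^ 2) (pow_ne_zero 2 hq) y) * CForm.dt q at hy
    change CForm.dt q * CForm.incl q (T 1 * y) =
      CForm.incl q (laurentScale (q ^ 2) (pow_ne_zero 2 hq) (T 1 * y)) * CForm.dt q
    rw [map_mul, map_mul, laurentScale_T, zpow_one, map_mul, map_smul, mul_assoc, ← hy]
    change CForm.dt q * (CForm.t q 1 * _) = (q ^ 2 • CForm.t q 1) * _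
    rw [← mul_assoc, CForm.dt_mul_t_one, smul_mul_assoc, smul_mul_assoc, mul_assoc]
  · intro y hy
    change CForm.dt q * CForm.incl q y =
      CForm.incl q (laurentScale (q ^ 2) (pow_ne_zero 2 hq) y) * CForm.dt q at hy
    change CForm.dt q * CForm.incl q (T (-1) * y) =
      CForm.incl q (laurentScale (q ^ 2) (pow_ne_zero 2 hq) (T (-1) * y)) * CForm.dt q
    rw [map_mul, map_mul, laurentScale_T, map_mul, map_smul, mul_assoc, ← hy]
    change CForm.dt q * (CForm.t q (-1) * _) = ((q ^ 2) ^ (-1 : ℤ) • CForm.t q (-1)) * _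
    rw [← mul_assoc, CForm.dt_mul_t_neg_one hq, smul_mul_assoc, smul_mul_assoc, mul_assoc,
      zpow_neg_one, inv_pow]

theorem CForm.dt_mul_t (hq : q ≠ 0) (n : ℤ) :
    CForm.dt q * CForm.t q n = (q ^ 2) ^ n • (CForm.t q n * CForm.dt q) := by
  rw [CForm.t, CForm.dt_mul_incl hq, laurentScale_T, map_smul, smul_mul_assoc]

/-- The elements of degree zero and one are `h` and `h dt`, and there are no others. -/
theorem CForm.gr_le (hq : q ≠ 0) (hq2 : q ^ 2 ≠ -1) (n : ℕ) : CForm.gr q n ≤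
    match n with
    | 0 => LinearMap.range (CForm.incl q).toLinearMap
    | 1 => LinearMap.range (LinearMap.mulRight ℂ (CForm.dt q) ∘ₗ (CForm.incl q).toLinearMap)
    | _ => ⊥ := by
  let V : ℕ → Submodule ℂ (CForm q) := fun n => match n with
    | 0 => LinearMap.range (CForm.incl q).toLinearMap
    | 1 => LinearMap.range (LinearMap.mulRight ℂ (CForm.dt q) ∘ₗ (CForm.incl q).toLinearMap)
    | _ => ⊥
  have hH : ∀ h n, ∀ y ∈ V n, CForm.incl q h * y ∈ V n := by
    intro h n y hy
    match n, hy with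
    | 0, ⟨a, ha⟩ => exact ⟨h * a, by rw [← ha]; simp⟩
    | 1, ⟨a, ha⟩ => exact ⟨h * a, by rw [← ha]; simp [mul_assoc]⟩
    | n + 2, hy =>
      rw [(Submodule.mem_bot ℂ).1 hy, mul_zero]; exact Submodule.zero_mem _
  refine wordGrading_le (V := V) ⟨1, by simp⟩ ?_ n
  intro x n y hy
  cases x with
  | t => rw [← CForm.t_one, CGen.deg, zero_add]; exact hH _ _ _ hy
  | ti => rw [← CForm.t_neg_one, CGen.deg, zero_add]; exact hH _ _ _ hy
  | dt =>
    rw [CGen.deg, add_comm]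
    change CForm.dt q * y ∈ _
    match n, hy with
    | 0, ⟨a, ha⟩ =>
      exact ⟨laurentScale (q ^ 2) (pow_ne_zero 2 hq) a, by
        rw [← ha]; simp [CForm.dt_mul_incl hq]⟩
    | 1, ⟨a, ha⟩ =>
      refine (Submodule.mem_bot ℂ).2 ?_
      rw [← ha]
      simp only [LinearMap.comp_apply, AlgHom.toLinearMap_apply, LinearMap.mulRight_apply]
      rw [← mul_assoc, CForm.dt_mul_incl hq, mul_assoc, CForm.dt_mul_dt hq2, mul_zero]
    | n + 2, hy =>
      rw [(Submodule.mem_bot ℂ).1 hy, mul_zero]; exact Submodule.zero_mem _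

theorem CForm.range_incl (hq : q ≠ 0) (hq2 : q ^ 2 ≠ -1) :
    LinearMap.range (CForm.incl q).toLinearMap = CForm.gr q 0 := by
  refine le_antisymm ?_ (CForm.gr_le hq hq2 0)
  rintro _ ⟨h, rfl⟩
  exact CForm.incl_mem h

theorem CForm.gr_eq_bot (hq : q ≠ 0) (hq2 : q ^ 2 ≠ -1) (n : ℕ) (hn : 2 ≤ n) :
    CForm.gr q n = ⊥ := by
  obtain ⟨m, rfl⟩ := Nat.exists_eq_add_of_le' hn
  exact le_bot_iff.1 (CForm.gr_le hq hq2 (m + 2))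

theorem CForm.exists_of_mem_one (hq : q ≠ 0) (hq2 : q ^ 2 ≠ -1) {ω : CForm q}
    (hω : ω ∈ CForm.gr q 1) : ∃ h, ω = CForm.incl q h * CForm.dt q := by
  obtain ⟨h, hh⟩ := CForm.gr_le hq hq2 1 hω
  exact ⟨h, hh.symm⟩

variable (q) in
/-- The action of `Ω(H)` on `Ω(H) = H ⊕ H dt` by left multiplication. -/
theorem CForm.exists_rep (hq : q ≠ 0) : ∃ φ : CForm q →ₐ[ℂ] Module.End ℂ (ℂ[T;T⁻¹] × ℂ[T;T⁻¹]),
    (∀ h p, φ (CForm.incl q h) p = (h * p.1, h * p.2)) ∧ φ (CForm.dt q) (1, 0) = (0, 1) := by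
  -- The pair `(a, b)` stands for `a + b dt`. Since `dt a = σ(a) dt` with `σ` the scaling `Tⁿ ↦
  -- q^{2n} Tⁿ`, and `dt ∧ dt` has to vanish, `dt` acts by `(a, b) ↦ (0, σ(a))`.
  let g : CGen → Module.End ℂ (ℂ[T;T⁻¹] × ℂ[T;T⁻¹]) := fun x => match x with
    | .t => LinearMap.prodMap (LinearMap.mulLeft ℂ (T 1)) (LinearMap.mulLeft ℂ (T 1))
    | .ti => LinearMap.prodMap (LinearMap.mulLeft ℂ (T (-1))) (LinearMap.mulLeft ℂ (T (-1)))
    | .dt => LinearMap.inr ℂ _ _ ∘ₗ (laurentScale (q ^ 2) (pow_ne_zero 2 hq)).toLinearMap ∘ₗ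
        LinearMap.fst ℂ _ _
  obtain ⟨φ, hφ⟩ := exists_lift (s := CircleRel q) g (by
    intro a b h
    cases h <;> refine LinearMap.ext fun p => ?_
    · simp [g, ← mul_assoc]
    · simp [g, ← mul_assoc]
    · simp [g, laurentScale_T]
    · simp [g])
  refine ⟨φ, fun h p => ?_, ?_⟩
  · refine laurent_mem (V := LinearMap.eqLocus
      (LinearMap.applyₗ p ∘ₗ φ.toLinearMap ∘ₗ (CForm.incl q).toLinearMap)
      (LinearMap.prod (LinearMap.mulRight ℂ p.1) (LinearMap.mulRight ℂ p.2))) ?_ ?_ ?_ h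
    · simp
    · intro y hy
      change φ (CForm.incl q y) p = (y * p.1, y * p.2) at hy
      change φ (CForm.incl q (T 1 * y)) p = (T 1 * y * p.1, T 1 * y * p.2)
      rw [map_mul, map_mul, Module.End.mul_apply, hy]
      change φ (CForm.t q 1) _ = _
      simp [CForm.t_one, hφ, g, mul_assoc]
    · intro y hy
      change φ (CForm.incl q y) p = (y * p.1, y * p.2) at hy
      change φ (CForm.incl q (T (-1) * y)) p = (T (-1) * y * p.1, T (-1) * y * p.2)
      rw [map_mul, map_mul, Module.End.mul_apply, hy]
      change φ (CForm.t q (-1)) _ = _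
      simp [CForm.t_neg_one, hφ, g, mul_assoc]
  · simp [CForm.dt, hφ, g]

theorem CForm.incl_injective (hq : q ≠ 0) : Function.Injective (CForm.incl q) := by
  obtain ⟨φ, h1, -⟩ := CForm.exists_rep q hq
  intro a b h
  have := congrArg (fun z => (φ z (1, 0)).1) h
  simpa [h1] using this

theorem CForm.isLeftBasis (hq : q ≠ 0) (hq2 : q ^ 2 ≠ -1) :
    IsLeftBasis (CForm.incl q) (CForm.gr q 1) ![CForm.dt q] := by
  obtain ⟨φ, h1, h2⟩ := CForm.exists_rep q hq
  refine ⟨?_, ?_, ?_⟩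
  · intro c _
    simpa using (SetLike.GradedMul.mul_mem (CForm.incl_mem (c 0)) CForm.dt_mem :
      _ ∈ CForm.gr q (0 + 1))
  · intro a _ b _ h
    -- Acting on `(1, 0)` reads off the coefficient of `dt`.
    have := congrArg (fun z => (φ z (1, 0)).2) h
    simp only [Fin.sum_univ_one, map_mul, Module.End.mul_apply, h1, h2,
      mul_one, Matrix.cons_val_fin_one] at this
    funext i
    rw [Subsingleton.elim i 0]
    exact this
  · intro ω hω
    obtain ⟨h, rfl⟩ := CForm.exists_of_mem_one hq hq2 hω
    exact ⟨fun _ => h, trivial, by simp⟩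

end Circle

end QHopf
end

open scoped TensorProduct LaurentPolynomial DirectSum

noncomputable section

namespace QHopf

/-! ### The calculus on the circle: maximality, covariance and the coproduct of forms. -/

section CircleCalculus

open LaurentPolynomial (T)
open GradedTensorProduct

theorem span_le_of_mem {k A Ω : Type} [Field k] [Ring A] [Algebra k A] [Ring Ω] [Algebra k Ω]
    {ι : A →ₐ[k] Ω} {gr : ℕ → Submodule k Ω} [SetLike.GradedMonoid gr] {d : Ω →ₗ[k] Ω}
    (hι : ∀ a, ι a ∈ gr 0) (hd : ∀ a, d (ι a) ∈ gr 1) (n : ℕ) :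
    Submodule.span k (Set.range fun a : A × (Fin n → A) =>
      ι a.1 * (List.ofFn fun i => d (ι (a.2 i))).prod) ≤ gr n := by
  have h : ∀ n (f : Fin n → A), (List.ofFn fun i => d (ι (f i))).prod ∈ gr n := by
    intro n
    induction n with
    | zero => intro f; simpa using (SetLike.GradedOne.one_mem : 1 ∈ gr 0)
    | succ n ih =>
      intro f
      have h := SetLike.GradedMul.mul_mem (hd (f 0)) (ih fun i => f i.succ)
      rw [add_comm 1 n] at h
      simpa using h
  refine Submodule.span_le.2 ?_
  rintro _ ⟨a, rfl⟩
  have := SetLike.GradedMul.mul_mem (hι a.1) (h n a.2)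
  rwa [zero_add] at this

/-- The differentials of the generators `t`, `t⁻¹`, `dt`. -/
def CForm.dGen (q : ℂ) : CGen → CForm q
  | .t => CForm.dt q
  | .ti => -(q⁻¹ ^ 2) • (CForm.t q (-2) * CForm.dt q)
  | .dt => 0

/-- `d` is the differential of the calculus on the circle. -/
structure CForm.IsDifferential {q : ℂ} (d : CForm q →ₗ[ℂ] CForm q) : Prop where
  one : d 1 = 0
  gen_mul : ∀ x y, d (pgen (CircleRel q) x * y) = CForm.dGen q x * y +
    (-1 : ℂ) ^ x.deg • (pgen (CircleRel q) x * d y)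

variable {q : ℂ}

theorem CForm.dGen_mem (x : CGen) : CForm.dGen q x ∈ CForm.gr q (x.deg + 1) := by
  cases x with
  | t => exact CForm.dt_mem
  | ti =>
    refine Submodule.smul_mem (CForm.gr q 1) _ ?_
    exact (SetLike.GradedMul.mul_mem (CForm.t_mem _) CForm.dt_mem : _ ∈ CForm.gr q (0 + 1))
  | dt => exact Submodule.zero_mem _

/-- The corner entries are the differentiated relations. The value `d(t⁻¹) = -t⁻¹ dt t⁻¹ = -q⁻² t⁻²
dt` is forced by differentiating `t t⁻¹ = 1`. -/
theorem CForm.exists_isDifferential (hq : q ≠ 0) (hq2 : q ^ 2 ≠ -1) :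
    ∃ d : CForm q →ₗ[ℂ] CForm q, CForm.IsDifferential d := by
  have e1 : CForm.t q 1 * CForm.t q (-1) = 1 := by rw [← CForm.t_add]; exact CForm.t_zero
  have e2 : CForm.t q (-1) * CForm.t q 1 = 1 := by rw [← CForm.t_add]; exact CForm.t_zero
  have e3 : CForm.t q 1 * CForm.t q (-2) = CForm.t q (-1) := by rw [← CForm.t_add]; rfl
  have e4 : CForm.t q (-2) * CForm.t q 1 = CForm.t q (-1) := by rw [← CForm.t_add]; rfl
  have c1 := CForm.dt_mul_t_one (q := q)
  have c2 := CForm.dt_mul_t_neg_one hq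
  have c3 := CForm.dt_mul_dt hq2
  have hdt : pgen (CircleRel q) .dt = CForm.dt q := rfl
  obtain ⟨d, h1, h2⟩ := exists_differential CGen.deg (CircleRel q) (CForm.dGen q) (by
    intro a b h
    cases h <;> simp only [map_mul, map_smul, map_one, FreeAlgebra.lift_ι_apply, ← CForm.t_one,
      ← CForm.t_neg_one, hdt, CForm.dGen, CGen.deg, pow_zero, one_smul, pow_one, upper_mul,
      upper_smul, upper_one] <;> apply upper_ext
    · exact e1
    · rw [c2, mul_smul_comm, ← mul_assoc, e3]
      module
    · exact e1
    · exact e2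
    · rw [smul_mul_assoc, mul_assoc, c1, mul_smul_comm, ← mul_assoc, e4, smul_smul, neg_mul,
        ← mul_pow, inv_mul_cancel₀ hq]
      module
    · exact e2
    · rw [smul_mul_assoc, c1, mul_smul_comm, smul_comm]
    · simp [c3]
    · exact c1
    · simp [c3]
    · simp
    · simp [c3])
  exact ⟨d, h1, h2⟩

variable {d : CForm q →ₗ[ℂ] CForm q}

theorem CForm.IsDifferential.degree (hd : CForm.IsDifferential d) (n : ℕ) (ω : CForm q)
    (hω : ω ∈ CForm.gr q n) : d ω ∈ CForm.gr q (n + 1) :=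
  degree_of_generators hd.one hd.gen_mul CForm.dGen_mem n ω hω

theorem CForm.IsDifferential.leibniz (hd : CForm.IsDifferential d) (n : ℕ) (ω : CForm q)
    (hω : ω ∈ CForm.gr q n) (η : CForm q) : d (ω * η) = d ω * η + (-1 : ℂ) ^ n • (ω * d η) :=
  leibniz_of_generators hd.one hd.gen_mul n ω hω η

theorem CForm.IsDifferential.d_gen (hd : CForm.IsDifferential d) (x : CGen) :
    d (pgen (CircleRel q) x) = CForm.dGen q x :=
  d_pgen hd.one hd.gen_mul x

theorem CForm.IsDifferential.d_t_one (hd : CForm.IsDifferential d) :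
    d (CForm.t q 1) = CForm.dt q := by
  rw [CForm.t_one, hd.d_gen]; rfl

theorem CForm.IsDifferential.d_t_neg_one (hd : CForm.IsDifferential d) :
    d (CForm.t q (-1)) = -(q⁻¹ ^ 2) • (CForm.t q (-2) * CForm.dt q) := by
  rw [CForm.t_neg_one, hd.d_gen]; rfl

theorem CForm.IsDifferential.d_t_two (hd : CForm.IsDifferential d) :
    d (CForm.t q 2) = (1 + q ^ 2) • (CForm.t q 1 * CForm.dt q) := by
  rw [show (2 : ℤ) = 1 + 1 by norm_num, CForm.t_add, hd.leibniz 0 _ (CForm.t_mem 1), hd.d_t_one,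
    CForm.dt_mul_t_one]
  module

theorem CForm.IsDifferential.isDifferentialCalculus (hd : CForm.IsDifferential d) (hq : q ≠ 0)
    (hq2 : q ^ 2 ≠ -1) : IsDifferentialCalculus (CForm.incl q) (CForm.gr q) d where
  injective := CForm.incl_injective hq
  range_eq := CForm.range_incl hq hq2
  degree := hd.degree
  -- The second differential of a generator has degree at least two, where there are no forms.
  d_d := d_d_of_generators hd.one hd.gen_mul CForm.dGen_mem fun x => by
    have h := hd.degree _ _ (CForm.dGen_mem (q := q) x)
    rw [CForm.gr_eq_bot hq hq2 _ (by omega)] at h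
    simpa using h
  leibniz := hd.leibniz
  generated := by
    intro n
    refine le_antisymm ?_ (span_le_of_mem CForm.incl_mem
      (fun a => hd.degree 0 _ (CForm.incl_mem a)) n)
    intro ω hω
    match n, hω with
    | 0, hω =>
      rw [← CForm.range_incl hq hq2] at hω
      obtain ⟨h, rfl⟩ := hω
      exact Submodule.subset_span ⟨(h, Fin.elim0), by simp⟩
    | 1, hω =>
      obtain ⟨h, rfl⟩ := CForm.exists_of_mem_one hq hq2 hω
      refine Submodule.subset_span ⟨(h, fun _ => T 1), ?_⟩
      simp [← hd.d_t_one, CForm.t]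
    | n + 2, hω =>
      rw [CForm.gr_eq_bot hq hq2 _ (by omega)] at hω
      rw [(Submodule.mem_bot ℂ).1 hω]
      exact Submodule.zero_mem _

/-- It suffices that the images of `t`, `t⁻¹`, `dt` satisfy the defining relations: bilinearity of
`f₁` gives the bimodule relation, and the prolongation condition gives the relation in degree two.
-/
theorem CForm.IsDifferential.isMaximalProlongation (hd : CForm.IsDifferential d) (hq : q ≠ 0)
    (hq2 : q ^ 2 ≠ -1) : IsMaximalProlongation (CForm.incl q) (CForm.gr q) d := by
  intro R _ _ f₀ f₁ hf hz
  let δ : CForm.gr q 1 := ⟨CForm.dt q, CForm.dt_mem⟩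
  have e1 : f₀ (T 1) * f₀ (T (-1)) = 1 := by
    rw [← map_mul, ← LaurentPolynomial.T_add]; exact map_one f₀
  have e2 : f₀ (T (-1)) * f₀ (T 1) = 1 := by
    rw [← map_mul, ← LaurentPolynomial.T_add]; exact map_one f₀
  -- Evaluate `f₁` on the one form `dt t = q² t dt`, seen as a right and as a left multiple of `dt`.
  have e3 : f₁ δ * f₀ (T 1) = q ^ 2 • (f₀ (T 1) * f₁ δ) := by
    have h1 := hf (q ^ 2 • T 1) 1 δ ⟨CForm.dt q * CForm.t q 1,
      (SetLike.GradedMul.mul_mem CForm.dt_mem (CForm.t_mem 1) : _ ∈ CForm.gr q (1 + 0))⟩ (by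
        rw [map_one, mul_one, map_smul, smul_mul_assoc]
        exact CForm.dt_mul_t_one)
    have h2 := hf 1 (T 1) δ ⟨CForm.dt q * CForm.t q 1,
      (SetLike.GradedMul.mul_mem CForm.dt_mem (CForm.t_mem 1) : _ ∈ CForm.gr q (1 + 0))⟩ (by
        rw [map_one, one_mul]
        rfl)
    rw [h1, map_one, mul_one, one_mul, map_smul, smul_mul_assoc] at h2
    exact h2.symm
  have e4 : f₁ δ * f₁ δ = 0 := by
    -- The relation fed to the prolongation condition is `1 · d(t²) - (1 + q²) t · dt = 0`. As `d 1
    -- = 0`, it yields `-(1 + q²) f₁(dt)² = 0`.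
    have h := hz 2 ![1, -(1 + q ^ 2) • T 1] ![T 2, T 1] ![0, -(1 + q ^ 2) • δ]
      ![⟨d (CForm.t q 2), hd.degree 0 _ (CForm.t_mem 2)⟩, δ] (by
        intro i
        fin_cases i
        · simp [hd.one]
        · change -(1 + q ^ 2) • CForm.dt q = d (CForm.incl q (-(1 + q ^ 2) • T 1))
          rw [map_smul, map_smul, ← hd.d_t_one]
          rfl) (by
        intro i
        fin_cases i
        · rfl
        · exact hd.d_t_one.symm) (by
        rw [Fin.sum_univ_two]
        change CForm.incl q 1 * d (CForm.t q 2) +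
          CForm.incl q (-(1 + q ^ 2) • T 1) * d (CForm.t q 1) = 0
        rw [map_one, one_mul, map_smul, hd.d_t_two, hd.d_t_one]
        change (1 + q ^ 2) • (CForm.t q 1 * CForm.dt q) +
          (-(1 + q ^ 2) • CForm.t q 1) * CForm.dt q = 0
        rw [smul_mul_assoc]
        module)
    rw [Fin.sum_univ_two] at h
    change f₁ 0 * _ + f₁ (-(1 + q ^ 2) • δ) * f₁ δ = 0 at h
    rw [map_zero, zero_mul, zero_add, map_smul, smul_mul_assoc] at h
    refine (smul_eq_zero.1 h).resolve_left fun h0 => hq2 ?_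
    linear_combination -h0
  let g : CGen → R := fun x => match x with
    | .t => f₀ (T 1)
    | .ti => f₀ (T (-1))
    | .dt => f₁ δ
  obtain ⟨F, hF⟩ := exists_lift (s := CircleRel q) g (by
    intro a b h
    cases h <;> simp only [map_mul, map_smul, map_one, FreeAlgebra.lift_ι_apply, g]
    · exact e1
    · exact e2
    · exact e3
    · rw [e4, smul_zero])
  have hF₀ : ∀ a, F (CForm.incl q a) = f₀ a := by
    have : F.comp (CForm.incl q) = f₀ := laurent_algHom_ext (by
      change F (CForm.t q 1) = _
      rw [CForm.t_one, hF])
    exact fun a => DFunLike.congr_fun this a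
  refine ⟨F, ⟨hF₀, ?_⟩, ?_⟩
  · rintro ⟨ω, hω⟩
    obtain ⟨h, rfl⟩ := CForm.exists_of_mem_one hq hq2 hω
    rw [hf h 1 δ ⟨_, hω⟩ (by simp [δ]), map_mul, hF₀, map_one, mul_one]
    exact congrArg _ (hF .dt)
  · rintro G ⟨hG₀, hG₁⟩
    refine presented_algHom_ext fun x => ?_
    rw [hF]
    cases x with
    | t => rw [← CForm.t_one]; exact hG₀ _
    | ti => rw [← CForm.t_neg_one]; exact hG₀ _
    | dt => exact hG₁ δ

/-- The degrees of the generators `t`, `t⁻¹`, `dt` for the coaction of the circle. -/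
def CGen.charge : CGen → ℤ
  | .t => 1
  | .ti => -1
  | .dt => 1

variable (q) in
-- Every relation is homogeneous for the charges `1, -1, 1` of `t, t⁻¹, dt`.
theorem CForm.exists_coaction : ∃ Δ : CForm q →ₐ[ℂ] CForm q ⊗[ℂ] ℂ[T;T⁻¹],
    ∀ x, pgen (CircleRel q) x ∈ homog Δ x.charge := by
  let g : CGen → CForm q ⊗[ℂ] ℂ[T;T⁻¹] := fun x => pgen (CircleRel q) x ⊗ₜ[ℂ] T x.charge
  have r : ∀ {a b}, CircleRel q a b →
      RingQuot.mkAlgHom ℂ (CircleRel q) a = RingQuot.mkAlgHom ℂ (CircleRel q) b :=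
    fun h => RingQuot.mkAlgHom_rel ℂ h
  simp only [mem_homog]
  refine exists_lift g ?_
  intro a b h
  have h' := r h
  cases h <;> simp only [map_mul, map_smul, map_one] at h' <;>
    simp only [map_mul, map_smul, map_one, FreeAlgebra.lift_ι_apply, g, pgen, CGen.charge,
      Algebra.TensorProduct.tmul_mul_tmul, ← LaurentPolynomial.T_add,
      TensorProduct.smul_tmul']
  · rw [h']; rfl
  · rw [h']; rfl
  · rw [h']
  · rw [← h']

theorem CForm.dGen_mem_homog {Δ : CForm q →ₐ[ℂ] CForm q ⊗[ℂ] ℂ[T;T⁻¹]}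
    (hΔ : ∀ x, pgen (CircleRel q) x ∈ homog Δ x.charge) (x : CGen) :
    CForm.dGen q x ∈ homog Δ x.charge := by
  cases x with
  | t => exact hΔ .dt
  | ti =>
    refine Submodule.smul_mem _ _ ?_
    rw [show (-2 : ℤ) = -1 + -1 by norm_num, CForm.t_add, CForm.t_neg_one]
    exact mul_mem_homog (mul_mem_homog (hΔ .ti) (hΔ .ti) rfl) (hΔ .dt) rfl
  | dt => exact Submodule.zero_mem _

theorem CForm.coaction_incl {Δ : CForm q →ₐ[ℂ] CForm q ⊗[ℂ] ℂ[T;T⁻¹]}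
    (hΔ : ∀ x, pgen (CircleRel q) x ∈ homog Δ x.charge) (h : ℂ[T;T⁻¹]) :
    Δ (CForm.incl q h) = Algebra.TensorProduct.map (CForm.incl q) (AlgHom.id ℂ ℂ[T;T⁻¹])
      (Bialgebra.comulAlgHom ℂ ℂ[T;T⁻¹] h) := by
  have : Δ.comp (CForm.incl q) = (Algebra.TensorProduct.map (CForm.incl q)
      (AlgHom.id ℂ ℂ[T;T⁻¹])).comp (Bialgebra.comulAlgHom ℂ ℂ[T;T⁻¹]) := by
    apply laurent_algHom_ext
    have h1 := mem_homog.1 (hΔ .t)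
    rw [← CForm.t_one] at h1
    change Δ (CForm.t q 1) = _
    rw [h1]
    simp [CGen.charge, CForm.t]
  exact DFunLike.congr_fun this h

theorem CForm.IsDifferential.isRightCovariant (hd : CForm.IsDifferential d)
    {Δ : CForm q →ₐ[ℂ] CForm q ⊗[ℂ] ℂ[T;T⁻¹]}
    (hΔ : ∀ x, pgen (CircleRel q) x ∈ homog Δ x.charge) :
    IsRightCovariant (Bialgebra.comulAlgHom ℂ ℂ[T;T⁻¹]) (CForm.incl q) (CForm.gr q) d Δ :=
  isRightCovariant_of_generators hd.one hd.gen_mul hΔ (CForm.dGen_mem_homog hΔ)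
    (CForm.coaction_incl hΔ)

/-- Because `H` is cocommutative, the flip of the right coaction is a left coaction, and the other
properties are carried over. -/
theorem CForm.IsDifferential.isLeftCovariant (hd : CForm.IsDifferential d)
    {Δ : CForm q →ₐ[ℂ] CForm q ⊗[ℂ] ℂ[T;T⁻¹]}
    (hΔ : ∀ x, pgen (CircleRel q) x ∈ homog Δ x.charge) :
    IsLeftCovariant (CForm.incl q) (CForm.gr q) d
      ((Algebra.TensorProduct.comm ℂ (CForm q) ℂ[T;T⁻¹]).toAlgHom.comp Δ) := by
  have hR := hd.isRightCovariant hΔ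
  let Δ' := (Algebra.TensorProduct.comm ℂ (CForm q) ℂ[T;T⁻¹]).toAlgHom.comp Δ
  have hΔ' : ∀ n, ∀ a ∈ homog Δ n, Δ' a = T n ⊗ₜ[ℂ] a := by
    intro n a ha
    change Algebra.TensorProduct.comm ℂ (CForm q) ℂ[T;T⁻¹] (Δ a) = _
    rw [mem_homog.1 ha, Algebra.TensorProduct.comm_tmul]
  have hspan := iSup_homog_of_generators hΔ
  refine ⟨⟨?_, ?_⟩, ?_, ?_, ?_⟩
  · refine mem_of_homog hspan (V := LinearMap.eqLocus
      ((TensorProduct.assoc ℂ _ _ _).toLinearMap ∘ₗ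
        TensorProduct.map Coalgebra.comul LinearMap.id ∘ₗ Δ'.toLinearMap)
      (TensorProduct.map LinearMap.id Δ'.toLinearMap ∘ₗ Δ'.toLinearMap)) fun n a ha => ?_
    simp [hΔ' n a ha]
  · refine mem_of_homog hspan (V := LinearMap.eqLocus ((TensorProduct.lid ℂ _).toLinearMap ∘ₗ
      TensorProduct.map Coalgebra.counit LinearMap.id ∘ₗ Δ'.toLinearMap)
      LinearMap.id) fun n a ha => ?_
    simp [hΔ' n a ha]
  · intro h
    have : Δ'.comp (CForm.incl q) = (Algebra.TensorProduct.map (AlgHom.id ℂ ℂ[T;T⁻¹])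
        (CForm.incl q)).comp (Bialgebra.comulAlgHom ℂ ℂ[T;T⁻¹]) := by
      apply laurent_algHom_ext
      have h1 := hΔ' _ _ (hΔ .t)
      rw [← CForm.t_one] at h1
      change Δ' (CForm.t q 1) = _
      rw [h1]
      simp [CGen.charge, CForm.t]
    exact DFunLike.congr_fun this h
  · intro n ω hω
    have h1 := hR.degree n ω hω
    have : Submodule.map₂ (TensorProduct.mk ℂ (CForm q) ℂ[T;T⁻¹]) (CForm.gr q n) ⊤ ≤
        (Submodule.map₂ (TensorProduct.mk ℂ ℂ[T;T⁻¹] (CForm q)) ⊤ (CForm.gr q n)).comap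
          (Algebra.TensorProduct.comm ℂ (CForm q) ℂ[T;T⁻¹]).toAlgHom.toLinearMap :=
      Submodule.map₂_le.2 fun a ha h _ =>
        Submodule.apply_mem_map₂ (TensorProduct.mk ℂ ℂ[T;T⁻¹] (CForm q)) Submodule.mem_top ha
    exact this h1
  · intro ω
    change Algebra.TensorProduct.comm ℂ (CForm q) ℂ[T;T⁻¹] (Δ (d ω)) = TensorProduct.map _ _
      (Algebra.TensorProduct.comm ℂ (CForm q) ℂ[T;T⁻¹] (Δ ω))
    rw [hR.colinear]
    induction Δ ω with
    | zero => simp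
    | add x y hx hy => simp only [map_add, hx, hy]
    | tmul a h => simp

/-- The values on `t`, `t⁻¹`, `dt` of the extension of the coproduct to forms. -/
def CForm.comulGen (q : ℂ) : CGen → CForm q ⊗[ℂ] CForm q
  | .t => CForm.t q 1 ⊗ₜ[ℂ] CForm.t q 1
  | .ti => CForm.t q (-1) ⊗ₜ[ℂ] CForm.t q (-1)
  | .dt => CForm.dt q ⊗ₜ[ℂ] CForm.t q 1 + CForm.t q 1 ⊗ₜ[ℂ] CForm.dt q

theorem CForm.exists_comul (hq2 : q ^ 2 ≠ -1) :
    ∃ Φ : CForm q →ₐ[ℂ] GradedTensorProduct ℂ (CForm.gr q) (CForm.gr q),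
      ∀ x, Φ (pgen (CircleRel q) x) = of ℂ (CForm.gr q) (CForm.gr q) (CForm.comulGen q x) := by
  have e1 : CForm.t q 1 * CForm.t q (-1) = 1 := by rw [← CForm.t_add]; exact CForm.t_zero
  have e2 : CForm.t q (-1) * CForm.t q 1 = 1 := by rw [← CForm.t_add]; exact CForm.t_zero
  have c1 := CForm.dt_mul_t_one (q := q)
  have c3 := CForm.dt_mul_dt hq2
  have m1 := CForm.t_mem (q := q) 1
  have m2 := CForm.dt_mem (q := q)
  refine exists_lift _ ?_
  intro a b h
  cases h <;> simp only [map_mul, map_smul, map_one, FreeAlgebra.lift_ι_apply, CForm.comulGen]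
  · rw [of_tmul_mul_of_tmul_zero_left _ m1, e1]; rfl
  · rw [of_tmul_mul_of_tmul_zero_left _ (CForm.t_mem _), e2]; rfl
  · rw [map_add, add_mul, mul_add, of_tmul_mul_of_tmul_zero_left _ m1,
      of_tmul_mul_of_tmul_zero_right _ _ m1, of_tmul_mul_of_tmul_zero_left _ m1,
      of_tmul_mul_of_tmul_zero_left _ m1, c1, ← TensorProduct.smul_tmul',
      TensorProduct.tmul_smul, map_smul, map_smul, smul_add]
  -- The cross terms `(dt ⊗ t)(t ⊗ dt)` and `(t ⊗ dt)(dt ⊗ t)` both equal `q² t dt ⊗ t dt` up to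
  -- sign, and only the second has the sign of the graded product.
  · have h0 : of ℂ (CForm.gr q) (CForm.gr q)
        (CForm.dt q ⊗ₜ[ℂ] CForm.t q 1 + CForm.t q 1 ⊗ₜ[ℂ] CForm.dt q) *
        of ℂ (CForm.gr q) (CForm.gr q)
        (CForm.dt q ⊗ₜ[ℂ] CForm.t q 1 + CForm.t q 1 ⊗ₜ[ℂ] CForm.dt q) = 0 := by
      rw [map_add, add_mul, mul_add, mul_add, of_tmul_mul_of_tmul_zero_left _ m1,
        of_tmul_mul_of_tmul_zero_left _ m1, of_tmul_mul_of_tmul _ m2 m2,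
        of_tmul_mul_of_tmul_zero_right _ _ m1, c3, c1, TensorProduct.zero_tmul,
        TensorProduct.tmul_zero, map_zero, ← TensorProduct.smul_tmul', TensorProduct.tmul_smul]
      simp
    rw [h0, smul_zero]

theorem CForm.IsDifferential.exists_isDGExtension (hd : CForm.IsDifferential d)
    (hq2 : q ^ 2 ≠ -1) : ∃ Φ, IsDGExtension (Bialgebra.comulAlgHom ℂ ℂ[T;T⁻¹]) (CForm.incl q)
      (CForm.gr q) d (CForm.incl q) (CForm.gr q) d Φ := by
  obtain ⟨Φ, hΦ⟩ := CForm.exists_comul hq2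
  have hp : Φ (CForm.t q 1) = of ℂ (CForm.gr q) (CForm.gr q) (CForm.comulGen q .t) := by
    rw [CForm.t_one]; exact hΦ .t
  have hm : Φ (CForm.t q (-1)) = of ℂ (CForm.gr q) (CForm.gr q) (CForm.comulGen q .ti) := by
    rw [CForm.t_neg_one]; exact hΦ .ti
  have hdt : Φ (CForm.dt q) = of ℂ (CForm.gr q) (CForm.gr q) (CForm.comulGen q .dt) := hΦ .dt
  have hddt : d (CForm.dt q) = 0 := hd.d_gen .dt
  refine ⟨Φ, isDGExtension_of_generators (gr := CForm.gr q) (w := CGen.deg) rfl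
    hd.degree hd.degree hd.leibniz
    hd.leibniz hd.one hd.one hd.gen_mul hΦ ?_ ?_ ?_⟩
  · intro x
    cases x with
    | t => exact tmul_mem_tensorDegree (CForm.t_mem _) (CForm.t_mem _) rfl
    | ti => exact tmul_mem_tensorDegree (CForm.t_mem _) (CForm.t_mem _) rfl
    | dt =>
      refine Submodule.add_mem (tensorDegree (CForm.gr q) (CForm.gr q) 1)
        (tmul_mem_tensorDegree CForm.dt_mem (CForm.t_mem _) rfl)
        (tmul_mem_tensorDegree (CForm.t_mem _) CForm.dt_mem rfl)
  · intro x
    cases x with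
    | t =>
      rw [CForm.dGen, hdt, CForm.comulGen, CForm.comulGen,
        tensorDifferential_tmul (CForm.t_mem _), hd.d_t_one, pow_zero, one_smul]
    | ti =>
      rw [CForm.dGen, CForm.comulGen, tensorDifferential_tmul (CForm.t_mem _), hd.d_t_neg_one,
        show (-2 : ℤ) = -1 + -1 by norm_num, CForm.t_add, map_smul, map_mul, map_mul, hm, hdt,
        CForm.comulGen, CForm.comulGen, of_tmul_mul_of_tmul_zero_left _ (CForm.t_mem _),
        ← CForm.t_add, of_tmul_mul_of_zero_left _ (CForm.t_mem _), mul_add,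
        Algebra.TensorProduct.tmul_mul_tmul, Algebra.TensorProduct.tmul_mul_tmul, ← CForm.t_add,
        ← TensorProduct.smul_tmul', TensorProduct.tmul_smul, pow_zero, one_smul, ← smul_add,
        map_smul]
      rfl
    | dt =>
      rw [CForm.dGen, CForm.comulGen, map_zero, map_add, tensorDifferential_tmul (CForm.t_mem _),
        tensorDifferential_tmul CForm.dt_mem, hddt, hd.d_t_one]
      simp
  · intro h
    refine laurent_mem (V := LinearMap.eqLocus
      ((of ℂ (CForm.gr q) (CForm.gr q)).symm.toLinearMap ∘ₗ Φ.toLinearMap ∘ₗ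
        (CForm.incl q).toLinearMap)
      ((Algebra.TensorProduct.map (CForm.incl q) (CForm.incl q)).toLinearMap ∘ₗ
        (Bialgebra.comulAlgHom ℂ ℂ[T;T⁻¹]).toLinearMap)) ?_ ?_ ?_ h
    · change (of ℂ (CForm.gr q) (CForm.gr q)).symm (Φ (CForm.incl q 1)) =
        Algebra.TensorProduct.map (CForm.incl q) (CForm.incl q)
          (Bialgebra.comulAlgHom ℂ ℂ[T;T⁻¹] 1)
      rw [map_one, map_one, of_symm_one, map_one, map_one]
    · intro y hy
      change _ = Algebra.TensorProduct.map (CForm.incl q) (CForm.incl q)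
        (Bialgebra.comulAlgHom ℂ ℂ[T;T⁻¹] y) at hy
      change Φ (CForm.incl q (T 1 * y)) = of ℂ (CForm.gr q) (CForm.gr q)
        (Algebra.TensorProduct.map (CForm.incl q) (CForm.incl q)
        (Bialgebra.comulAlgHom ℂ ℂ[T;T⁻¹] (T 1 * y)))
      rw [map_mul, map_mul Φ, map_mul, map_mul, ← hy]
      change Φ (CForm.t q 1) * _ = _
      rw [hp, CForm.comulGen, Bialgebra.comulAlgHom_apply, LaurentPolynomial.comul_T,
        Algebra.TensorProduct.map_tmul]
      exact of_tmul_mul_of_zero_left _ (CForm.t_mem 1) _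
    · intro y hy
      change _ = Algebra.TensorProduct.map (CForm.incl q) (CForm.incl q)
        (Bialgebra.comulAlgHom ℂ ℂ[T;T⁻¹] y) at hy
      change Φ (CForm.incl q (T (-1) * y)) = of ℂ (CForm.gr q) (CForm.gr q)
        (Algebra.TensorProduct.map (CForm.incl q) (CForm.incl q)
        (Bialgebra.comulAlgHom ℂ ℂ[T;T⁻¹] (T (-1) * y)))
      rw [map_mul, map_mul Φ, map_mul, map_mul, ← hy]
      change Φ (CForm.t q (-1)) * _ = _
      rw [hm, CForm.comulGen, Bialgebra.comulAlgHom_apply, LaurentPolynomial.comul_T,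
        Algebra.TensorProduct.map_tmul]
      exact of_tmul_mul_of_zero_left _ (CForm.t_mem (-1)) _

end CircleCalculus

end QHopf
end

open scoped TensorProduct LaurentPolynomial DirectSum

noncomputable section

namespace QHopf

/-! ### The relations of `Ω(A)` as rewriting rules, and their compatibility with `d`. -/

section FormRelations

variable {R : Type} [Ring R] [Algebra ℂ R] {q : ℂ}

theorem FormRel.map {S : Type} [Ring S] [Algebra ℂ S] {x : Gen → R} {e : EGen → R}
    (φ : R →ₐ[ℂ] S) {a b : R} (h : FormRel q x e a b) :
    FormRel q (φ ∘ x) (φ ∘ e) (φ a) (φ b) := by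
  cases h with
  | base h => exact .base (h.map φ)
  | comm s f => simp only [map_mul, map_smul]; exact .comm s f
  | sq s => simp only [map_mul, map_zero]; exact .sq s
  | ep_em => simp only [map_mul, map_smul]; exact .ep_em
  | ep_ez => simp only [map_mul, map_smul]; exact .ep_ez
  | em_ez => simp only [map_mul, map_smul]; exact .em_ez

theorem FormRel.exists_of_map {S : Type} [Ring S] [Algebra ℂ S] {x : Gen → R} {e : EGen → R}
    (φ : R →ₐ[ℂ] S) {a b : S} (h : FormRel q (fun f => φ (x f)) (fun s => φ (e s)) a b) :
    ∃ a' b' : R, FormRel q x e a' b' ∧ φ a' = a ∧ φ b' = b := by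
  cases h with
  | base h =>
    obtain ⟨a', b', h', h1, h2⟩ := SURel.exists_of_map φ h
    exact ⟨a', b', .base h', h1, h2⟩
  | comm s f => exact ⟨_, _, .comm s f, by simp, by simp⟩
  | sq s => exact ⟨_, _, .sq s, by simp, by simp⟩
  | ep_em => exact ⟨_, _, .ep_em, by simp, by simp⟩
  | ep_ez => exact ⟨_, _, .ep_ez, by simp, by simp⟩
  | em_ez => exact ⟨_, _, .em_ez, by simp, by simp⟩

theorem Form.gen_rel {a b : Form q} (h : FormRel q (Form.x q) (Form.e q) a b) : a = b := by
  obtain ⟨a', b', h', rfl, rfl⟩ := FormRel.exists_of_map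
    (x := fun f => FreeAlgebra.ι ℂ (Sum.inl f)) (e := fun s => FreeAlgebra.ι ℂ (Sum.inr s))
    (RingQuot.mkAlgHom ℂ (formRel q)) h
  exact RingQuot.mkAlgHom_rel ℂ h'

theorem formRel_lift_eq {x : Gen → R} {e : EGen → R} (hx : ∀ a b, FormRel q x e a b → a = b)
    (a b : FreeAlgebra ℂ (Gen ⊕ EGen)) (h : formRel q a b) :
    FreeAlgebra.lift ℂ (Sum.elim x e) a = FreeAlgebra.lift ℂ (Sum.elim x e) b := by
  refine hx _ _ ?_
  convert h.map (FreeAlgebra.lift ℂ (Sum.elim x e)) using 1 <;> funext <;> simp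

theorem Form.exists_lift {x : Gen → R} {e : EGen → R}
    (hx : ∀ a b, FormRel q x e a b → a = b) : ∃ φ : Form q →ₐ[ℂ] R,
      (∀ f, φ (Form.x q f) = x f) ∧ ∀ s, φ (Form.e q s) = e s := by
  obtain ⟨φ, hφ⟩ := QHopf.exists_lift (s := formRel q) (Sum.elim x e) (formRel_lift_eq hx)
  exact ⟨φ, fun f => hφ (.inl f), fun s => hφ (.inr s)⟩

theorem smul_assoc_rule {a b c d : R} {r : ℂ} (h : a * b = r • (c * d)) (y : R) :
    a * (b * y) = r • (c * (d * y)) := by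
  rw [← mul_assoc, h, smul_mul_assoc, mul_assoc]

/-- The differentials of `α, β, γ, δ`. -/
def dGen (q : ℂ) (x : Gen → R) (e : EGen → R) : Gen → R
  | .al => x .al * e .ez + q • (x .be * e .ep)
  | .be => x .al * e .em - q⁻¹ ^ 2 • (x .be * e .ez)
  | .ga => x .ga * e .ez + q • (x .de * e .ep)
  | .de => x .ga * e .em - q⁻¹ ^ 2 • (x .de * e .ez)

/-- The differentials of `e⁺, e⁻, e⁰`. -/
def dEGen (q : ℂ) (e : EGen → R) : EGen → R
  | .ep => -(q ^ 2 * (1 + q⁻¹ ^ 2)) • (e .ep * e .ez)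
  | .em => (q⁻¹ ^ 2 * (1 + q⁻¹ ^ 2)) • (e .em * e .ez)
  | .ez => q ^ 3 • (e .ep * e .em)

/-- The relations of the algebra of forms as rules that move one-forms to the right and order
them. -/
structure FormRules (q : ℂ) (x : Gen → R) (e : EGen → R) : Prop where
  be_al : x .be * x .al = q • (x .al * x .be)
  ga_al : x .ga * x .al = q • (x .al * x .ga)
  de_be : x .de * x .be = q • (x .be * x .de)
  de_ga : x .de * x .ga = q • (x .ga * x .de)
  ga_be : x .ga * x .be = x .be * x .ga
  al_de : x .al * x .de = 1 + q⁻¹ • (x .be * x .ga)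
  de_al : x .de * x .al = 1 + q • (x .be * x .ga)
  ep_al : e .ep * x .al = q • (x .al * e .ep)
  ep_be : e .ep * x .be = q⁻¹ • (x .be * e .ep)
  ep_ga : e .ep * x .ga = q • (x .ga * e .ep)
  ep_de : e .ep * x .de = q⁻¹ • (x .de * e .ep)
  em_al : e .em * x .al = q • (x .al * e .em)
  em_be : e .em * x .be = q⁻¹ • (x .be * e .em)
  em_ga : e .em * x .ga = q • (x .ga * e .em)
  em_de : e .em * x .de = q⁻¹ • (x .de * e .em)
  ez_al : e .ez * x .al = q ^ 2 • (x .al * e .ez)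
  ez_be : e .ez * x .be = q⁻¹ ^ 2 • (x .be * e .ez)
  ez_ga : e .ez * x .ga = q ^ 2 • (x .ga * e .ez)
  ez_de : e .ez * x .de = q⁻¹ ^ 2 • (x .de * e .ez)
  em_ep : e .em * e .ep = -(q ^ 2) • (e .ep * e .em)
  ez_ep : e .ez * e .ep = -(q ^ 4) • (e .ep * e .ez)
  ez_em : e .ez * e .em = -(q⁻¹ ^ 4) • (e .em * e .ez)
  sq : ∀ s, e s * e s = 0

theorem formRules {x : Gen → R} {e : EGen → R} (hq : q ≠ 0)
    (h : ∀ a b, FormRel q x e a b → a = b) : FormRules q x e := by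
  have hc : ∀ s f, e s * x f = q ^ (s.wt * f.deg) • (x f * e s) := fun s f => h _ _ (.comm s f)
  have hd : x .al * x .de = 1 + q⁻¹ • (x .be * x .ga) :=
    sub_eq_iff_eq_add.1 (h _ _ (.base .det))
  -- The defining relations express the ordered products of one-forms by the reversed ones; the
  -- rules need the converse.
  have inv : ∀ {a b : R} {r : ℂ}, r ≠ 0 → a = -r⁻¹ • b → b = -r • a := by
    intro a b r hr h
    rw [h, smul_smul, neg_mul_neg, mul_inv_cancel₀ hr, one_smul]
  refine ⟨h _ _ (.base .be_al), h _ _ (.base .ga_al), h _ _ (.base .de_be), h _ _ (.base .de_ga),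
    h _ _ (.base .ga_be), hd, ?_, ?_, ?_, ?_, ?_, ?_, ?_, ?_, ?_, ?_, ?_, ?_, ?_, ?_, ?_, ?_,
    fun s => h _ _ (.sq s)⟩
  -- The coefficient of `βγ` in `δα` is `q⁻¹ + (q - q⁻¹) = q`.
  · rw [sub_eq_iff_eq_add.1 (h _ _ (.base .de_al)), hd]
    module
  · simpa [EGen.wt, Gen.deg] using hc .ep .al
  · simpa [EGen.wt, Gen.deg] using hc .ep .be
  · simpa [EGen.wt, Gen.deg] using hc .ep .ga
  · simpa [EGen.wt, Gen.deg] using hc .ep .de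
  · simpa [EGen.wt, Gen.deg] using hc .em .al
  · simpa [EGen.wt, Gen.deg] using hc .em .be
  · simpa [EGen.wt, Gen.deg] using hc .em .ga
  · simpa [EGen.wt, Gen.deg] using hc .em .de
  · simpa [EGen.wt, Gen.deg] using hc .ez .al
  · simpa [EGen.wt, Gen.deg, zpow_neg] using hc .ez .be
  · simpa [EGen.wt, Gen.deg] using hc .ez .ga
  · simpa [EGen.wt, Gen.deg, zpow_neg] using hc .ez .de
  · exact inv (pow_ne_zero 2 hq) (by simpa using h _ _ .ep_em)
  · exact inv (pow_ne_zero 4 hq) (by simpa using h _ _ .ep_ez)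
  · exact inv (pow_ne_zero 4 (inv_ne_zero hq)) (by simpa using h _ _ .em_ez)

/-- The diagonal entries repeat the relations, up to the sign of the one-forms, and the corner entry
is the differentiated relation. After inserting `dg = gω` and `dω = -ω∧ω`, the rules bring both
sides to combinations of the same ordered words, and the coefficients, rational in `q`, are
compared. -/
theorem upper_formRel {x : Gen → R} {e : EGen → R} (hq : q ≠ 0)
    (h : ∀ a b, FormRel q x e a b → a = b) (a b : Matrix (Fin 2) (Fin 2) R)
    (hab : FormRel q (fun f => !![x f, dGen q x e f; 0, x f])
      (fun s => !![-e s, dEGen q e s; 0, e s]) a b) : a = b := by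
  have r := formRules hq h
  have ga_be : ∀ y, x .ga * (x .be * y) = x .be * (x .ga * y) := fun y => by
    rw [← mul_assoc, r.ga_be, mul_assoc]
  have al_de : ∀ y, x .al * (x .de * y) = y + q⁻¹ • (x .be * (x .ga * y)) := fun y => by
    rw [← mul_assoc, r.al_de, add_mul, one_mul, smul_mul_assoc, mul_assoc]
  have de_al : ∀ y, x .de * (x .al * y) = y + q • (x .be * (x .ga * y)) := fun y => by
    rw [← mul_assoc, r.de_al, add_mul, one_mul, smul_mul_assoc, mul_assoc]
  have sq : ∀ s y, e s * (e s * y) = 0 := fun s y => by rw [← mul_assoc, r.sq, zero_mul]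
  cases hab with
  | base hab =>
    cases hab <;> simp only [upper_mul, upper_smul, upper_sub, upper_one]
    · refine upper_ext r.be_al ?_ r.be_al
      simp only [dGen, mul_add, add_mul, mul_sub, sub_mul, smul_mul_assoc, mul_smul_comm, mul_assoc,
        smul_add, smul_sub, smul_smul, r.ep_be, r.em_al, r.ez_al,
        r.ez_be, smul_assoc_rule r.be_al]
      match_scalars <;> field_simp <;> ring
    · refine upper_ext r.ga_al ?_ r.ga_al
      simp only [dGen, mul_add, add_mul, smul_mul_assoc, mul_smul_comm, mul_assoc,
        smul_add, smul_smul, r.ep_al, r.ep_ga, r.ez_al,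
        r.ez_ga, smul_assoc_rule r.ga_al, ga_be, de_al, al_de]
      match_scalars <;> field_simp
    · refine upper_ext r.de_be ?_ r.de_be
      simp only [dGen, mul_sub, sub_mul, smul_mul_assoc, mul_smul_comm, mul_assoc,
        smul_add, smul_sub, smul_smul, r.em_be, r.em_de, r.ez_be,
        r.ez_de, smul_assoc_rule r.de_be, ga_be, de_al, al_de]
      match_scalars <;> field_simp
    · refine upper_ext r.de_ga ?_ r.de_ga
      simp only [dGen, mul_add, add_mul, mul_sub, sub_mul, smul_mul_assoc, mul_smul_comm, mul_assoc,
        smul_add, smul_sub, smul_smul, r.ep_de, r.em_ga, r.ez_ga,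
        r.ez_de, smul_assoc_rule r.de_ga]
      match_scalars <;> field_simp <;> ring
    · refine upper_ext r.ga_be ?_ r.ga_be
      simp only [dGen, mul_add, add_mul, mul_sub, sub_mul, smul_mul_assoc, mul_smul_comm, mul_assoc,
        smul_smul, r.ep_be, r.em_ga, r.ez_be, r.ez_ga, ga_be,
        smul_assoc_rule r.de_be, smul_assoc_rule r.ga_al]
      match_scalars <;> field_simp <;> ring
    · refine upper_ext (h _ _ (.base .de_al)) ?_ (h _ _ (.base .de_al))
      simp only [dGen, mul_add, add_mul, mul_sub, sub_mul, smul_mul_assoc, mul_smul_comm, mul_assoc,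
        smul_add, smul_sub, smul_smul, r.ep_de, r.em_al, r.em_ga, r.ez_al, r.ez_de, r.ez_ga, al_de,
        de_al, smul_assoc_rule r.de_be, smul_assoc_rule r.ga_al]
      match_scalars <;> field_simp <;> ring
    · refine upper_ext (h _ _ (.base .det)) ?_ (h _ _ (.base .det))
      simp only [dGen, mul_add, add_mul, mul_sub, sub_mul, smul_mul_assoc, mul_smul_comm, mul_assoc,
        smul_add, smul_sub, smul_smul, r.ep_de, r.em_ga, r.ez_de, r.ez_ga, al_de]
      match_scalars <;> field_simp <;> ring
  | comm s f =>
    have hc := h _ _ (.comm s f)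
    simp only [upper_mul, upper_smul]
    refine upper_ext (by rw [neg_mul, mul_neg, smul_neg, hc]) ?_ hc
    cases s <;> cases f <;>
      simp only [dGen, dEGen, EGen.wt, Gen.deg, mul_add, add_mul, mul_sub, sub_mul, smul_mul_assoc,
        mul_smul_comm, mul_assoc, neg_mul, mul_neg, smul_neg,
        smul_add, smul_sub, smul_smul, smul_assoc_rule r.ep_al, smul_assoc_rule r.ep_be,
        smul_assoc_rule r.ep_ga, smul_assoc_rule r.ep_de, smul_assoc_rule r.em_al,
        smul_assoc_rule r.em_be, smul_assoc_rule r.em_ga, smul_assoc_rule r.em_de,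
        smul_assoc_rule r.ez_al, smul_assoc_rule r.ez_be, smul_assoc_rule r.ez_ga,
        smul_assoc_rule r.ez_de, r.em_al, r.em_be, r.em_ga,
        r.em_de, r.ez_al, r.ez_be, r.ez_ga, r.ez_de, r.em_ep, r.ez_ep, r.ez_em, r.sq, mul_zero,
        smul_zero, mul_neg, mul_one, zpow_neg, Int.reduceNeg,
        zpow_ofNat, add_zero, zero_add, sub_zero, zero_sub, neg_zero, neg_neg] <;>
      match_scalars <;> field_simp <;> ring
  | sq s =>
    simp only [upper_mul, upper_zero]
    refine upper_ext (by rw [neg_mul_neg, r.sq]) ?_ (r.sq s)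
    cases s <;> simp only [dEGen, smul_mul_assoc, mul_smul_comm, mul_assoc, neg_mul, sq,
      smul_assoc_rule r.ez_ep, r.ez_em, r.ez_ep,
      smul_zero, neg_zero, add_zero, smul_smul]
    -- Only `e⁰` leaves something to check: `e⁺e⁻` commutes with `e⁰`, as the factors `-q⁴` and
    -- `-q⁻⁴` cancel.
    match_scalars
    field_simp
    ring
  | ep_em =>
    have hc := h _ _ .ep_em
    simp only [upper_mul, upper_smul]
    refine upper_ext (by rw [neg_mul_neg, neg_mul_neg, hc]) ?_ hc
    simp only [dEGen, smul_mul_assoc, mul_smul_comm, mul_assoc, neg_mul, r.ez_ep,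
      r.ez_em, smul_assoc_rule r.em_ep, smul_smul, mul_neg, neg_smul, smul_neg,
      neg_neg]
    match_scalars
    field_simp
    ring
  | ep_ez =>
    have hc := h _ _ .ep_ez
    simp only [upper_mul, upper_smul]
    refine upper_ext (by rw [neg_mul_neg, neg_mul_neg, hc]) ?_ hc
    simp only [dEGen, smul_mul_assoc, mul_smul_comm, mul_assoc, neg_mul, sq, r.sq, r.em_ep,
      smul_assoc_rule r.ez_ep, mul_zero, smul_zero, neg_zero, add_zero, mul_neg, neg_smul]
  | em_ez =>
    have hc := h _ _ .em_ez
    simp only [upper_mul, upper_smul]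
    refine upper_ext (by rw [neg_mul_neg, neg_mul_neg, hc]) ?_ hc
    simp only [dEGen, smul_mul_assoc, mul_smul_comm, mul_assoc, neg_mul, r.sq,
      smul_assoc_rule r.em_ep, smul_assoc_rule r.ez_em,
      mul_zero, smul_zero, neg_zero, add_zero]

end FormRelations

end QHopf
end

open scoped TensorProduct LaurentPolynomial DirectSum

noncomputable section

namespace QHopf

/-! ### The differential on `Ω(A)`. -/

section FormDifferential

variable {R : Type} [Ring R] [Algebra ℂ R] {q : ℂ}

/-- `d` is the twisted derivation with the values `dGen`, `dEGen` on the generators. -/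
structure IsFormDifferential (q : ℂ) (x : Gen → R) (e : EGen → R) (d : R →ₗ[ℂ] R) : Prop where
  one : d 1 = 0
  x_mul : ∀ f y, d (x f * y) = dGen q x e f * y + x f * d y
  e_mul : ∀ s y, d (e s * y) = dEGen q e s * y - e s * d y

variable {x : Gen → R} {e : EGen → R} {d : R →ₗ[ℂ] R}

theorem IsFormDifferential.d_x (hd : IsFormDifferential q x e d) (f : Gen) :
    d (x f) = dGen q x e f := by
  simpa [hd.one] using hd.x_mul f 1

theorem IsFormDifferential.d_e (hd : IsFormDifferential q x e d) (s : EGen) :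
    d (e s) = dEGen q e s := by
  simpa [hd.one] using hd.e_mul s 1

theorem FormRules.sq_assoc (r : FormRules q x e) (s : EGen) (y : R) : e s * (e s * y) = 0 := by
  rw [← mul_assoc, r.sq, zero_mul]

/-- In matrix form, `d(gω) = dg ∧ ω + g dω = g ω∧ω - g ω∧ω = 0`. -/
theorem IsFormDifferential.d_dGen (hd : IsFormDifferential q x e d) (hq : q ≠ 0)
    (r : FormRules q x e) (f : Gen) : d (dGen q x e f) = 0 := by
  have de := hd.d_e
  have dx := hd.x_mul
  cases f <;> simp only [dGen, map_add, map_sub, map_smul, dx, de, dEGen, mul_add, add_mul, sub_mul,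
      smul_mul_assoc, mul_smul_comm, mul_assoc, r.sq, r.em_ep, r.ez_ep, r.ez_em,
      smul_add, smul_sub, smul_smul, mul_zero, smul_zero, zero_add] <;>
    match_scalars <;> field_simp <;> ring

/-- Each term of `d(e⁺e⁰)` and `d(e⁻e⁰)` repeats a one-form, hence vanishes. In `d(e⁺e⁻)` two
multiples of `e⁺e⁻e⁰` remain and cancel. -/
theorem IsFormDifferential.d_dEGen (hd : IsFormDifferential q x e d) (hq : q ≠ 0)
    (r : FormRules q x e) (s : EGen) : d (dEGen q e s) = 0 := by
  have de := hd.d_e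
  have dm := hd.e_mul
  have sq := r.sq_assoc
  cases s <;> simp only [dEGen, map_smul, de, dm, smul_mul_assoc, mul_smul_comm, mul_assoc, sq,
    r.sq, smul_assoc_rule r.em_ep, r.ez_em, mul_zero, smul_zero, sub_zero]
  match_scalars
  field_simp
  ring

/-- This formula and the next two are entries of `ω = g⁻¹ dg` with `g⁻¹ = [[δ, -qβ], [-q⁻¹γ, α]]`;
this one is the lower left entry `q e⁺`, divided by `q`. -/
theorem IsFormDifferential.ep_eq (hd : IsFormDifferential q x e d) (hq : q ≠ 0)
    (r : FormRules q x e) :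
    e .ep = q⁻¹ • (x .al * d (x .ga)) - q⁻¹ ^ 2 • (x .ga * d (x .al)) := by
  simp only [hd.d_x, dGen, mul_add, mul_smul_comm, ← mul_assoc, r.al_de, r.ga_al, r.ga_be,
    add_mul, smul_mul_assoc, one_mul, smul_add, smul_smul]
  match_scalars <;> field_simp <;> ring

theorem IsFormDifferential.em_eq (hd : IsFormDifferential q x e d) (hq : q ≠ 0)
    (r : FormRules q x e) :
    e .em = x .de * d (x .be) - q • (x .be * d (x .de)) := by
  simp only [hd.d_x, dGen, mul_sub, mul_smul_comm, ← mul_assoc, r.de_al, r.de_be,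
    add_mul, smul_mul_assoc, one_mul, smul_sub, smul_smul]
  match_scalars <;> field_simp <;> ring

theorem IsFormDifferential.ez_eq (hd : IsFormDifferential q x e d)
    (r : FormRules q x e) :
    e .ez = x .de * d (x .al) - q • (x .be * d (x .ga)) := by
  simp only [hd.d_x, dGen, mul_add, mul_smul_comm, ← mul_assoc, r.de_al, r.de_be,
    add_mul, smul_mul_assoc, one_mul, smul_add, smul_smul]
  match_scalars <;> field_simp <;> ring

end FormDifferential

section FormCalculus

variable {q : ℂ}

theorem Form.rel (a b : Form q) (h : FormRel q (Form.x q) (Form.e q) a b) : a = b := Form.gen_rel h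

theorem Form.x_mem (f : Gen) : Form.x q f ∈ Form.gr q 0 := gen_mem formDeg _ (Sum.inl f)

theorem Form.e_mem (s : EGen) : Form.e q s ∈ Form.gr q 1 := gen_mem formDeg _ (Sum.inr s)

theorem Form.mul_mem {i j n : ℕ} {a b : Form q} (ha : a ∈ Form.gr q i) (hb : b ∈ Form.gr q j)
    (h : i + j = n) : a * b ∈ Form.gr q n :=
  mul_mem_wordGrading_of_mem ha hb h

/-- The differentials of the generators of the algebra of forms. -/
def Form.dGen (q : ℂ) : Gen ⊕ EGen → Form q :=
  Sum.elim (QHopf.dGen q (Form.x q) (Form.e q)) (QHopf.dEGen q (Form.e q))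

theorem Form.dGen_mem (x : Gen ⊕ EGen) : Form.dGen q x ∈ Form.gr q (formDeg x + 1) := by
  have m1 : ∀ (c : ℂ) (f : Gen) (s : EGen), c • (Form.x q f * Form.e q s) ∈ Form.gr q 1 :=
    fun c f s => (Form.gr q 1).smul_mem c (Form.mul_mem (Form.x_mem f) (Form.e_mem s) rfl)
  have m2 : ∀ (c : ℂ) (s s' : EGen), c • (Form.e q s * Form.e q s') ∈ Form.gr q 2 :=
    fun c s s' => (Form.gr q 2).smul_mem c (Form.mul_mem (Form.e_mem s) (Form.e_mem s') rfl)
  have m1' : ∀ (f : Gen) (s : EGen), Form.x q f * Form.e q s ∈ Form.gr q 1 :=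
    fun f s => Form.mul_mem (Form.x_mem f) (Form.e_mem s) rfl
  rcases x with f | s
  · cases f
    · exact (Form.gr q 1).add_mem (m1' _ _) (m1 _ _ _)
    · exact (Form.gr q 1).sub_mem (m1' _ _) (m1 _ _ _)
    · exact (Form.gr q 1).add_mem (m1' _ _) (m1 _ _ _)
    · exact (Form.gr q 1).sub_mem (m1' _ _) (m1 _ _ _)
  · cases s
    · exact m2 _ _ _
    · exact m2 _ _ _
    · exact m2 _ _ _

/-- `d` is the differential of the three-dimensional calculus. -/
structure Form.IsDifferential {q : ℂ} (d : Form q →ₗ[ℂ] Form q) : Prop where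
  one : d 1 = 0
  gen_mul : ∀ x y, d (pgen (formRel q) x * y) = Form.dGen q x * y +
    (-1 : ℂ) ^ formDeg x • (pgen (formRel q) x * d y)

theorem Form.exists_isDifferential (hq : q ≠ 0) :
    ∃ d : Form q →ₗ[ℂ] Form q, Form.IsDifferential d := by
  obtain ⟨d, h1, h2⟩ := exists_differential formDeg (formRel q) (Form.dGen q) (by
    have e : (fun x => !![(-1 : ℂ) ^ formDeg x • pgen (formRel q) x, Form.dGen q x;
        0, pgen (formRel q) x]) = Sum.elim
        (fun f => !![Form.x q f, QHopf.dGen q (Form.x q) (Form.e q) f; 0, Form.x q f])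
        (fun s => !![-Form.e q s, QHopf.dEGen q (Form.e q) s; 0, Form.e q s]) := by
      funext x
      rcases x with f | s
      · simp only [formDeg, pow_zero, one_smul]; rfl
      · have : (-1 : ℂ) ^ formDeg (Sum.inr s) • pgen (formRel q) (Sum.inr s) = -Form.e q s := by
          rw [formDeg, pow_one]; exact neg_one_smul ℂ (Form.e q s)
        rw [this]; rfl
    rw [e]
    exact formRel_lift_eq (upper_formRel hq Form.rel))
  exact ⟨d, h1, h2⟩

variable {d : Form q →ₗ[ℂ] Form q}

theorem Form.IsDifferential.degree (hd : Form.IsDifferential d) (n : ℕ) (ω : Form q)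
    (hω : ω ∈ Form.gr q n) : d ω ∈ Form.gr q (n + 1) :=
  degree_of_generators hd.one hd.gen_mul Form.dGen_mem n ω hω

theorem Form.IsDifferential.leibniz (hd : Form.IsDifferential d) (n : ℕ) (ω : Form q)
    (hω : ω ∈ Form.gr q n) (η : Form q) : d (ω * η) = d ω * η + (-1 : ℂ) ^ n • (ω * d η) :=
  leibniz_of_generators hd.one hd.gen_mul n ω hω η

theorem Form.IsDifferential.isFormDifferential (hd : Form.IsDifferential d) :
    IsFormDifferential q (Form.x q) (Form.e q) d where
  one := hd.one
  x_mul f y := by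
    have h := hd.gen_mul (.inl f) y
    rwa [formDeg, pow_zero, one_smul] at h
  e_mul s y := by
    have h := hd.gen_mul (.inr s) y
    have e : (-1 : ℂ) ^ formDeg (.inr s) • (pgen (formRel q) (.inr s) * d y) =
      -(pgen (formRel q) (.inr s) * d y) := by
        rw [formDeg, pow_one]; exact neg_one_smul ℂ (Form.e q s * d y)
    rw [e, ← sub_eq_add_neg] at h
    exact h

theorem Form.IsDifferential.d_d (hd : Form.IsDifferential d) (hq : q ≠ 0) (ω : Form q) :
    d (d ω) = 0 := by
  refine d_d_of_generators hd.one hd.gen_mul Form.dGen_mem (fun x => ?_) ω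
  rcases x with f | s
  · exact hd.isFormDifferential.d_dGen hq (formRules hq Form.rel) f
  · exact hd.isFormDifferential.d_dEGen hq (formRules hq Form.rel) s

end FormCalculus

end QHopf
end

open scoped TensorProduct LaurentPolynomial DirectSum

noncomputable section

namespace QHopf

/-! ### An action of `Ω(A)` on `A⁸`. -/

section FormModules

open LaurentPolynomial (T)

/-- The automorphism of `O_q(SU(2))` that scales an element of degree `n` by `zⁿ`. -/
def SUq.twist (q : ℂ) (z : ℂˣ) : SUq q →ₐ[ℂ] SUq q :=
  (Algebra.TensorProduct.rid ℂ ℂ (SUq q)).toAlgHom.comp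
    ((Algebra.TensorProduct.map (AlgHom.id ℂ (SUq q)) (AddMonoidAlgebra.lift ℂ ℂ ℤ
      ((Units.coeHom ℂ).comp (zpowersHom ℂˣ z)))).comp (coaction q))

theorem SUq.twist_gen (q : ℂ) (z : ℂˣ) (f : Gen) :
    SUq.twist q z (SUq.gen q f) = ((z : ℂ) ^ f.deg) • SUq.gen q f := by
  have h : coaction q (SUq.gen q f) = SUq.gen q f ⊗ₜ[ℂ] T f.deg := mem_homog.1 (gen_mem_homog q f)
  change (Algebra.TensorProduct.rid ℂ ℂ (SUq q)) (Algebra.TensorProduct.map _ _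
    (coaction q (SUq.gen q f))) = _
  rw [h, Algebra.TensorProduct.map_tmul, Algebra.TensorProduct.rid_tmul]
  congr 1
  simp [T, -LaurentPolynomial.single_eq_C_mul_T]

theorem SUq.twist_comm (q : ℂ) (z z' : ℂˣ) (a : SUq q) :
    SUq.twist q z (SUq.twist q z' a) = SUq.twist q z' (SUq.twist q z a) := by
  have : (SUq.twist q z).comp (SUq.twist q z') = (SUq.twist q z').comp (SUq.twist q z) := by
    refine presented_algHom_ext fun f => ?_
    change SUq.twist q z (SUq.twist q z' (SUq.gen q f)) =
      SUq.twist q z' (SUq.twist q z (SUq.gen q f))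
    rw [twist_gen, twist_gen, map_smul, map_smul, twist_gen, twist_gen, smul_comm]
  exact DFunLike.congr_fun this a

section Representation

variable {A : Type} [Ring A] [Algebra ℂ A] {q : ℂ}

/-- Left multiplication on a free module of rank eight. -/
def formRepX : A →ₐ[ℂ] Module.End ℂ (Fin 8 → A) := AlgHom.ofLinearMap
  { toFun a :=
      { toFun c i := a * c i
        map_add' c c' := by ext i; simp [mul_add]
        map_smul' r c := by ext i; simp }
    map_add' a b := by ext c i; simp [add_mul]
    map_smul' r a := by ext c i; simp }
  (by ext c i; simp) (fun a b => by ext c i; simp [mul_assoc])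

theorem formRepX_apply (a : A) (c : Fin 8 → A) (i : Fin 8) : formRepX a c i = a * c i := rfl

/-- Left multiplication by `e⁺`, in the basis
`1, e⁺, e⁻, e⁰, e⁺e⁻, e⁺e⁰, e⁻e⁰, e⁺e⁻e⁰`. -/
def formRepP (σ : A →ₐ[ℂ] A) : Module.End ℂ (Fin 8 → A) where
  toFun c := ![0, σ (c 0), 0, 0, σ (c 2), σ (c 3), 0, σ (c 6)]
  map_add' c c' := by ext i; fin_cases i <;> simp
  map_smul' r c := by ext i; fin_cases i <;> simp

/-- Left multiplication by `e⁻`. -/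
def formRepM (q : ℂ) (σ : A →ₐ[ℂ] A) : Module.End ℂ (Fin 8 → A) where
  toFun c := ![0, 0, σ (c 0), 0, -(q ^ 2) • σ (c 1), 0, σ (c 3), -(q ^ 2) • σ (c 5)]
  map_add' c c' := by ext i; fin_cases i <;> simp
  map_smul' r c := by ext i; fin_cases i <;> simp [smul_comm r]

/-- Left multiplication by `e⁰`. -/
def formRepZ (q : ℂ) (τ : A →ₐ[ℂ] A) : Module.End ℂ (Fin 8 → A) where
  toFun c := ![0, 0, 0, τ (c 0), 0, -(q ^ 4) • τ (c 1), -(q⁻¹ ^ 4) • τ (c 2), τ (c 4)]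
  map_add' c c' := by ext i; fin_cases i <;> simp
  map_smul' r c := by ext i; fin_cases i <;> simp [smul_comm r]

/-- The operators of left multiplication by the one-forms. -/
def formRepE (q : ℂ) (σ τ : A →ₐ[ℂ] A) : EGen → Module.End ℂ (Fin 8 → A)
  | .ep => formRepP σ
  | .em => formRepM q σ
  | .ez => formRepZ q τ

section Relations

variable {x : Gen → A} {σ τ : A →ₐ[ℂ] A}

theorem formRepE_comm (hσ : ∀ f, σ (x f) = q ^ f.deg • x f)
    (hτ : ∀ f, τ (x f) = q ^ (2 * f.deg) • x f) (s : EGen) (f : Gen) :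
    formRepE q σ τ s * formRepX (x f) =
      q ^ (s.wt * f.deg) • (formRepX (x f) * formRepE q σ τ s) := by
  refine LinearMap.ext fun c => funext fun i => ?_
  cases s <;> fin_cases i <;>
    simp [formRepX_apply, formRepE, formRepP, formRepM, formRepZ, EGen.wt, hσ, hτ]
  all_goals exact smul_comm _ _ _

theorem formRepE_sq (s : EGen) : formRepE q σ τ s * formRepE q σ τ s = 0 := by
  refine LinearMap.ext fun c => funext fun i => ?_
  cases s <;> fin_cases i <;> simp [formRepE, formRepP, formRepM, formRepZ]

theorem formRepE_ep_em (hq : q ≠ 0) : formRepE q σ τ .ep * formRepE q σ τ .em =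
    -(q⁻¹ ^ 2) • (formRepE q σ τ .em * formRepE q σ τ .ep) := by
  refine LinearMap.ext fun c => funext fun i => ?_
  fin_cases i <;> simp [formRepE, formRepP, formRepM, smul_smul, hq]

theorem formRepE_ep_ez (hq : q ≠ 0) (hστ : ∀ a, σ (τ a) = τ (σ a)) :
    formRepE q σ τ .ep * formRepE q σ τ .ez =
      -(q⁻¹ ^ 4) • (formRepE q σ τ .ez * formRepE q σ τ .ep) := by
  refine LinearMap.ext fun c => funext fun i => ?_
  fin_cases i <;> simp [formRepE, formRepP, formRepZ, smul_smul, hq, hστ]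

theorem formRepE_em_ez (hq : q ≠ 0) (hστ : ∀ a, σ (τ a) = τ (σ a)) :
    formRepE q σ τ .em * formRepE q σ τ .ez =
      -(q ^ 4) • (formRepE q σ τ .ez * formRepE q σ τ .em) := by
  refine LinearMap.ext fun c => funext fun i => ?_
  fin_cases i <;> simp [formRepE, formRepM, formRepZ, smul_smul, hq, hστ, mul_comm]

/-- The twists enter through their values on generators, which give the bimodule relations, and
through `σ τ = τ σ`, which makes the two orders of `e^±` and `e⁰` proportional as operators. -/
theorem formRep_rel (hq : q ≠ 0) (hx : ∀ a b, SURel q x a b → a = b)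
    (hσ : ∀ f, σ (x f) = q ^ f.deg • x f)
    (hτ : ∀ f, τ (x f) = q ^ (2 * f.deg) • x f) (hστ : ∀ a, σ (τ a) = τ (σ a))
    (a b : Module.End ℂ (Fin 8 → A))
    (h : FormRel q (fun f => formRepX (x f)) (formRepE q σ τ) a b) : a = b := by
  cases h with
  | base h =>
    obtain ⟨a', b', h', rfl, rfl⟩ := SURel.exists_of_map (x := x) formRepX h
    rw [hx _ _ h']
  | comm s f => exact formRepE_comm hσ hτ s f
  | sq s => exact formRepE_sq s
  | ep_em => exact formRepE_ep_em hq
  | ep_ez => exact formRepE_ep_ez hq hστ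
  | em_ez => exact formRepE_em_ez hq hστ

/-- With the four lemmas that follow, this shows that each ordered monomial carries the vector of
`1` to its own basis vector. -/
theorem formRepE_single_zero : formRepE q σ τ .ep (Pi.single 0 1) = Pi.single 1 1 ∧
    formRepE q σ τ .em (Pi.single 0 1) = Pi.single 2 1 ∧
    formRepE q σ τ .ez (Pi.single 0 1) = Pi.single 3 1 := by
  refine ⟨?_, ?_, ?_⟩ <;> funext i <;> fin_cases i <;>
    simp [formRepE, formRepP, formRepM, formRepZ]

theorem formRepE_ep_single_two : formRepE q σ τ .ep (Pi.single 2 1) = Pi.single 4 1 := by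
  funext i
  fin_cases i <;> simp [formRepE, formRepP]

theorem formRepE_ep_single_three : formRepE q σ τ .ep (Pi.single 3 1) = Pi.single 5 1 := by
  funext i
  fin_cases i <;> simp [formRepE, formRepP]

theorem formRepE_em_single_three : formRepE q σ τ .em (Pi.single 3 1) = Pi.single 6 1 := by
  funext i
  fin_cases i <;> simp [formRepE, formRepM]

theorem formRepE_ep_single_six : formRepE q σ τ .ep (Pi.single 6 1) = Pi.single 7 1 := by
  funext i
  fin_cases i <;> simp [formRepE, formRepP]

end Relations

end Representation
end FormModules
end QHopf
end

open scoped TensorProduct LaurentPolynomial DirectSum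

noncomputable section

namespace QHopf

/-! ### Bases of the modules of forms. -/

section FormBases

variable {q : ℂ}

theorem Form.incl_gen (f : Gen) : Form.incl q (SUq.gen q f) = Form.x q f := by
  simp [Form.incl, SUq.lift, SUq.gen, pgen]

theorem Form.incl_mem (a : SUq q) : Form.incl q a ∈ Form.gr q 0 := by
  refine mem_of_generators _ ((Form.gr q 0).comap (Form.incl q).toLinearMap) ?_ ?_ a
  · rw [Submodule.mem_comap, AlgHom.toLinearMap_apply, map_one]
    exact SetLike.GradedOne.one_mem
  · intro f y hy
    rw [Submodule.mem_comap, AlgHom.toLinearMap_apply, map_mul]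
    refine Form.mul_mem (i := 0) (j := 0) ?_ hy rfl
    change Form.incl q (SUq.gen q f) ∈ _
    rw [Form.incl_gen]
    exact Form.x_mem f

/-- The twist with `e^s a = twist(a) e^s`. -/
def EGen.twist (hq : q ≠ 0) (s : EGen) : SUq q →ₐ[ℂ] SUq q :=
  SUq.twist q (Units.mk0 q hq ^ s.wt)

theorem EGen.twist_gen (hq : q ≠ 0) (s : EGen) (f : Gen) :
    s.twist hq (SUq.gen q f) = q ^ (s.wt * f.deg) • SUq.gen q f := by
  rw [EGen.twist, SUq.twist_gen, Units.val_zpow_eq_zpow_val, Units.val_mk0, zpow_mul]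

theorem Form.e_mul_incl (hq : q ≠ 0) (s : EGen) (a : SUq q) :
    Form.e q s * Form.incl q a = Form.incl q (s.twist hq a) * Form.e q s := by
  refine mem_of_generators _ (LinearMap.eqLocus
    (LinearMap.mulLeft ℂ (Form.e q s) ∘ₗ (Form.incl q).toLinearMap)
    (LinearMap.mulRight ℂ (Form.e q s) ∘ₗ (Form.incl q).toLinearMap ∘ₗ
      (s.twist hq).toLinearMap)) ?_ ?_ a
  · simp
  · intro f y hy
    change Form.e q s * Form.incl q y = Form.incl q (s.twist hq y) * Form.e q s at hy
    change Form.e q s * Form.incl q (SUq.gen q f * y) =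
      Form.incl q (s.twist hq (SUq.gen q f * y)) * Form.e q s
    rw [map_mul, map_mul, map_mul, EGen.twist_gen, map_smul, Form.incl_gen, ← mul_assoc,
      Form.rel _ _ (.comm s f), mul_assoc, ← hy, smul_mul_assoc, smul_mul_assoc, mul_assoc]

/-- Coordinates in the basis `1, e⁺, e⁻, e⁰, e⁺e⁻, e⁺e⁰, e⁻e⁰, e⁺e⁻e⁰`. -/
theorem Form.exists_coordinates (hq : q ≠ 0) : ∃ ψ : Form q →ₗ[ℂ] (Fin 8 → SUq q),
    (∀ a ω i, ψ (Form.incl q a * ω) i = a * ψ ω i) ∧ ψ 1 = Pi.single 0 1 ∧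
    ψ (Form.e q .ep) = Pi.single 1 1 ∧ ψ (Form.e q .em) = Pi.single 2 1 ∧
    ψ (Form.e q .ez) = Pi.single 3 1 ∧ ψ (Form.e q .ep * Form.e q .em) = Pi.single 4 1 ∧
    ψ (Form.e q .ep * Form.e q .ez) = Pi.single 5 1 ∧
    ψ (Form.e q .em * Form.e q .ez) = Pi.single 6 1 ∧
    ψ (Form.e q .ep * Form.e q .em * Form.e q .ez) = Pi.single 7 1 := by
  -- The forms `e⁺` and `e⁻` have the same weight, so one twist serves both.
  obtain ⟨φ, hx, he⟩ := Form.exists_lift (formRep_rel hq (x := SUq.gen q)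
    (fun a b h => SUq.gen_rel q h) (σ := EGen.twist hq .ep) (τ := EGen.twist hq .ez)
    (fun f => by rw [EGen.twist_gen, EGen.wt, one_mul])
    (fun f => by rw [EGen.twist_gen, EGen.wt]) (fun a => SUq.twist_comm q _ _ a))
  -- The coordinates of a form are its action on the vector of `1`.
  refine ⟨LinearMap.applyₗ (Pi.single 0 1 : Fin 8 → SUq q) ∘ₗ φ.toLinearMap, ?_, ?_⟩
  · intro a
    change ∀ ω i, φ (Form.incl q a * ω) (Pi.single 0 1) i = a * φ ω (Pi.single 0 1) i
    suffices h : φ (Form.incl q a) = formRepX a by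
      intro ω i
      rw [map_mul, h]
      rfl
    have h : φ.comp (Form.incl q) = formRepX := presented_algHom_ext fun f => by
      change φ (Form.incl q (SUq.gen q f)) = formRepX (SUq.gen q f)
      rw [Form.incl_gen, hx]
    exact DFunLike.congr_fun h a
  · change φ 1 (Pi.single 0 1) = _ ∧ φ _ (Pi.single 0 1) = _ ∧ φ _ (Pi.single 0 1) = _ ∧
      φ _ (Pi.single 0 1) = _ ∧ φ _ (Pi.single 0 1) = _ ∧ φ _ (Pi.single 0 1) = _ ∧
      φ _ (Pi.single 0 1) = _ ∧ φ _ (Pi.single 0 1) = _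
    simp only [map_mul, he, map_one, Module.End.mul_apply, Module.End.one_apply,
      formRepE_single_zero, formRepE_ep_single_two, formRepE_ep_single_three,
      formRepE_em_single_three, formRepE_ep_single_six, and_self]

end FormBases

section FormSpan

variable {R : Type} [Ring R] [Algebra ℂ R] {q : ℂ} {x : Gen → R} {e : EGen → R}

theorem FormRules.mul_mem_two (r : FormRules q x e) {W : Submodule ℂ R} (h1 : e .ep * e .em ∈ W)
    (h2 : e .ep * e .ez ∈ W) (h3 : e .em * e .ez ∈ W) (s s' : EGen) : e s * e s' ∈ W := by
  have h0 : ∀ s, e s * e s ∈ W := fun s => by rw [r.sq]; exact W.zero_mem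
  have h4 : e .em * e .ep ∈ W := by rw [r.em_ep]; exact W.smul_mem _ h1
  have h5 : e .ez * e .ep ∈ W := by rw [r.ez_ep]; exact W.smul_mem _ h2
  have h6 : e .ez * e .em ∈ W := by rw [r.ez_em]; exact W.smul_mem _ h3
  cases s <;> cases s' <;> first | assumption | exact h0 _

theorem FormRules.mul_mem_three (r : FormRules q x e) {W : Submodule ℂ R}
    (h : e .ep * e .em * e .ez ∈ W) (s : EGen) : e s * (e .ep * e .em) ∈ W ∧
      e s * (e .ep * e .ez) ∈ W ∧ e s * (e .em * e .ez) ∈ W := by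
  have sq := r.sq_assoc
  rw [mul_assoc] at h
  cases s <;> simp only [sq, r.sq, smul_assoc_rule r.em_ep, smul_assoc_rule r.ez_ep,
    smul_assoc_rule r.ez_em, r.ez_em, mul_smul_comm, mul_zero, smul_zero, W.zero_mem, true_and,
      and_true, h] <;>
    first
    | exact W.smul_mem _ h
    | exact W.smul_mem _ (W.smul_mem _ h)

/-- A fourth one-form repeats one of the three, and reordering brings the two copies together. -/
theorem FormRules.mul_eq_zero (r : FormRules q x e) (s : EGen) :
    e s * (e .ep * e .em * e .ez) = 0 := by
  have sq := r.sq_assoc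
  cases s <;> simp only [mul_assoc, sq, r.sq, smul_assoc_rule r.em_ep, smul_assoc_rule r.ez_ep,
    smul_assoc_rule r.ez_em, mul_zero, smul_zero]

end FormSpan

section FormFree

variable {q : ℂ}

/-- The left linear combinations of the forms `v i`. -/
def leftCombination (q : ℂ) {n : ℕ} (v : Fin n → Form q) : (Fin n → SUq q) →ₗ[ℂ] Form q :=
  ∑ i, LinearMap.mulRight ℂ (v i) ∘ₗ (Form.incl q).toLinearMap ∘ₗ LinearMap.proj i

theorem leftCombination_apply {n : ℕ} (v : Fin n → Form q) (c : Fin n → SUq q) :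
    leftCombination q v c = ∑ i, Form.incl q (c i) * v i := by
  simp [leftCombination]

theorem incl_mul_mem_range {n : ℕ} (v : Fin n → Form q) (a : SUq q) {y : Form q}
    (hy : y ∈ LinearMap.range (leftCombination q v)) :
    Form.incl q a * y ∈ LinearMap.range (leftCombination q v) := by
  obtain ⟨c, rfl⟩ := hy
  refine ⟨fun i => a * c i, ?_⟩
  simp only [leftCombination_apply, Finset.mul_sum, map_mul, mul_assoc]

theorem self_mem_range {n : ℕ} (v : Fin n → Form q) (i : Fin n) :
    v i ∈ LinearMap.range (leftCombination q v) := by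
  refine ⟨Pi.single i 1, ?_⟩
  rw [leftCombination_apply, Finset.sum_eq_single i (fun j _ hj => by simp [hj]) (by simp)]
  simp

theorem e_mul_mem_range (hq : q ≠ 0) {m n : ℕ} {v : Fin m → Form q} {v' : Fin n → Form q}
    (s : EGen) (h : ∀ i, Form.e q s * v i ∈ LinearMap.range (leftCombination q v')) {y : Form q}
    (hy : y ∈ LinearMap.range (leftCombination q v)) :
    Form.e q s * y ∈ LinearMap.range (leftCombination q v') := by
  obtain ⟨c, rfl⟩ := hy
  rw [leftCombination_apply, Finset.mul_sum]
  refine Submodule.sum_mem _ fun i _ => ?_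
  rw [← mul_assoc, Form.e_mul_incl hq, mul_assoc]
  exact incl_mul_mem_range _ _ (h i)

variable (q) in
/-- The basis of the one-forms. -/
abbrev Form.basisOne : Fin 3 → Form q := ![Form.e q .ep, Form.e q .em, Form.e q .ez]

variable (q) in
/-- The basis of the two-forms. -/
abbrev Form.basisTwo : Fin 3 → Form q := ![Form.e q .ep * Form.e q .em,
  Form.e q .ep * Form.e q .ez, Form.e q .em * Form.e q .ez]

variable (q) in
/-- The basis of the three-forms. -/
abbrev Form.basisThree : Fin 1 → Form q := ![Form.e q .ep * Form.e q .em * Form.e q .ez]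

/-- Multiplying a combination of ordered monomials by `e^s` twists the coefficients and leaves a
product of one-forms that the rules order again or annihilate. -/
theorem Form.gr_le (hq : q ≠ 0) (n : ℕ) : Form.gr q n ≤
    match n with
    | 0 => LinearMap.range (leftCombination q ![1])
    | 1 => LinearMap.range (leftCombination q (Form.basisOne q))
    | 2 => LinearMap.range (leftCombination q (Form.basisTwo q))
    | 3 => LinearMap.range (leftCombination q (Form.basisThree q))
    | _ => ⊥ := by
  have r := formRules hq (Form.rel (q := q))
  let V : ℕ → Submodule ℂ (Form q) := fun n => match n with
    | 0 => LinearMap.range (leftCombination q ![1])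
    | 1 => LinearMap.range (leftCombination q (Form.basisOne q))
    | 2 => LinearMap.range (leftCombination q (Form.basisTwo q))
    | 3 => LinearMap.range (leftCombination q (Form.basisThree q))
    | _ => ⊥
  refine wordGrading_le (V := V) (self_mem_range ![(1 : Form q)] 0) ?_ n
  intro x n y hy
  rcases x with f | s
  · change Form.x q f * y ∈ V (0 + n)
    rw [zero_add, ← Form.incl_gen]
    match n, hy with
    | 0, hy => exact incl_mul_mem_range _ _ hy
    | 1, hy => exact incl_mul_mem_range _ _ hy
    | 2, hy => exact incl_mul_mem_range _ _ hy
    | 3, hy => exact incl_mul_mem_range _ _ hy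
    | n + 4, hy => rw [(Submodule.mem_bot ℂ).1 hy, mul_zero]; exact Submodule.zero_mem _
  · change Form.e q s * y ∈ V (1 + n)
    rw [add_comm]
    match n, hy with
    | 0, hy =>
      refine e_mul_mem_range hq (v' := Form.basisOne q) s (fun i => ?_) hy
      rw [Fin.fin_one_eq_zero i, Matrix.cons_val_zero, mul_one]
      cases s
      · exact self_mem_range (Form.basisOne q) 0
      · exact self_mem_range (Form.basisOne q) 1
      · exact self_mem_range (Form.basisOne q) 2
    | 1, hy =>
      refine e_mul_mem_range hq (v' := Form.basisTwo q) s (fun i => ?_) hy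
      have h := r.mul_mem_two (self_mem_range (Form.basisTwo q) 0)
        (self_mem_range (Form.basisTwo q) 1) (self_mem_range (Form.basisTwo q) 2) s
      fin_cases i
      · exact h _
      · exact h _
      · exact h _
    | 2, hy =>
      refine e_mul_mem_range hq (v' := Form.basisThree q) s (fun i => ?_) hy
      have h := r.mul_mem_three (self_mem_range (Form.basisThree q) 0) s
      fin_cases i
      · exact h.1
      · exact h.2.1
      · exact h.2.2
    | 3, hy =>
      obtain ⟨c, rfl⟩ := hy
      refine (Submodule.mem_bot ℂ).2 ?_
      rw [leftCombination_apply, Fin.sum_univ_one, ← mul_assoc, Form.e_mul_incl hq, mul_assoc]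
      exact (congrArg _ (r.mul_eq_zero s)).trans (mul_zero _)
    | n + 4, hy => rw [(Submodule.mem_bot ℂ).1 hy, mul_zero]; exact Submodule.zero_mem _

theorem Form.gr_eq_bot (hq : q ≠ 0) (n : ℕ) (hn : 3 < n) : Form.gr q n = ⊥ := by
  obtain ⟨m, rfl⟩ := Nat.exists_eq_add_of_lt hn
  have h := Form.gr_le hq (m + 4)
  rw [show 3 + m + 1 = m + 4 by omega]
  exact le_bot_iff.1 h

theorem Form.range_incl (hq : q ≠ 0) : LinearMap.range (Form.incl q).toLinearMap = Form.gr q 0 := by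
  refine le_antisymm ?_ ?_
  · rintro _ ⟨a, rfl⟩
    exact Form.incl_mem a
  · intro ω hω
    obtain ⟨c, rfl⟩ := Form.gr_le hq 0 hω
    exact ⟨c 0, by simp [leftCombination_apply]⟩

theorem Form.incl_injective (hq : q ≠ 0) : Function.Injective (Form.incl q) := by
  obtain ⟨ψ, hψ, h1, -⟩ := Form.exists_coordinates hq
  intro a b h
  have h' := congrArg (fun ω => ψ (ω * 1) 0) h
  simp only [hψ, h1] at h'
  simpa using h'

/-- Spanning is `hle`; independence holds because the coordinate `κ i` of `ψ` reads off the
coefficient of `v i`. -/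
theorem isLeftBasis_of_coordinates {n : ℕ} {v : Fin n → Form q} {m : ℕ}
    (hle : Form.gr q m ≤ LinearMap.range (leftCombination q v)) (hv : ∀ i, v i ∈ Form.gr q m)
    (ψ : Form q →ₗ[ℂ] (Fin 8 → SUq q)) (hψ : ∀ a ω i, ψ (Form.incl q a * ω) i = a * ψ ω i)
    (κ : Fin n → Fin 8) (hκ : Function.Injective κ) (hψv : ∀ i, ψ (v i) = Pi.single (κ i) 1) :
    IsLeftBasis (Form.incl q) (Form.gr q m) v := by
  refine ⟨fun c _ => ?_, fun c _ c' _ h => ?_, fun ω hω => ?_⟩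
  · exact Submodule.sum_mem _ fun i _ => Form.mul_mem (Form.incl_mem _) (hv i) (zero_add m)
  · have key : ∀ (c : Fin n → SUq q) j, ψ (∑ i, Form.incl q (c i) * v i) (κ j) = c j := by
      intro c j
      rw [map_sum, Finset.sum_apply, Finset.sum_eq_single j]
      · rw [hψ, hψv, Pi.single_eq_same, mul_one]
      · intro i _ hi
        rw [hψ, hψv, Pi.single_eq_of_ne (fun h => hi (hκ h).symm), mul_zero]
      · simp
    funext j
    rw [← key c j, ← key c' j]
    exact congrArg (fun ω => ψ ω (κ j)) h
  · obtain ⟨c, rfl⟩ := hle hω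
    exact ⟨c, trivial, (leftCombination_apply v c).symm⟩

theorem Form.isLeftBasis_one (hq : q ≠ 0) :
    IsLeftBasis (Form.incl q) (Form.gr q 1) (Form.basisOne q) := by
  obtain ⟨ψ, hψ, -, h1, h2, h3, -⟩ := Form.exists_coordinates hq
  refine isLeftBasis_of_coordinates (Form.gr_le hq 1) ?_ ψ hψ ![1, 2, 3] (by decide) ?_
  · intro i
    fin_cases i <;> exact Form.e_mem _
  · intro i
    fin_cases i
    exacts [h1, h2, h3]

theorem Form.isLeftBasis_two (hq : q ≠ 0) :
    IsLeftBasis (Form.incl q) (Form.gr q 2) (Form.basisTwo q) := by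
  obtain ⟨ψ, hψ, -, -, -, -, h1, h2, h3, -⟩ := Form.exists_coordinates hq
  refine isLeftBasis_of_coordinates (Form.gr_le hq 2) ?_ ψ hψ ![4, 5, 6] (by decide) ?_
  · intro i
    fin_cases i <;> exact Form.mul_mem (Form.e_mem _) (Form.e_mem _) rfl
  · intro i
    fin_cases i
    exacts [h1, h2, h3]

theorem Form.isLeftBasis_three (hq : q ≠ 0) :
    IsLeftBasis (Form.incl q) (Form.gr q 3) (Form.basisThree q) := by
  obtain ⟨ψ, hψ, -, -, -, -, -, -, -, h1⟩ := Form.exists_coordinates hq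
  refine isLeftBasis_of_coordinates (Form.gr_le hq 3) ?_ ψ hψ ![7] (by decide) ?_
  · intro i
    fin_cases i
    exact Form.mul_mem (Form.mul_mem (Form.e_mem _) (Form.e_mem _) rfl) (Form.e_mem _) rfl
  · intro i
    fin_cases i
    exact h1

end FormFree

end QHopf
end

open scoped TensorProduct LaurentPolynomial DirectSum

noncomputable section

namespace QHopf

/-! ### The images of the generators of `Ω(A)` in `Ω(A) ⊗ Ω(H)`. -/

section GradedCoaction

open GradedTensorProduct

variable {Ω Θ : Type} [Ring Ω] [Algebra ℂ Ω] [Ring Θ] [Algebra ℂ Θ]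
  {gr : ℕ → Submodule ℂ Ω} {gr' : ℕ → Submodule ℂ Θ} {q : ℂ}

/-- The rules for the powers `t n` and the invariant form `w` of a calculus on the circle. -/
structure CircleRules (q : ℂ) (gr' : ℕ → Submodule ℂ Θ) (t : ℤ → Θ) (w : Θ) : Prop where
  t_mem : ∀ n, t n ∈ gr' 0
  w_mem : w ∈ gr' 1
  t_zero : t 0 = 1
  t_mul : ∀ m n, t m * t n = t (m + n)
  w_t : ∀ n, w * t n = q ^ (2 * n) • (t n * w)
  w_w : w * w = 0

/-- The images `e^± ⊗ t^{±2}` and `e⁰ ⊗ 1 + 1 ⊗ w` of the one-forms. -/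
def coE (e : EGen → Ω) (t : ℤ → Θ) (w : Θ) : EGen → Ω ⊗[ℂ] Θ
  | .ep => e .ep ⊗ₜ[ℂ] t 2
  | .em => e .em ⊗ₜ[ℂ] t (-2)
  | .ez => e .ez ⊗ₜ[ℂ] 1 + 1 ⊗ₜ[ℂ] w

variable {x : Gen → Ω} {e : EGen → Ω} {t : ℤ → Θ} {w : Θ}

theorem CircleRules.one_mem (c : CircleRules q gr' t w) : (1 : Θ) ∈ gr' 0 := c.t_zero ▸ c.t_mem 0

variable [GradedAlgebra gr] [GradedAlgebra gr']

theorem CircleRules.tmul_mul (c : CircleRules q gr' t w) (a : Ω) (m : ℤ) (a' : Ω) (n : ℤ) :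
    of ℂ gr gr' (a ⊗ₜ[ℂ] t m) * of ℂ gr gr' (a' ⊗ₜ[ℂ] t n) =
      of ℂ gr gr' ((a * a') ⊗ₜ[ℂ] t (m + n)) := by
  rw [of_tmul_mul_of_tmul_zero_left _ (c.t_mem m), c.t_mul]

theorem CircleRules.tmul_mul_coE_ez (c : CircleRules q gr' t w) (a : Ω) (m : ℤ) :
    of ℂ gr gr' (a ⊗ₜ[ℂ] t m) * of ℂ gr gr' (coE e t w .ez) =
      of ℂ gr gr' ((a * e .ez) ⊗ₜ[ℂ] t m) + of ℂ gr gr' (a ⊗ₜ[ℂ] (t m * w)) := by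
  rw [coE, map_add, mul_add, of_tmul_mul_of_tmul_zero_left _ (c.t_mem m),
    of_tmul_mul_of_tmul_zero_left _ (c.t_mem m), mul_one, mul_one]

theorem CircleRules.coE_ez_mul_tmul (c : CircleRules q gr' t w) {i : ℕ} {a : Ω} (ha : a ∈ gr i)
    (m : ℤ) : of ℂ gr gr' (coE e t w .ez) * of ℂ gr gr' (a ⊗ₜ[ℂ] t m) =
      of ℂ gr gr' ((e .ez * a) ⊗ₜ[ℂ] t m) +
        ((-1) ^ i * q ^ (2 * m)) • of ℂ gr gr' (a ⊗ₜ[ℂ] (t m * w)) := by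
  rw [coE, map_add, add_mul, of_tmul_mul_of_tmul_zero_left _ c.one_mem,
    of_tmul_mul_of_tmul _ c.w_mem ha, one_mul, one_mul, one_mul, c.w_t, TensorProduct.tmul_smul,
    map_smul, smul_smul]

/-- Relations without `e⁰` hold because the powers of `t` add up. For those with `e⁰`, the summand
`1 ⊗ w` has to follow the same rule as `e⁰ ⊗ 1`, and it does by `w tⁿ = q^{2n} tⁿ w` and the sign of
the graded product. -/
theorem CircleRules.formRel (c : CircleRules q gr' t w) (hq : q ≠ 0)
    (hx : ∀ f, x f ∈ gr 0) (he : ∀ s, e s ∈ gr 1) (h : ∀ a b, FormRel q x e a b → a = b)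
    (a b : GradedTensorProduct ℂ gr gr')
    (hab : FormRel q (fun f => of ℂ gr gr' (x f ⊗ₜ[ℂ] t f.deg))
      (fun s => of ℂ gr gr' (coE e t w s)) a b) : a = b := by
  have r := formRules hq h
  have hone : (1 : GradedTensorProduct ℂ gr gr') = of ℂ gr gr' (1 ⊗ₜ[ℂ] t 0) := by
    rw [c.t_zero]; rfl
  have hep : coE e t w .ep = e .ep ⊗ₜ[ℂ] t 2 := rfl
  have hem : coE e t w .em = e .em ⊗ₜ[ℂ] t (-2) := rfl
  cases hab with
  | base hab =>
    cases hab <;> simp only [c.tmul_mul, Gen.deg, ← map_smul, ← map_sub,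
      TensorProduct.smul_tmul', ← TensorProduct.sub_tmul, hone, add_neg_cancel, neg_add_cancel]
    · rw [r.be_al]
    · rw [r.ga_al]
    · rw [r.de_be]
    · rw [r.de_ga]
    · rw [r.ga_be]
    · rw [h _ _ (.base .de_al)]
    · rw [h _ _ (.base .det)]
  | comm s f =>
    have hc := h _ _ (.comm s f)
    cases s with
    | ep => rw [hep, c.tmul_mul, c.tmul_mul, hc, ← TensorProduct.smul_tmul', map_smul, add_comm]
    | em => rw [hem, c.tmul_mul, c.tmul_mul, hc, ← TensorProduct.smul_tmul', map_smul, add_comm]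
    | ez =>
      rw [c.coE_ez_mul_tmul (hx f), c.tmul_mul_coE_ez, hc, ← TensorProduct.smul_tmul', map_smul,
        smul_add, pow_zero, one_mul, EGen.wt]
  | sq s =>
    cases s with
    | ep => rw [hep, c.tmul_mul, r.sq, TensorProduct.zero_tmul, map_zero]
    | em => rw [hem, c.tmul_mul, r.sq, TensorProduct.zero_tmul, map_zero]
    | ez =>
      -- The cross terms `(e⁰ ⊗ 1)(1 ⊗ w)` and `(1 ⊗ w)(e⁰ ⊗ 1)` are opposite.
      rw [coE, map_add, add_mul, mul_add, mul_add, of_tmul_mul_of_tmul_zero_left _ c.one_mem,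
        of_tmul_mul_of_tmul_zero_left _ c.one_mem, of_tmul_mul_of_tmul _ c.w_mem (he .ez),
        of_tmul_mul_of_tmul_zero_right _ _ SetLike.GradedOne.one_mem, r.sq, c.w_w]
      simp
  | ep_em =>
    rw [hep, hem, c.tmul_mul, c.tmul_mul, h _ _ .ep_em, ← TensorProduct.smul_tmul', map_smul,
      add_comm]
  | ep_ez =>
    -- Moving `1 ⊗ w` past `e⁺ ⊗ t²` costs `-q⁴`, the same factor as in `e⁰e⁺ = -q⁴ e⁺e⁰`.
    rw [hep, c.tmul_mul_coE_ez, c.coE_ez_mul_tmul (he .ep), h _ _ .ep_ez,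
      ← TensorProduct.smul_tmul', map_smul]
    match_scalars <;> simp <;> field_simp
  | em_ez =>
    rw [hem, c.tmul_mul_coE_ez, c.coE_ez_mul_tmul (he .em), h _ _ .em_ez,
      ← TensorProduct.smul_tmul', map_smul]
    match_scalars <;> simp [zpow_neg] <;> field_simp

/-- The differentials of the powers of `t` and of the invariant form. -/
structure CircleDifferentialRules (q : ℂ) (t : ℤ → Θ) (w : Θ) (d' : Θ →ₗ[ℂ] Θ) : Prop where
  one : d' 1 = 0
  d_w : d' w = 0
  t_one : d' (t 1) = t 1 * w
  t_neg_one : d' (t (-1)) = -(q⁻¹ ^ 2) • (t (-1) * w)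
  t_two : d' (t 2) = (1 + q ^ 2) • (t 2 * w)
  t_neg_two : d' (t (-2)) = -(q⁻¹ ^ 2 * (1 + q⁻¹ ^ 2)) • (t (-2) * w)

variable {d : Ω →ₗ[ℂ] Ω} {d' : Θ →ₗ[ℂ] Θ}
  {Φ : Ω →ₐ[ℂ] GradedTensorProduct ℂ gr gr'}

/-- The part `1 ⊗ w` of the image of `e⁰` supplies the summand `x f ⊗ d'(t^{|f|})`: the coefficient
of `x f * e⁰` in `dGen`, which is `1` or `-q⁻²`, is that of `t^{|f|} w` in `d'(t^{|f|})`. -/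
theorem map_dGen_eq (c : CircleRules q gr' t w) (c' : CircleDifferentialRules q t w d')
    (hd : IsFormDifferential q x e d) (hx : ∀ f, x f ∈ gr 0)
    (hΦx : ∀ f, Φ (x f) = of ℂ gr gr' (x f ⊗ₜ[ℂ] t f.deg))
    (hΦe : ∀ s, Φ (e s) = of ℂ gr gr' (coE e t w s)) (f : Gen) :
    Φ (dGen q x e f) = of ℂ gr gr' (tensorDifferential gr d d' (x f ⊗ₜ[ℂ] t f.deg)) := by
  have hep : coE e t w .ep = e .ep ⊗ₜ[ℂ] t 2 := rfl
  have hem : coE e t w .em = e .em ⊗ₜ[ℂ] t (-2) := rfl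
  rw [tensorDifferential_tmul (hx f), hd.d_x]
  cases f <;>
    simp only [dGen, map_add Φ, map_sub Φ, map_mul Φ, map_smul Φ, hΦx, hΦe, c.tmul_mul_coE_ez, hep,
      hem, c.tmul_mul, Gen.deg, c'.t_one, c'.t_neg_one, TensorProduct.add_tmul,
      TensorProduct.sub_tmul, ← TensorProduct.smul_tmul', TensorProduct.tmul_smul, map_add,
      map_sub, map_smul, Int.reduceAdd, Int.reduceNeg] <;>
    module

/-- For `e^±` the coefficient in `dEGen` is minus that of `t^{±2} w` in `d'(t^{±2})`, the sign
coming from the odd degree of `e^±`. For `e⁰` the powers `t²` and `t⁻²` cancel and `d' w = 0`. -/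
theorem map_dEGen_eq (hq : q ≠ 0) (c : CircleRules q gr' t w)
    (c' : CircleDifferentialRules q t w d')
    (hd : IsFormDifferential q x e d) (he : ∀ s, e s ∈ gr 1)
    (hΦe : ∀ s, Φ (e s) = of ℂ gr gr' (coE e t w s)) (s : EGen) :
    Φ (dEGen q e s) = of ℂ gr gr' (tensorDifferential gr d d' (coE e t w s)) := by
  have hep : coE e t w .ep = e .ep ⊗ₜ[ℂ] t 2 := rfl
  have hem : coE e t w .em = e .em ⊗ₜ[ℂ] t (-2) := rfl
  have h1 : (1 : Ω) ∈ gr 0 := SetLike.GradedOne.one_mem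
  cases s with
  | ep =>
    rw [dEGen, map_smul, map_mul, hΦe, hΦe, hep, c.tmul_mul_coE_ez, tensorDifferential_tmul (he _),
      hd.d_e, dEGen, c'.t_two, TensorProduct.tmul_smul, ← TensorProduct.smul_tmul', map_add,
      map_smul, map_smul, map_smul]
    match_scalars <;> field_simp
    ring
  | em =>
    rw [dEGen, map_smul, map_mul, hΦe, hΦe, hem, c.tmul_mul_coE_ez, tensorDifferential_tmul (he _),
      hd.d_e, dEGen, c'.t_neg_two, TensorProduct.tmul_smul, ← TensorProduct.smul_tmul', map_add,
      map_smul, map_smul, map_smul]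
    match_scalars <;> field_simp
  | ez =>
    rw [dEGen, map_smul, map_mul, hΦe, hΦe, hep, hem, c.tmul_mul, coE, map_add,
      tensorDifferential_tmul (he _), tensorDifferential_tmul h1, hd.d_e, dEGen, c'.one, c'.d_w,
      hd.one, ← TensorProduct.smul_tmul']
    simp [c.t_zero]

theorem coE_mem (c : CircleRules q gr' t w) (he : ∀ s, e s ∈ gr 1) (s : EGen) :
    coE e t w s ∈ tensorDegree gr gr' 1 := by
  cases s with
  | ep => exact tmul_mem_tensorDegree (he _) (c.t_mem _) rfl
  | em => exact tmul_mem_tensorDegree (he _) (c.t_mem _) rfl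
  | ez =>
    exact Submodule.add_mem _ (tmul_mem_tensorDegree (he _) c.one_mem rfl)
      (tmul_mem_tensorDegree SetLike.GradedOne.one_mem c.w_mem rfl)

end GradedCoaction

end QHopf
end

open scoped TensorProduct LaurentPolynomial DirectSum

noncomputable section

namespace QHopf

/-! ### `Ω(A)` is generated by `A` and `dA`, and the coaction extends uniquely. -/

section CompleteCalculus

open LaurentPolynomial (T)
open GradedTensorProduct

variable {q : ℂ} {d : Form q →ₗ[ℂ] Form q} {d' : CForm q →ₗ[ℂ] CForm q}

/-- A common shape for the three formulas, so that generation in degree zero and uniqueness of the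
extension need no distinction between the one-forms. -/
theorem Form.IsDifferential.exists_e_eq (hd : Form.IsDifferential d) (hq : q ≠ 0) (s : EGen) :
    ∃ (c c' : ℂ) (f g f' g' : Gen), Form.e q s = c • (Form.x q f * d (Form.x q g)) -
      c' • (Form.x q f' * d (Form.x q g')) := by
  have r := formRules hq (Form.rel (q := q))
  cases s with
  | ep => exact ⟨_, _, _, _, _, _, hd.isFormDifferential.ep_eq hq r⟩
  | em => exact ⟨1, q, .de, .be, .be, .de,
      (hd.isFormDifferential.em_eq hq r).trans (by rw [one_smul])⟩
  | ez => exact ⟨1, q, .de, .al, .be, .ga,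
      (hd.isFormDifferential.ez_eq r).trans (by rw [one_smul])⟩

/-- A one-form `e^s` on the left crosses the leading coefficient by its twist and is then replaced
by a combination of products `f dg`, which lengthens the string of differentials by one. -/
theorem Form.IsDifferential.gr_le_span (hd : Form.IsDifferential d) (hq : q ≠ 0) (n : ℕ) :
    Form.gr q n ≤ Submodule.span ℂ (Set.range fun a : SUq q × (Fin n → SUq q) =>
      Form.incl q a.1 * (List.ofFn fun i => d (Form.incl q (a.2 i))).prod) := by
  let W : ℕ → Submodule ℂ (Form q) := fun n =>
    Submodule.span ℂ (Set.range fun a : SUq q × (Fin n → SUq q) =>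
      Form.incl q a.1 * (List.ofFn fun i => d (Form.incl q (a.2 i))).prod)
  have hx : ∀ a n, W n ≤ (W n).comap (LinearMap.mulLeft ℂ (Form.incl q a)) := by
    intro a n
    refine Submodule.span_le.2 ?_
    rintro _ ⟨b, rfl⟩
    exact Submodule.subset_span ⟨(a * b.1, b.2), by simp [mul_assoc]⟩
  have hxd : ∀ (b : SUq q) (f g : Gen) (n : ℕ) (a : Fin n → SUq q),
      Form.incl q b * (Form.x q f * d (Form.x q g) *
        (List.ofFn fun i => d (Form.incl q (a i))).prod) ∈ W (n + 1) := by
    intro b f g n a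
    refine Submodule.subset_span ⟨(b * SUq.gen q f, Fin.cons (SUq.gen q g) a), ?_⟩
    simp [List.ofFn_succ, Form.incl_gen, mul_assoc]
  have he : ∀ s n, W n ≤ (W (n + 1)).comap (LinearMap.mulLeft ℂ (Form.e q s)) := by
    intro s n
    obtain ⟨c, c', f, g, f', g', h⟩ := hd.exists_e_eq hq s
    refine Submodule.span_le.2 ?_
    rintro _ ⟨a, rfl⟩
    change Form.e q s * (Form.incl q a.1 * _) ∈ W (n + 1)
    rw [← mul_assoc, Form.e_mul_incl hq, mul_assoc, h, sub_mul, smul_mul_assoc, smul_mul_assoc,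
      mul_sub, mul_smul_comm, mul_smul_comm]
    exact (W (n + 1)).sub_mem ((W (n + 1)).smul_mem _ (hxd _ _ _ _ _))
      ((W (n + 1)).smul_mem _ (hxd _ _ _ _ _))
  refine wordGrading_le (V := W) (Submodule.subset_span ⟨(1, Fin.elim0), by simp⟩) ?_ n
  intro x n y hy
  rcases x with f | s
  · change Form.x q f * y ∈ W (0 + n)
    rw [zero_add, ← Form.incl_gen]
    exact hx _ n hy
  · change Form.e q s * y ∈ W (1 + n)
    rw [add_comm]
    exact he s n hy

theorem Form.IsDifferential.isDifferentialCalculus (hd : Form.IsDifferential d) (hq : q ≠ 0) :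
    IsDifferentialCalculus (Form.incl q) (Form.gr q) d where
  injective := Form.incl_injective hq
  range_eq := Form.range_incl hq
  degree := hd.degree
  d_d := hd.d_d hq
  leibniz := hd.leibniz
  generated n := le_antisymm (hd.gr_le_span hq n) (span_le_of_mem Form.incl_mem
    (fun a => hd.degree 0 _ (Form.incl_mem a)) n)

theorem CForm.circleRules (hq : q ≠ 0) (hq2 : q ^ 2 ≠ -1) :
    CircleRules q (CForm.gr q) (CForm.t q) (CForm.t q (-1) * CForm.dt q) where
  t_mem := CForm.t_mem
  w_mem := (SetLike.GradedMul.mul_mem (CForm.t_mem _) CForm.dt_mem : _ ∈ CForm.gr q (0 + 1))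
  t_zero := CForm.t_zero
  t_mul m n := (CForm.t_add m n).symm
  w_t n := by
    rw [mul_assoc, CForm.dt_mul_t hq, mul_smul_comm, ← mul_assoc, ← mul_assoc, ← CForm.t_add,
      ← CForm.t_add, add_comm, zpow_mul]
    rfl
  w_w := by
    rw [mul_assoc, ← mul_assoc (CForm.dt q), CForm.dt_mul_t hq, smul_mul_assoc, mul_assoc,
      CForm.dt_mul_dt hq2]
    simp

theorem CForm.IsDifferential.circleDifferentialRules (hd' : CForm.IsDifferential d') (hq : q ≠ 0)
    (hq2 : q ^ 2 ≠ -1) :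
    CircleDifferentialRules q (CForm.t q) (CForm.t q (-1) * CForm.dt q) d' where
  one := hd'.one
  d_w := by
    -- The differential of `w` is a two-form on the circle, hence zero.
    have h := hd'.degree _ _ (CForm.circleRules hq hq2).w_mem
    rw [CForm.gr_eq_bot hq hq2 _ le_rfl] at h
    exact (Submodule.mem_bot ℂ).1 h
  t_one := by
    rw [hd'.d_t_one, ← mul_assoc, ← CForm.t_add]
    exact ((congrArg (· * CForm.dt q) CForm.t_zero).trans (one_mul _)).symm
  t_neg_one := by
    rw [hd'.d_t_neg_one, ← mul_assoc, ← CForm.t_add]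
    rfl
  t_two := by
    rw [hd'.d_t_two, ← mul_assoc, ← CForm.t_add]
    rfl
  t_neg_two := by
    rw [show (-2 : ℤ) = -1 + -1 by norm_num, CForm.t_add, hd'.leibniz 0 _ (CForm.t_mem _),
      hd'.d_t_neg_one, smul_mul_assoc, mul_assoc, CForm.dt_mul_t_neg_one hq, mul_smul_comm,
      mul_smul_comm, ← mul_assoc, ← mul_assoc, ← mul_assoc, ← CForm.t_add, ← CForm.t_add,
      ← CForm.t_add, ← CForm.t_add]
    simp only [Int.reduceAdd, Int.reduceNeg]
    module

theorem Form.exists_extension (hq : q ≠ 0) (hq2 : q ^ 2 ≠ -1) :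
    ∃ Φ : Form q →ₐ[ℂ] GradedTensorProduct ℂ (Form.gr q) (CForm.gr q),
      (∀ f, Φ (Form.x q f) = of ℂ (Form.gr q) (CForm.gr q) (Form.x q f ⊗ₜ[ℂ] CForm.t q f.deg)) ∧
      ∀ s, Φ (Form.e q s) = of ℂ (Form.gr q) (CForm.gr q)
        (coE (Form.e q) (CForm.t q) (CForm.t q (-1) * CForm.dt q) s) :=
  Form.exists_lift ((CForm.circleRules hq hq2).formRel hq Form.x_mem Form.e_mem Form.rel)

theorem Form.IsDifferential.exists_isDGExtension (hd : Form.IsDifferential d)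
    (hd' : CForm.IsDifferential d') (hq : q ≠ 0) (hq2 : q ^ 2 ≠ -1) :
    ∃ Φ : Form q →ₐ[ℂ] GradedTensorProduct ℂ (Form.gr q) (CForm.gr q),
      IsDGExtension (coaction q) (Form.incl q) (Form.gr q) d (CForm.incl q) (CForm.gr q) d' Φ ∧
      (∀ f, Φ (Form.x q f) = of ℂ (Form.gr q) (CForm.gr q) (Form.x q f ⊗ₜ[ℂ] CForm.t q f.deg)) ∧
      ∀ s, Φ (Form.e q s) = of ℂ (Form.gr q) (CForm.gr q)
        (coE (Form.e q) (CForm.t q) (CForm.t q (-1) * CForm.dt q) s) := by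
  obtain ⟨Φ, hx, he⟩ := Form.exists_extension hq hq2
  have c := CForm.circleRules hq hq2
  have c' := hd'.circleDifferentialRules hq hq2
  have hd₀ := hd.isFormDifferential
  refine ⟨Φ, isDGExtension_of_generators (gr := Form.gr q) (w := formDeg) rfl hd.degree hd'.degree
    hd.leibniz hd'.leibniz hd.one hd'.one hd.gen_mul
    (u := Sum.elim (fun f => Form.x q f ⊗ₜ[ℂ] CForm.t q f.deg)
      (coE (Form.e q) (CForm.t q) (CForm.t q (-1) * CForm.dt q))) ?_ ?_ ?_ ?_, hx, he⟩
  · rintro (f | s)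
    exacts [hx f, he s]
  · rintro (f | s)
    · exact tmul_mem_tensorDegree (Form.x_mem f) (CForm.t_mem _) rfl
    · exact coE_mem c Form.e_mem s
  · rintro (f | s)
    · exact map_dGen_eq c c' hd₀ Form.x_mem hx he f
    · exact map_dEGen_eq hq c c' hd₀ Form.e_mem he s
  · intro a
    refine mem_of_generators _ (V := LinearMap.eqLocus
      ((of ℂ (Form.gr q) (CForm.gr q)).symm.toLinearMap ∘ₗ Φ.toLinearMap ∘ₗ
        (Form.incl q).toLinearMap)
      ((Algebra.TensorProduct.map (Form.incl q) (CForm.incl q)).toLinearMap ∘ₗ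
        (coaction q).toLinearMap)) ?_ ?_ a
    · change (of ℂ (Form.gr q) (CForm.gr q)).symm (Φ (Form.incl q 1)) =
        Algebra.TensorProduct.map (Form.incl q) (CForm.incl q) (coaction q 1)
      rw [map_one, map_one, of_symm_one, map_one, map_one]
    · intro f y hy
      change _ = Algebra.TensorProduct.map (Form.incl q) (CForm.incl q) (coaction q y) at hy
      change Φ (Form.incl q (SUq.gen q f * y)) = of ℂ (Form.gr q) (CForm.gr q)
        (Algebra.TensorProduct.map (Form.incl q) (CForm.incl q) (coaction q (SUq.gen q f * y)))
      rw [map_mul, map_mul Φ, map_mul, map_mul, ← hy, Form.incl_gen, hx,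
        mem_homog.1 (gen_mem_homog q f), Algebra.TensorProduct.map_tmul, Form.incl_gen]
      exact of_tmul_mul_of_zero_left _ (CForm.t_mem f.deg) _

/-- The coaction fixes the map on `A`, compatibility with the differentials fixes it on `dA`, and
the one-forms `e^s` are combinations of products of such elements. -/
theorem Form.IsDifferential.isDGExtension_unique (hd : Form.IsDifferential d) (hq : q ≠ 0)
    {Φ Ψ : Form q →ₐ[ℂ] GradedTensorProduct ℂ (Form.gr q) (CForm.gr q)}
    (hΦ : IsDGExtension (coaction q) (Form.incl q) (Form.gr q) d (CForm.incl q) (CForm.gr q) d' Φ)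
    (hΨ : IsDGExtension (coaction q) (Form.incl q) (Form.gr q) d (CForm.incl q) (CForm.gr q) d' Ψ) :
    Φ = Ψ := by
  have hx : ∀ f, Φ (Form.x q f) = Ψ (Form.x q f) := fun f => by
    apply (of ℂ (Form.gr q) (CForm.gr q)).symm.injective
    rw [← Form.incl_gen, hΦ.extends_coaction, hΨ.extends_coaction]
  have hdx : ∀ f, Φ (d (Form.x q f)) = Ψ (d (Form.x q f)) := fun f => by
    apply (of ℂ (Form.gr q) (CForm.gr q)).symm.injective
    rw [hΦ.differential, hΨ.differential, hx]
  refine presented_algHom_ext ?_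
  rintro (f | s)
  · exact hx f
  · change Φ (Form.e q s) = Ψ (Form.e q s)
    obtain ⟨c, c', f, g, f', g', h⟩ := hd.exists_e_eq hq s
    rw [h]
    simp only [map_sub, map_smul, map_mul, hx, hdx]

end CompleteCalculus

end QHopf
end

open scoped TensorProduct LaurentPolynomial DirectSum

noncomputable section

namespace QHopf

/-! ### Components of the extension and the coaction on forms. -/

section Components

open LaurentPolynomial (T)
open GradedTensorProduct

section Projections

variable {k Ω Θ : Type} [Field k] [Ring Ω] [Algebra k Ω] [Ring Θ] [Algebra k Θ]
  {gr : ℕ → Submodule k Ω} {gr' : ℕ → Submodule k Θ} [GradedAlgebra gr] [GradedAlgebra gr']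

theorem map_proj_tmul {a : Ω} {b : Θ} {i j : ℕ} (ha : a ∈ gr i) (hb : b ∈ gr' j) (m n : ℕ) :
    TensorProduct.map (GradedAlgebra.proj gr m) (GradedAlgebra.proj gr' n) (a ⊗ₜ[k] b) =
      if i = m ∧ j = n then a ⊗ₜ[k] b else 0 := by
  rw [TensorProduct.map_tmul]
  split_ifs with hij
  · obtain ⟨rfl, rfl⟩ := hij
    rw [proj_of_mem ha, proj_of_mem hb]
  · rcases not_and_or.1 hij with hi | hj
    · rw [proj_of_mem_ne ha hi, TensorProduct.zero_tmul]
    · rw [proj_of_mem_ne hb hj, TensorProduct.tmul_zero]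

theorem ver_apply (Φ : Ω →ₐ[k] GradedTensorProduct k gr gr') (m n : ℕ) (ω : Ω) :
    ver Φ m n ω = TensorProduct.map (GradedAlgebra.proj gr m) (GradedAlgebra.proj gr' n)
      ((of k gr gr').symm (Φ ω)) := rfl

theorem ver_tmul {Φ : Ω →ₐ[k] GradedTensorProduct k gr gr'} {ω : Ω} {a : Ω} {b : Θ} {i j : ℕ}
    (h : Φ ω = of k gr gr' (a ⊗ₜ[k] b)) (ha : a ∈ gr i) (hb : b ∈ gr' j) (m n : ℕ) :
    ver Φ m n ω = if i = m ∧ j = n then a ⊗ₜ[k] b else 0 := by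
  rw [ver_apply, h, of_symm_of, map_proj_tmul ha hb]

theorem ver_tmul_add_tmul {Φ : Ω →ₐ[k] GradedTensorProduct k gr gr'} {ω a a' : Ω} {b b' : Θ}
    {i j i' j' : ℕ} (h : Φ ω = of k gr gr' (a ⊗ₜ[k] b) + of k gr gr' (a' ⊗ₜ[k] b'))
    (ha : a ∈ gr i) (hb : b ∈ gr' j) (ha' : a' ∈ gr i') (hb' : b' ∈ gr' j') (m n : ℕ) :
    ver Φ m n ω = (if i = m ∧ j = n then a ⊗ₜ[k] b else 0) +
      if i' = m ∧ j' = n then a' ⊗ₜ[k] b' else 0 := by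
  rw [ver_apply, h, ← map_add, of_symm_of, map_add, map_proj_tmul ha hb, map_proj_tmul ha' hb']

/-- The first factors of `u` already lie in degree `n`, so the projection to degree `n` can be
inserted on both sides of `h`. -/
theorem map_id_eq_map_proj {H : Type} [Ring H] [Algebra k H] {ι' : H →ₗ[k] Θ} {n : ℕ}
    {u : Ω ⊗[k] H} (hu : u ∈ Submodule.map₂ (TensorProduct.mk k Ω H) (gr n) ⊤) {v : Ω ⊗[k] Θ}
    (h : TensorProduct.map LinearMap.id ι' u =
      TensorProduct.map LinearMap.id (GradedAlgebra.proj gr' 0) v) :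
    TensorProduct.map LinearMap.id ι' u =
      TensorProduct.map (GradedAlgebra.proj gr n) (GradedAlgebra.proj gr' 0) v := by
  have h1 : TensorProduct.map (GradedAlgebra.proj gr n) LinearMap.id
      (TensorProduct.map LinearMap.id ι' u) = TensorProduct.map LinearMap.id ι' u := by
    have hle : Submodule.map₂ (TensorProduct.mk k Ω H) (gr n) ⊤ ≤ LinearMap.eqLocus
        (TensorProduct.map (GradedAlgebra.proj gr n) LinearMap.id ∘ₗ
          TensorProduct.map LinearMap.id ι') (TensorProduct.map LinearMap.id ι') := by
      refine Submodule.map₂_le.2 fun a ha b _ => ?_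
      rw [LinearMap.mem_eqLocus, LinearMap.comp_apply, TensorProduct.mk_apply,
        TensorProduct.map_tmul, TensorProduct.map_tmul, LinearMap.id_apply, LinearMap.id_apply,
        proj_of_mem ha]
    exact hle hu
  rw [← h1, h, ← LinearMap.comp_apply, ← TensorProduct.map_comp, LinearMap.comp_id,
    LinearMap.id_comp]

theorem ver_eq_zero_of_eq_bot {Φ : Ω →ₐ[k] GradedTensorProduct k gr gr'} {j : ℕ} (i : ℕ)
    (h : gr' j = ⊥) : ver Φ i j = 0 := by
  have h0 : GradedAlgebra.proj gr' j = 0 := by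
    ext η
    exact (Submodule.mem_bot k).1 (h.le (SetLike.coe_mem (DirectSum.decompose gr' η j)))
  rw [ver, h0, TensorProduct.map_zero_right, LinearMap.zero_comp]

end Projections

variable {q : ℂ} {d : Form q →ₗ[ℂ] Form q}

/-- The degrees of `e⁺, e⁻, e⁰` for the coaction of the circle. -/
def EGen.charge : EGen → ℤ
  | .ep => 2
  | .em => -2
  | .ez => 0

/-- The degrees of the generators of the algebra of forms for the coaction of the circle. -/
def formCharge : Gen ⊕ EGen → ℤ := Sum.elim Gen.deg EGen.charge

/-- In each relation all terms have the same charge, so the powers of `T` agree and the relation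
holds in the first factor. No signs occur, because the tensor product is the ordinary one. -/
theorem tmul_T_formRel {Ω : Type} [Ring Ω] [Algebra ℂ Ω] {x : Gen → Ω} {e : EGen → Ω}
    (h : ∀ a b, FormRel q x e a b → a = b) (a b : Ω ⊗[ℂ] ℂ[T;T⁻¹])
    (hab : FormRel q (fun f => x f ⊗ₜ[ℂ] (T f.deg : ℂ[T;T⁻¹]))
      (fun s => e s ⊗ₜ[ℂ] (T s.charge : ℂ[T;T⁻¹])) a b) : a = b := by
  have one : (1 : Ω ⊗[ℂ] ℂ[T;T⁻¹]) = 1 ⊗ₜ[ℂ] T 0 := rfl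
  cases hab with
  | base hab =>
    cases hab <;> simp only [Algebra.TensorProduct.tmul_mul_tmul, ← LaurentPolynomial.T_add,
      Gen.deg, TensorProduct.smul_tmul', one, add_neg_cancel, neg_add_cancel,
      ← TensorProduct.sub_tmul]
    · rw [h _ _ (.base .be_al)]
    · rw [h _ _ (.base .ga_al)]
    · rw [h _ _ (.base .de_be)]
    · rw [h _ _ (.base .de_ga)]
    · rw [h _ _ (.base .ga_be)]
    · rw [h _ _ (.base .de_al)]
    · rw [h _ _ (.base .det)]
  | comm s f =>
    rw [Algebra.TensorProduct.tmul_mul_tmul, Algebra.TensorProduct.tmul_mul_tmul,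
      h _ _ (.comm s f), TensorProduct.smul_tmul', mul_comm (T s.charge)]
  | sq s => rw [Algebra.TensorProduct.tmul_mul_tmul, h _ _ (.sq s), TensorProduct.zero_tmul]
  | ep_em =>
    rw [Algebra.TensorProduct.tmul_mul_tmul, Algebra.TensorProduct.tmul_mul_tmul,
      h _ _ .ep_em, TensorProduct.smul_tmul', mul_comm (T (EGen.charge .em))]
  | ep_ez =>
    rw [Algebra.TensorProduct.tmul_mul_tmul, Algebra.TensorProduct.tmul_mul_tmul,
      h _ _ .ep_ez, TensorProduct.smul_tmul', mul_comm (T (EGen.charge .ez))]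
  | em_ez =>
    rw [Algebra.TensorProduct.tmul_mul_tmul, Algebra.TensorProduct.tmul_mul_tmul,
      h _ _ .em_ez, TensorProduct.smul_tmul', mul_comm (T (EGen.charge .ez))]

variable (q) in
theorem Form.exists_coaction : ∃ Δ : Form q →ₐ[ℂ] Form q ⊗[ℂ] ℂ[T;T⁻¹],
    ∀ x, pgen (formRel q) x ∈ homog Δ (formCharge x) := by
  obtain ⟨Δ, h1, h2⟩ := Form.exists_lift (tmul_T_formRel (Form.rel (q := q)))
  refine ⟨Δ, ?_⟩
  rintro (f | s)
  exacts [mem_homog.2 (h1 f), mem_homog.2 (h2 s)]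

theorem Form.dGen_mem_homog {Δ : Form q →ₐ[ℂ] Form q ⊗[ℂ] ℂ[T;T⁻¹]}
    (hΔ : ∀ x, pgen (formRel q) x ∈ homog Δ (formCharge x)) (x : Gen ⊕ EGen) :
    Form.dGen q x ∈ homog Δ (formCharge x) := by
  have m1 : ∀ f s n, f.deg + s.charge = n → Form.x q f * Form.e q s ∈ homog Δ n :=
    fun f s n h => mul_mem_homog (hΔ (.inl f)) (hΔ (.inr s)) h
  have m2 : ∀ s s' n, s.charge + s'.charge = n → Form.e q s * Form.e q s' ∈ homog Δ n :=
    fun s s' n h => mul_mem_homog (hΔ (.inr s)) (hΔ (.inr s')) h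
  rcases x with f | s
  · cases f
    · exact (homog Δ _).add_mem (m1 _ _ _ rfl) ((homog Δ _).smul_mem _ (m1 _ _ _ rfl))
    · exact (homog Δ _).sub_mem (m1 _ _ _ rfl) ((homog Δ _).smul_mem _ (m1 _ _ _ rfl))
    · exact (homog Δ _).add_mem (m1 _ _ _ rfl) ((homog Δ _).smul_mem _ (m1 _ _ _ rfl))
    · exact (homog Δ _).sub_mem (m1 _ _ _ rfl) ((homog Δ _).smul_mem _ (m1 _ _ _ rfl))
  · cases s
    · exact (homog Δ _).smul_mem _ (m2 _ _ _ rfl)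
    · exact (homog Δ _).smul_mem _ (m2 _ _ _ rfl)
    · exact (homog Δ _).smul_mem _ (m2 _ _ _ rfl)

theorem Form.coaction_incl {Δ : Form q →ₐ[ℂ] Form q ⊗[ℂ] ℂ[T;T⁻¹]}
    (hΔ : ∀ x, pgen (formRel q) x ∈ homog Δ (formCharge x)) (a : SUq q) :
    Δ (Form.incl q a) = Algebra.TensorProduct.map (Form.incl q) (AlgHom.id ℂ ℂ[T;T⁻¹])
      (coaction q a) := by
  have : Δ.comp (Form.incl q) = (Algebra.TensorProduct.map (Form.incl q)
      (AlgHom.id ℂ ℂ[T;T⁻¹])).comp (coaction q) := by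
    refine presented_algHom_ext fun f => ?_
    change Δ (Form.incl q (SUq.gen q f)) = Algebra.TensorProduct.map (Form.incl q)
      (AlgHom.id ℂ ℂ[T;T⁻¹]) (coaction q (SUq.gen q f))
    rw [mem_homog.1 (gen_mem_homog q f), Form.incl_gen, Algebra.TensorProduct.map_tmul,
      Form.incl_gen]
    exact mem_homog.1 (hΔ (.inl f))
  exact DFunLike.congr_fun this a

theorem Form.IsDifferential.isRightCovariant (hd : Form.IsDifferential d)
    {Δ : Form q →ₐ[ℂ] Form q ⊗[ℂ] ℂ[T;T⁻¹]}
    (hΔ : ∀ x, pgen (formRel q) x ∈ homog Δ (formCharge x)) :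
    IsRightCovariant (coaction q) (Form.incl q) (Form.gr q) d Δ :=
  isRightCovariant_of_generators hd.one hd.gen_mul hΔ (Form.dGen_mem_homog hΔ)
    (Form.coaction_incl hΔ)

/-- Both sides are multiplicative in `ω`, the right one by `map_proj_zero_mul`. They agree on
generators, since the projection to degree zero removes the summand `1 ⊗ w` from the image of `e⁰`.
-/
theorem Form.map_incl_coaction {Δ : Form q →ₐ[ℂ] Form q ⊗[ℂ] ℂ[T;T⁻¹]}
    (hΔ : ∀ x, pgen (formRel q) x ∈ homog Δ (formCharge x))
    {Φ : Form q →ₐ[ℂ] GradedTensorProduct ℂ (Form.gr q) (CForm.gr q)}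
    (hx : ∀ f, Φ (Form.x q f) =
      of ℂ (Form.gr q) (CForm.gr q) (Form.x q f ⊗ₜ[ℂ] CForm.t q f.deg))
    (he : ∀ s, Φ (Form.e q s) = of ℂ (Form.gr q) (CForm.gr q)
        (coE (Form.e q) (CForm.t q) (CForm.t q (-1) * CForm.dt q) s)) (ω : Form q) :
    TensorProduct.map LinearMap.id (CForm.incl q).toLinearMap (Δ ω) =
      TensorProduct.map LinearMap.id (GradedAlgebra.proj (CForm.gr q) 0)
        ((of ℂ (Form.gr q) (CForm.gr q)).symm (Φ ω)) := by
  have p0 : ∀ n, GradedAlgebra.proj (CForm.gr q) 0 (CForm.t q n) = CForm.t q n :=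
    fun n => proj_of_mem (CForm.t_mem n)
  have p1 : GradedAlgebra.proj (CForm.gr q) 0 (1 : CForm q) = 1 :=
    proj_of_mem SetLike.GradedOne.one_mem
  have p2 : GradedAlgebra.proj (CForm.gr q) 0 (CForm.t q (-1) * CForm.dt q) = 0 :=
    proj_of_mem_ne (m := 1) (SetLike.GradedMul.mul_mem (CForm.t_mem _) CForm.dt_mem :
      _ ∈ CForm.gr q (0 + 1)) one_ne_zero
  have hgen : ∀ x, TensorProduct.map LinearMap.id (GradedAlgebra.proj (CForm.gr q) 0)
      ((of ℂ (Form.gr q) (CForm.gr q)).symm (Φ (pgen (formRel q) x))) =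
      pgen (formRel q) x ⊗ₜ[ℂ] CForm.t q (formCharge x) := by
    rintro (f | s)
    · change TensorProduct.map LinearMap.id (GradedAlgebra.proj (CForm.gr q) 0)
        ((of ℂ (Form.gr q) (CForm.gr q)).symm (Φ (Form.x q f))) = _
      rw [hx, of_symm_of, TensorProduct.map_tmul, p0]
      rfl
    · change TensorProduct.map LinearMap.id (GradedAlgebra.proj (CForm.gr q) 0)
        ((of ℂ (Form.gr q) (CForm.gr q)).symm (Φ (Form.e q s))) = _
      rw [he, of_symm_of]
      cases s with
      | ep => rw [coE, TensorProduct.map_tmul, p0]; rfl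
      | em => rw [coE, TensorProduct.map_tmul, p0]; rfl
      | ez =>
        rw [coE, map_add, TensorProduct.map_tmul, TensorProduct.map_tmul, p1, p2,
          TensorProduct.tmul_zero, add_zero, ← CForm.t_zero]
        rfl
  have hmap : ∀ u v : Form q ⊗[ℂ] ℂ[T;T⁻¹],
      TensorProduct.map LinearMap.id (CForm.incl q).toLinearMap (u * v) =
      TensorProduct.map LinearMap.id (CForm.incl q).toLinearMap u *
      TensorProduct.map LinearMap.id (CForm.incl q).toLinearMap v :=
    fun u v => map_mul (Algebra.TensorProduct.map (AlgHom.id ℂ (Form q)) (CForm.incl q)) u v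
  refine mem_of_generators _ (V := LinearMap.eqLocus
    (TensorProduct.map LinearMap.id (CForm.incl q).toLinearMap ∘ₗ Δ.toLinearMap)
    (TensorProduct.map LinearMap.id (GradedAlgebra.proj (CForm.gr q) 0) ∘ₗ
      (of ℂ (Form.gr q) (CForm.gr q)).symm.toLinearMap ∘ₗ Φ.toLinearMap)) ?_ ?_ ω
  · change TensorProduct.map LinearMap.id (CForm.incl q).toLinearMap (Δ 1) =
      TensorProduct.map LinearMap.id (GradedAlgebra.proj (CForm.gr q) 0)
        ((of ℂ (Form.gr q) (CForm.gr q)).symm (Φ 1))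
    rw [map_one Δ, map_one Φ, of_symm_one, Algebra.TensorProduct.one_def,
      Algebra.TensorProduct.one_def, TensorProduct.map_tmul, TensorProduct.map_tmul, p1]
    simp
  · intro x y hy
    change TensorProduct.map LinearMap.id (CForm.incl q).toLinearMap (Δ y) =
      TensorProduct.map LinearMap.id (GradedAlgebra.proj (CForm.gr q) 0)
        ((of ℂ (Form.gr q) (CForm.gr q)).symm (Φ y)) at hy
    change TensorProduct.map LinearMap.id (CForm.incl q).toLinearMap (Δ (pgen (formRel q) x * y)) =
      TensorProduct.map LinearMap.id (GradedAlgebra.proj (CForm.gr q) 0)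
        ((of ℂ (Form.gr q) (CForm.gr q)).symm (Φ (pgen (formRel q) x * y)))
    have hm := map_proj_zero_mul (gr := Form.gr q) (gr' := CForm.gr q)
      ((of ℂ (Form.gr q) (CForm.gr q)).symm (Φ (pgen (formRel q) x)))
      ((of ℂ (Form.gr q) (CForm.gr q)).symm (Φ y))
    rw [symm_of_of, symm_of_of] at hm
    rw [map_mul Φ, hm, hgen, map_mul Δ, hmap, hy, mem_homog.1 (hΔ x), TensorProduct.map_tmul]
    rfl

theorem Form.map_incl_coaction_of_mem (hd : Form.IsDifferential d)
    {Δ : Form q →ₐ[ℂ] Form q ⊗[ℂ] ℂ[T;T⁻¹]}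
    (hΔ : ∀ x, pgen (formRel q) x ∈ homog Δ (formCharge x))
    {Φ : Form q →ₐ[ℂ] GradedTensorProduct ℂ (Form.gr q) (CForm.gr q)}
    (hx : ∀ f, Φ (Form.x q f) =
      of ℂ (Form.gr q) (CForm.gr q) (Form.x q f ⊗ₜ[ℂ] CForm.t q f.deg))
    (he : ∀ s, Φ (Form.e q s) = of ℂ (Form.gr q) (CForm.gr q)
        (coE (Form.e q) (CForm.t q) (CForm.t q (-1) * CForm.dt q) s)) (n : ℕ) (ω : Form q)
    (hω : ω ∈ Form.gr q n) :
    TensorProduct.map LinearMap.id (CForm.incl q).toLinearMap (Δ ω) = ver Φ n 0 ω := by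
  rw [ver_apply]
  exact map_id_eq_map_proj (gr := Form.gr q) (gr' := CForm.gr q)
    ((hd.isRightCovariant hΔ).degree n ω hω)
    (Form.map_incl_coaction hΔ hx he ω)

end Components

end QHopf
end

open scoped TensorProduct LaurentPolynomial DirectSum

noncomputable section

namespace QHopf

/-! ### Values of the components on the basis forms. -/

section ComponentValues

open GradedTensorProduct

variable {Ω Θ : Type} [Ring Ω] [Algebra ℂ Ω] [Ring Θ] [Algebra ℂ Θ]
  {gr : ℕ → Submodule ℂ Ω} {gr' : ℕ → Submodule ℂ Θ} {q : ℂ} [GradedAlgebra gr] [GradedAlgebra gr']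
  {e : EGen → Ω} {t : ℤ → Θ} {w : Θ} {Φ : Ω →ₐ[ℂ] GradedTensorProduct ℂ gr gr'}

theorem CircleRules.t_mul_w_mem (c : CircleRules q gr' t w) (n : ℤ) : t n * w ∈ gr' 1 :=
  (SetLike.GradedMul.mul_mem (c.t_mem n) c.w_mem : _ ∈ gr' (0 + 1))

/-- Here and in the next two lemmas the image of a basis form is a sum of at most two tensors of
pure bidegree, among which the component selects. -/
theorem ver_one_forms (c : CircleRules q gr' t w) (he : ∀ s, e s ∈ gr 1)
    (hΦ : ∀ s, Φ (e s) = of ℂ gr gr' (coE e t w s)) :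
    ver Φ 1 0 (e .ep) = e .ep ⊗ₜ[ℂ] t 2 ∧ ver Φ 1 0 (e .em) = e .em ⊗ₜ[ℂ] t (-2) ∧
      ver Φ 1 0 (e .ez) = e .ez ⊗ₜ[ℂ] 1 ∧ ver Φ 0 1 (e .ep) = 0 ∧ ver Φ 0 1 (e .em) = 0 ∧
      ver Φ 0 1 (e .ez) = 1 ⊗ₜ[ℂ] w := by
  have hp := ver_tmul (hΦ .ep) (he _) (c.t_mem _)
  have hm := ver_tmul (hΦ .em) (he _) (c.t_mem _)
  have hz := ver_tmul_add_tmul ((hΦ .ez).trans (map_add _ _ _)) (he _) c.one_mem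
    SetLike.GradedOne.one_mem c.w_mem
  refine ⟨?_, ?_, ?_, ?_, ?_, ?_⟩ <;> simp [hp, hm, hz]

theorem ver_two_forms (c : CircleRules q gr' t w) (he : ∀ s, e s ∈ gr 1)
    (hΦ : ∀ s, Φ (e s) = of ℂ gr gr' (coE e t w s)) :
    ver Φ 2 0 (e .ep * e .em) = (e .ep * e .em) ⊗ₜ[ℂ] 1 ∧
      ver Φ 2 0 (e .ep * e .ez) = (e .ep * e .ez) ⊗ₜ[ℂ] t 2 ∧
      ver Φ 2 0 (e .em * e .ez) = (e .em * e .ez) ⊗ₜ[ℂ] t (-2) ∧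
      ver Φ 1 1 (e .ep * e .em) = 0 ∧
      ver Φ 1 1 (e .ep * e .ez) = e .ep ⊗ₜ[ℂ] (t 2 * w) ∧
      ver Φ 1 1 (e .em * e .ez) = e .em ⊗ₜ[ℂ] (t (-2) * w) := by
  have he2 : ∀ s s', e s * e s' ∈ gr 2 := fun s s' => SetLike.GradedMul.mul_mem (he s) (he s')
  have hpm := ver_tmul (Φ := Φ) (ω := e .ep * e .em) (by
      rw [map_mul, hΦ, hΦ]; exact c.tmul_mul _ _ _ _)
    (he2 .ep .em) (c.t_mem (2 + -2))
  have hpz := ver_tmul_add_tmul (Φ := Φ) (ω := e .ep * e .ez) (by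
      rw [map_mul, hΦ .ep, hΦ]; exact c.tmul_mul_coE_ez _ _)
    (he2 .ep .ez) (c.t_mem 2) (he .ep) (c.t_mul_w_mem 2)
  have hmz := ver_tmul_add_tmul (Φ := Φ) (ω := e .em * e .ez) (by
      rw [map_mul, hΦ .em, hΦ]; exact c.tmul_mul_coE_ez _ _)
    (he2 .em .ez) (c.t_mem (-2)) (he .em) (c.t_mul_w_mem (-2))
  refine ⟨?_, ?_, ?_, ?_, ?_, ?_⟩ <;> simp [hpm, hpz, hmz, c.t_zero]

theorem ver_three_forms (c : CircleRules q gr' t w) (he : ∀ s, e s ∈ gr 1)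
    (hΦ : ∀ s, Φ (e s) = of ℂ gr gr' (coE e t w s)) :
    ver Φ 3 0 (e .ep * e .em * e .ez) = (e .ep * e .em * e .ez) ⊗ₜ[ℂ] 1 ∧
      ver Φ 2 1 (e .ep * e .em * e .ez) = (e .ep * e .em) ⊗ₜ[ℂ] w := by
  have he2 : e .ep * e .em ∈ gr 2 := SetLike.GradedMul.mul_mem (he .ep) (he .em)
  have he3 : e .ep * e .em * e .ez ∈ gr 3 := SetLike.GradedMul.mul_mem he2 (he .ez)
  have h := ver_tmul_add_tmul (Φ := Φ) (ω := e .ep * e .em * e .ez) (by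
      rw [map_mul, map_mul, hΦ .ep, hΦ .em, hΦ .ez]
      exact (congrArg (· * _) (c.tmul_mul _ _ _ _)).trans (c.tmul_mul_coE_ez _ _))
    he3 (c.t_mem (2 + -2)) he2 (c.t_mul_w_mem (2 + -2))
  refine ⟨?_, ?_⟩ <;> simp [h, c.t_zero]

end ComponentValues

end QHopf
end

open QHopf
theorem mainTheorem10 (q : ℂ) (hq : q ≠ 0) (hq2 : q ^ 2 ≠ -1) :
    ∃ (dH : CForm q →ₗ[ℂ] CForm q) (dA : Form q →ₗ[ℂ] Form q),
      -- the calculus on `H = ℂ[t, t⁻¹]`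
      (IsDifferentialCalculus (CForm.incl q) (CForm.gr q) dH ∧
        dH (CForm.t q 1) = CForm.dt q ∧
        CForm.dt q * CForm.t q 1 = q ^ 2 • (CForm.t q 1 * CForm.dt q) ∧
        IsLeftBasis (CForm.incl q) (CForm.gr q 1) ![CForm.dt q] ∧
        (∀ n, 2 ≤ n → CForm.gr q n = ⊥) ∧
        IsMaximalProlongation (CForm.incl q) (CForm.gr q) dH ∧
        (∃ Δ, IsRightCovariant (Bialgebra.comulAlgHom ℂ (LaurentPolynomial ℂ)) (CForm.incl q)
          (CForm.gr q) dH Δ) ∧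
        (∃ Δ, IsLeftCovariant (H := LaurentPolynomial ℂ) (CForm.incl q) (CForm.gr q) dH Δ) ∧
        ∃ Δ, IsDGExtension (Bialgebra.comulAlgHom ℂ (LaurentPolynomial ℂ))
          (CForm.incl q) (CForm.gr q) dH (CForm.incl q) (CForm.gr q) dH Δ) ∧
      -- the calculus on `A = O_q(SU(2))`: the one-forms `e⁺, e⁻, e⁰`
      (Form.e q .ep = q⁻¹ • (Form.x q .al * dA (Form.x q .ga)) -
          q⁻¹ ^ 2 • (Form.x q .ga * dA (Form.x q .al)) ∧
        Form.e q .em = Form.x q .de * dA (Form.x q .be) - q • (Form.x q .be * dA (Form.x q .de)) ∧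
        Form.e q .ez = Form.x q .de * dA (Form.x q .al) -
          q • (Form.x q .be * dA (Form.x q .ga)) ∧
        ∀ s f, Form.e q s * Form.x q f = q ^ (s.wt * f.deg) • (Form.x q f * Form.e q s)) ∧
      -- the relations in degree two and three
      (Form.e q .ep * Form.e q .em = -(q⁻¹ ^ 2) • (Form.e q .em * Form.e q .ep) ∧
        Form.e q .ep * Form.e q .ez = -(q⁻¹ ^ 4) • (Form.e q .ez * Form.e q .ep) ∧
        Form.e q .em * Form.e q .ez = -(q ^ 4) • (Form.e q .ez * Form.e q .em) ∧
        (∀ s, Form.e q s * Form.e q s = 0) ∧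
        dA (Form.e q .ez) = q ^ 3 • (Form.e q .ep * Form.e q .em) ∧
        dA (Form.e q .ep) = -(q ^ 2 * (1 + q⁻¹ ^ 2)) • (Form.e q .ep * Form.e q .ez) ∧
        dA (Form.e q .em) = (q⁻¹ ^ 2 * (1 + q⁻¹ ^ 2)) • (Form.e q .em * Form.e q .ez) ∧
        dA (Form.e q .ep * Form.e q .em) = -(q⁻¹ ^ 2) • dA (Form.e q .em * Form.e q .ep) ∧
        dA (Form.e q .ep * Form.e q .ez) = -(q⁻¹ ^ 4) • dA (Form.e q .ez * Form.e q .ep) ∧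
        dA (Form.e q .em * Form.e q .ez) = -(q ^ 4) • dA (Form.e q .ez * Form.e q .em)) ∧
      -- the modules of forms are free
      (IsLeftBasis (Form.incl q) (Form.gr q 1) ![Form.e q .ep, Form.e q .em, Form.e q .ez] ∧
        IsLeftBasis (Form.incl q) (Form.gr q 2) ![Form.e q .ep * Form.e q .em,
          Form.e q .ep * Form.e q .ez, Form.e q .em * Form.e q .ez] ∧
        IsLeftBasis (Form.incl q) (Form.gr q 3)
          ![Form.e q .ep * Form.e q .em * Form.e q .ez] ∧
        ∀ n, 3 < n → Form.gr q n = ⊥) ∧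
      -- completeness
      IsCompleteCalculus (coaction q) (Form.incl q) (Form.gr q) dA
        (CForm.incl q) (CForm.gr q) dH ∧
      -- the components of the extended coaction
      ∀ Φ : Form q →ₐ[ℂ] GradedTensorProduct ℂ (Form.gr q) (CForm.gr q),
        IsDGExtension (coaction q) (Form.incl q) (Form.gr q) dA
          (CForm.incl q) (CForm.gr q) dH Φ →
        -- degree one
        (ver Φ 1 0 (Form.e q .ep) = Form.e q .ep ⊗ₜ[ℂ] CForm.t q 2 ∧
          ver Φ 1 0 (Form.e q .em) = Form.e q .em ⊗ₜ[ℂ] CForm.t q (-2) ∧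
          ver Φ 1 0 (Form.e q .ez) = Form.e q .ez ⊗ₜ[ℂ] (1 : CForm q) ∧
          ver Φ 0 1 (Form.e q .ep) = 0 ∧
          ver Φ 0 1 (Form.e q .em) = 0 ∧
          ver Φ 0 1 (Form.e q .ez) = (1 : Form q) ⊗ₜ[ℂ] (CForm.t q (-1) * CForm.dt q)) ∧
        -- degree two
        (ver Φ 2 0 (Form.e q .ep * Form.e q .em) =
            (Form.e q .ep * Form.e q .em) ⊗ₜ[ℂ] (1 : CForm q) ∧
          ver Φ 2 0 (Form.e q .ep * Form.e q .ez) =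
            (Form.e q .ep * Form.e q .ez) ⊗ₜ[ℂ] CForm.t q 2 ∧
          ver Φ 2 0 (Form.e q .em * Form.e q .ez) =
            (Form.e q .em * Form.e q .ez) ⊗ₜ[ℂ] CForm.t q (-2) ∧
          ver Φ 1 1 (Form.e q .ep * Form.e q .em) = 0 ∧
          ver Φ 1 1 (Form.e q .ep * Form.e q .ez) =
            Form.e q .ep ⊗ₜ[ℂ] (CForm.t q 1 * CForm.dt q) ∧
          ver Φ 1 1 (Form.e q .em * Form.e q .ez) =
            Form.e q .em ⊗ₜ[ℂ] (CForm.t q (-3) * CForm.dt q) ∧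
          ver Φ 0 2 = 0) ∧
        -- degree three
        (ver Φ 3 0 (Form.e q .ep * Form.e q .em * Form.e q .ez) =
            (Form.e q .ep * Form.e q .em * Form.e q .ez) ⊗ₜ[ℂ] (1 : CForm q) ∧
          ver Φ 2 1 (Form.e q .ep * Form.e q .em * Form.e q .ez) =
            (Form.e q .ep * Form.e q .em) ⊗ₜ[ℂ] (CForm.t q (-1) * CForm.dt q) ∧
          ver Φ 1 2 = 0 ∧ ver Φ 0 3 = 0) ∧
        -- the components are determined by these values: they are left linear along `Δ_A`
        (∀ i j a ω, ver Φ i j (Form.incl q a * ω) =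
          Algebra.TensorProduct.map (Form.incl q) (CForm.incl q) (coaction q a) * ver Φ i j ω) ∧
        -- the components with values in `Ω(A) ⊗ H` make the calculus right covariant
        ∃ Δ, IsRightCovariant (coaction q) (Form.incl q) (Form.gr q) dA Δ ∧
          ∀ n, ∀ ω ∈ Form.gr q n,
            TensorProduct.map LinearMap.id (CForm.incl q).toLinearMap (Δ ω) = ver Φ n 0 ω := by
  obtain ⟨dH, hH⟩ := CForm.exists_isDifferential hq hq2
  obtain ⟨dA, hA⟩ := Form.exists_isDifferential hq
  obtain ⟨ΔH, hΔH⟩ := CForm.exists_coaction q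
  obtain ⟨ΔA, hΔA⟩ := Form.exists_coaction q
  obtain ⟨Ψ, hΨ, hx, he⟩ := hA.exists_isDGExtension hH hq hq2
  have r := formRules hq (Form.rel (q := q))
  have hA₀ := hA.isFormDifferential
  have c := CForm.circleRules hq hq2
  have bot := CForm.gr_eq_bot hq hq2
  refine ⟨dH, dA, ⟨hH.isDifferentialCalculus hq hq2, hH.d_t_one, CForm.dt_mul_t_one,
    CForm.isLeftBasis hq hq2, bot, hH.isMaximalProlongation hq hq2,
    ⟨ΔH, hH.isRightCovariant hΔH⟩, ⟨_, hH.isLeftCovariant hΔH⟩, hH.exists_isDGExtension hq2⟩,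
    ⟨hA₀.ep_eq hq r, hA₀.em_eq hq r, hA₀.ez_eq r, fun s f => Form.rel _ _ (.comm s f)⟩,
    ⟨Form.rel _ _ .ep_em, Form.rel _ _ .ep_ez, Form.rel _ _ .em_ez, r.sq, hA₀.d_e .ez,
      hA₀.d_e .ep, hA₀.d_e .em, ?_, ?_, ?_⟩,
    ⟨Form.isLeftBasis_one hq, Form.isLeftBasis_two hq, Form.isLeftBasis_three hq,
      Form.gr_eq_bot hq⟩,
    ⟨coaction_isQuantumPrincipalBundle q, hA.isDifferentialCalculus hq, Ψ, hΨ⟩, ?_⟩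
  · exact (congrArg dA (Form.rel _ _ .ep_em)).trans (map_smul dA _ _)
  · exact (congrArg dA (Form.rel _ _ .ep_ez)).trans (map_smul dA _ _)
  · exact (congrArg dA (Form.rel _ _ .em_ez)).trans (map_smul dA _ _)
  intro Φ hΦ
  -- An arbitrary extension is the constructed one, so its values on the generators are known.
  obtain rfl := hA.isDGExtension_unique hq hΦ hΨ
  have e1 : CForm.t q 2 * (CForm.t q (-1) * CForm.dt q) = CForm.t q 1 * CForm.dt q := by
    rw [← mul_assoc, ← CForm.t_add]; rfl
  have e2 : CForm.t q (-2) * (CForm.t q (-1) * CForm.dt q) = CForm.t q (-3) * CForm.dt q := by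
    rw [← mul_assoc, ← CForm.t_add]; rfl
  obtain ⟨v1, v2, v3, v4, v5, v6⟩ := ver_two_forms c Form.e_mem he
  obtain ⟨v7, v8⟩ := ver_three_forms c Form.e_mem he
  rw [e1] at v5
  rw [e2] at v6
  -- The components with second degree at least two vanish because the circle has no forms there.
  refine ⟨ver_one_forms c Form.e_mem he, ⟨v1, v2, v3, v4, v5, v6,
    ver_eq_zero_of_eq_bot 0 (bot 2 le_rfl)⟩, ⟨v7, v8, ver_eq_zero_of_eq_bot 1 (bot 2 le_rfl),
      ver_eq_zero_of_eq_bot 0 (bot 3 (by norm_num))⟩, ?_, ΔA, hA.isRightCovariant hΔA,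
    Form.map_incl_coaction_of_mem hA hΔA hx he⟩
  intro i j a ω
  have h := map_proj_mul (gr := Form.gr q) (gr' := CForm.gr q) Form.incl_mem CForm.incl_mem i j
    (coaction q a) ((GradedTensorProduct.of ℂ (Form.gr q) (CForm.gr q)).symm (Φ ω))
  rw [← hΦ.extends_coaction] at h
  rw [ver_apply, ver_apply, map_mul, ← hΦ.extends_coaction]
  exact h
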